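/- Let $n,l$ be positive integers and $m$ an integer with $l<2^m$. Let $g:\{0,1\}^n\to\{0,1\}$, and for every sequence $(x_1,\dots,x_k)$ of strings in $\{0,1\}^n$ with $0\le k\le l$ let $s_{(x_1,\dots,x_k)}\in\{0,1\}^n$ be such that $$g\big(s_{(x_1,\dots,x_k)}\big)=s_{(x_1,\dots,x_{k-1})}\cdot x_k \bmod 2\qquad(1\le k\le l).$$ Write $s_\emptyset$ for the secret of the empty sequence. **Program.** Let $p,q$ be quantum variables over $\mathbb C^{2^m}$, let $Y,Y',Z$ be qubits, and let $X$ be an array of quantum variables $X[i]$ over $\mathbb C^{2^n}$ ($0\le i<2^m$); an operator $A$ on the element $X[q]$ means $\sum_i|i\rangle\langle i|_q\otimes A_{X[i]}$. The recursive procedure $\mathrm{RQFS}(q,Y)$ has the body $$\mathbf{if}\ \square\,k\cdot M[q]=k\to S_k,\qquad M=\Big\{\textstyle\sum_{i<l}|i\rangle\langle i|,\ |l\rangle\langle l|,\ \sum_{l<i<2^m}|i\rangle\langle i|\Big\},$$ where $S_2=\bot$; $S_1$ is $(X[1],\dots,X[l],Y)\mathrel{*}=\mathcal O$ with $\mathcal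 O|x_1\rangle\cdots|x_l\rangle|y\rangle=|x_1\rangle\cdots|x_l\rangle|y\oplus g(s_{(x_1,\dots,x_l)})\rangle$; and $S_0$ is $$\begin{aligned}&q\mathrel{*}=U_{+1};\ \mathbf{local}\ X[q],Y';\ (X[q],Y')\mathrel{*}=H^{\otimes n}\otimes HX;\ \mathbf{call}\ \mathrm{RQFS}(q,Y');\ X[q]\mathrel{*}=H^{\otimes n};\ (X[q],Y)\mathrel{*}=\mathcal G;\\ &X[q]\mathrel{*}=H^{\otimes n};\ \mathbf{call}\ \mathrm{RQFS}(q,Y');\ (X[q],Y')\mathrel{*}=H^{\otimes n}\otimes XH;\ \mathbf{release}\ X[q],Y';\ q\mathrel{*}=U_{-1},\end{aligned}$$ with $U_{\pm1}|i\rangle=|i\pm1 \bmod 2^m\rangle$, $\mathcal G|x\rangle|y\rangle=|x\rangle|y\oplus g(x)\rangle$, $H$ the Hadamard gate, and, in $HX$ and $XH$, $X$ the Pauli gate. The main program $\mathit{main}$ is $$(p,Z):=|0\rangle;\ \mathbf{call}\ \mathrm{RQFS}(p,Z);\ \mathbf{if}\ \square\,k\cdot M'[Z]=k\to\mathbf{skip},\qquad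 M'=\{|0\rangle\langle0|,|1\rangle\langle1|\}.$$ Besides these, arbitrarily many further variables of each type are available to the proof. **Proof system.** Assertions are parameterized quantum predicate terms $\mathcal E^*(\mathcal B)+\mathcal F^*(I)$, where $\mathcal B$ is a tensor product of quantum predicate variables on disjoint sets of quantum variables (its factors are the *parameters* of the term), and $\mathcal E,\mathcal F$ are quantum operations with $\mathcal E^*(I)+\mathcal F^*(I)\sqsubseteq I$. $\mathrm{trueOrder}$ is the set of formulas $P\sqsubseteq Q$, with $P,Q$ having the same parameters, that hold in the Löwner order for all values of the parameters. A substitution $[r/q]$ of variables is a type-preserving injective renaming that fixes the global variables of the procedures. The system qPP derives partial-correctness triples by * (A Bot) $\{I\}\bot\{P\}$; (A Skip) $\{P\}\mathbf{skip}\{P\}$; (A Init) $\{\sum_k|k\rangle_q\langle0|P|0\rangle_q\langle k|\}\;q:=|0\rangle\;\{P\}$; (A Unit) $\{U^\dagger PU\}\;q\mathrel{*}=U\;\{P\}$; * (R Comp) from $\{P\}S_1\{Q\}$ and $\{Q\}S_2\{R\}$ infer $\{P\}S_1;S_2\{R\}$; * (R Case) from $\{P_k\}S_k\{Q\}$ for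 all $k$ infer $\{\sum_kM_k^\dagger P_kM_k\}\;\mathbf{if}\ \square\,k\cdot M[q]=k\to S_k\;\{Q\}$; * (R Order) from $P\sqsubseteq P'$, $\{P'\}S\{Q'\}$ and $Q'\sqsubseteq Q$ infer $\{P\}S\{Q\}$; * (R Subst) from $\{P\}S\{Q\}$ infer $\{P[R/\mathcal X]\}S\{Q[R/\mathcal X]\}$, for a term $R$ on the variables of the predicate variable $\mathcal X$ (where, if $P$ or $Q$ has two or more parameters, $R$ has the form $\mathcal E^*(\mathcal B)$ or $\mathcal F^*(I)$); * (R Loc) from $\{P\}\;r:=|0\rangle;S[r/q]\;\{Q\}$ infer $\{P\}\;\mathbf{local}\ q;S;\mathbf{release}\ q\;\{Q\}$, where $P$ and $Q$ act as the identity on $r$ and have no parameters on $r$; * (R Adap) from $\{P\}S\{Q\}$ infer $\{P[r/q]\}S[r/q]\{Q[r/q]\}$; * (Rp pRec) if, for the bodies $S_i$ of the procedures $f_i(y_i)$, all triples $\{P_i\}S_i\{Q_i\}$ (with $P_i,Q_i$ having the same parameters) are derivable by the preceding rules from the hypotheses $\{P_i\}\mathbf{call}\,f_i(y_i)\{Q_i\}$,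 infer each $\{P_i\}\mathbf{call}\,f_i(y_i)\{Q_i\}$. **Claim.** The partial-correctness triple $$\big\{I_p\otimes I_Z\big\}\ \mathit{main}\ \big\{|0\rangle\langle0|_p\otimes|g(s_\emptyset)\rangle\langle g(s_\emptyset)|_Z\big\}$$ is derivable in qPP from $\mathrm{trueOrder}$. More precisely, there is an $N_0$ such that for every $N\ge N_0$ it is derivable when $N$ further variables of each type (counters, strings, qubits) are available. -/

import Mathlib

open scoped Matrix ComplexOrder

noncomputable section

namespace QHL

/-! ## Signatures, variables, states -/

/-- A signature: finite types with computational bases, simple variable names, array names, and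
procedure names with typed parameter lists.  An array of `Arr ι τ` has components of type `τ`,
one for each basis state of the index type `ι`.  `zero τ` labels the basis state `|0⟩`. -/
structure Sig where
  Ty : Type
  Val : Ty → Type
  Name : Ty → Type
  Arr : Ty → Ty → Type
  Proc : Type
  Par : Proc → Type
  parTy : ∀ f, Par f → Ty
  zero : ∀ τ, Val τ
  finTy : Finite Ty
  finVal : ∀ τ, Finite (Val τ)
  finName : ∀ τ, Finite (Name τ)
  finArr : ∀ ι τ, Finite (Arr ι τ)

attribute [instance] Sig.finTy Sig.finVal Sig.finName Sig.finArr

/-- A quantum variable of type `τ`: a simple variable, or the component `a[k]` of an array. -/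
abbrev Var (S : Sig) (τ : S.Ty) : Type := S.Name τ ⊕ (Σ ι : S.Ty, S.Arr ι τ × S.Val ι)

/-- A quantum variable of any type. -/
abbrev AnyVar (S : Sig) : Type := Σ τ : S.Ty, Var S τ

/-- A computational basis state of the whole system: one basis label for each variable. -/
def Conf (S : Sig) : Type := ∀ v : AnyVar S, S.Val v.1

/-- Values of a tuple with component types `Γ`: basis labels of the tensor product space. -/
def Vals (S : Sig) {ι : Type} (Γ : ι → S.Ty) : Type := ∀ i, S.Val (Γ i)

instance (S : Sig) : Finite (Conf S) := inferInstanceAs (Finite (∀ v : AnyVar S, S.Val v.1))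

instance (S : Sig) {ι : Type} [Finite ι] (Γ : ι → S.Ty) : Finite (Vals S Γ) :=
  inferInstanceAs (Finite (∀ i, S.Val (Γ i)))

instance (S : Sig) : Fintype (Conf S) := Fintype.ofFinite _
instance (S : Sig) : DecidableEq (Conf S) := Classical.decEq _
instance (S : Sig) {ι : Type} [Finite ι] (Γ : ι → S.Ty) : Fintype (Vals S Γ) := Fintype.ofFinite _
instance (S : Sig) {ι : Type} (Γ : ι → S.Ty) : DecidableEq (Vals S Γ) := Classical.decEq _

/-- Linear operators on the state space of the whole system.  An operator on the space of some of
the variables is identified with its tensor product with the identity on the others. -/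
abbrev Op (S : Sig) : Type := Matrix (Conf S) (Conf S) ℂ

/-- The Löwner order: `B - A` is positive. -/
def Loewner {S : Sig} (A B : Op S) : Prop := (B - A).PosSemidef

/-- Quantum predicates: `0 ⊑ A ⊑ I`. -/
def IsPred {S : Sig} (A : Op S) : Prop := Loewner 0 A ∧ Loewner A 1

/-- `A` has the form `A₀ ⊗ I` with `A₀` an operator on the space of the variables in `s`. -/
def LocalTo {S : Sig} (s : Set (AnyVar S)) (A : Op S) : Prop :=
  ∃ A₀ : (∀ v : s, S.Val v.1.1) → (∀ v : s, S.Val v.1.1) → ℂ, ∀ x y : Conf S,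
    ((∀ v, v ∉ s → x v = y v) → A x y = A₀ (fun v => x v) (fun v => y v)) ∧
    ((∃ v, v ∉ s ∧ x v ≠ y v) → A x y = 0)

/-! ## References to variables, and operators on tuples of references -/

/-- What a program text may refer to: a variable, or the array element `a[i]` selected by the
basis state of the quantum variable `i`. -/
inductive Ref (S : Sig) : S.Ty → Type
  | var {τ : S.Ty} (v : Var S τ) : Ref S τ
  | elem {ι τ : S.Ty} (a : S.Arr ι τ) (i : Var S ι) : Ref S τ

/-- A tuple of references with component types `Γ`. -/
abbrev Refs (S : Sig) {ι : Type} (Γ : ι → S.Ty) : Type := ∀ i, Ref S (Γ i)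

/-- The variable that a reference denotes in the basis state `x`. -/
def Ref.target {S : Sig} (x : Conf S) : {τ : S.Ty} → Ref S τ → Var S τ
  | _, .var v => v
  | _, .elem a i => Sum.inr ⟨_, a, x ⟨_, i⟩⟩

/-- The index variable of an array element. -/
def Ref.index {S : Sig} : {τ : S.Ty} → Ref S τ → Set (AnyVar S)
  | _, .var _ => ∅
  | _, .elem _ i => {⟨_, i⟩}

/-- The variable named by a reference that is not an array element. -/
def Ref.named {S : Sig} : {τ : S.Ty} → Ref S τ → Set (AnyVar S)
  | _, .var v => {⟨_, v⟩}
  | _, .elem _ _ => ∅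

/-- The variable denoted by the `i`-th reference of a tuple in the basis state `x`. -/
def targetAt {S : Sig} {ι : Type} {Γ : ι → S.Ty} (q : Refs S Γ) (x : Conf S) (i : ι) : AnyVar S :=
  ⟨Γ i, (q i).target x⟩

/-- The references of `q` always denote pairwise distinct variables, none of which is used as an
index in `q`. -/
def Distinct {S : Sig} {ι : Type} {Γ : ι → S.Ty} (q : Refs S Γ) : Prop :=
  ∀ x : Conf S, Function.Injective (targetAt q x) ∧ ∀ i j, targetAt q x i ∉ (q j).index

/-- The basis label of the tuple `q` in the basis state `x`. -/
def readAt {S : Sig} {ι : Type} {Γ : ι → S.Ty} (q : Refs S Γ) (x : Conf S) : Vals S Γ :=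
  fun i => x (targetAt q x i)

open Classical in
/-- The operator `A` applied to the tuple `q`, and the identity to everything else.  For a tuple of
variables this is `A_q ⊗ I`; for an array element `a[i]` it is `∑ₖ |k⟩⟨k|_i ⊗ A_{a[k]}`. -/
def lift {S : Sig} {ι : Type} {Γ : ι → S.Ty} (q : Refs S Γ) (A : Matrix (Vals S Γ) (Vals S Γ) ℂ) :
    Op S :=
  Matrix.of fun x y =>
    if ∀ v, (∀ i, v ≠ targetAt q x i) → x v = y v then A (readAt q x) (readAt q y) else 0

/-! ## Programs -/

/-- Statements: `⊥`, `skip`, `q := |0⟩`, `q *= U`, `S₁; S₂`, `if □ m · M[q] = m → Sₘ`,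
`local q; S; release q`, `call f(a)`. -/
inductive Stmt (S : Sig) : Type 1
  | bot : Stmt S
  | skip : Stmt S
  | init {ι : Type} [Finite ι] {Γ : ι → S.Ty} (q : Refs S Γ) : Stmt S
  | unit {ι : Type} [Finite ι] {Γ : ι → S.Ty} (q : Refs S Γ)
      (U : Matrix (Vals S Γ) (Vals S Γ) ℂ) : Stmt S
  | seq (S₁ S₂ : Stmt S) : Stmt S
  | case {ι : Type} [Finite ι] {Γ : ι → S.Ty} (q : Refs S Γ) {μ : Type} [Fintype μ]
      (M : μ → Matrix (Vals S Γ) (Vals S Γ) ℂ) (b : μ → Stmt S) : Stmt S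
  | loc {ι : Type} [Finite ι] {Γ : ι → S.Ty} (q : Refs S Γ) (body : Stmt S) : Stmt S
  | call (f : S.Proc) (a : ∀ i : S.Par f, S.Name (S.parTy f i)) : Stmt S

/-- The variables occurring free in a statement, apart from those reached only through an array
element.  Local variables are bound; the index of a local array element is not. -/
def Stmt.free {S : Sig} : Stmt S → Set (AnyVar S)
  | .bot => ∅
  | .skip => ∅
  | @Stmt.init _ _ _ _ q => ⋃ i, ((q i).named ∪ (q i).index)
  | @Stmt.unit _ _ _ _ q _ => ⋃ i, ((q i).named ∪ (q i).index)
  | .seq S₁ S₂ => S₁.free ∪ S₂.free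
  | @Stmt.case _ _ _ _ q _ _ _ b => (⋃ i, ((q i).named ∪ (q i).index)) ∪ ⋃ m, (b m).free
  | @Stmt.loc _ _ _ _ q body => (body.free \ ⋃ i, (q i).named) ∪ ⋃ i, (q i).index
  | .call f a => Set.range fun i => (⟨S.parTy f i, Sum.inl (a i)⟩ : AnyVar S)

/-- Procedure declarations: for each procedure, distinct formal parameters and a body. -/
structure Decl (S : Sig) where
  formal : ∀ (f : S.Proc) (i : S.Par f), S.Name (S.parTy f i)
  formal_inj : ∀ f,
    Function.Injective fun i => (⟨S.parTy f i, Sum.inl (formal f i)⟩ : AnyVar S)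
  body : S.Proc → Stmt S

/-- The global variables of the declared procedures: free in a body, and not a formal parameter. -/
def Decl.globals {S : Sig} (D : Decl S) : Set (AnyVar S) :=
  ⋃ f, (D.body f).free \ Set.range fun i => (⟨S.parTy f i, Sum.inl (D.formal f i)⟩ : AnyVar S)

/-! ## Renaming of variables

The substitution `[p/q]` of distinct variables for distinct variables, with `p` fresh except where
it is a variable of `q`, is given by a type-preserving permutation of the simple variable names. -/

/-- A type-preserving renaming of the simple variables. -/
abbrev Ren (S : Sig) : Type := ∀ τ : S.Ty, Equiv.Perm (S.Name τ)

def Var.ren {S : Sig} (σ : Ren S) {τ : S.Ty} (v : Var S τ) : Var S τ := Sum.map (σ τ) id v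

def AnyVar.ren {S : Sig} (σ : Ren S) (v : AnyVar S) : AnyVar S := ⟨v.1, Var.ren σ v.2⟩

def Ref.ren {S : Sig} (σ : Ren S) : {τ : S.Ty} → Ref S τ → Ref S τ
  | _, .var v => .var (Var.ren σ v)
  | _, .elem a i => .elem a (Var.ren σ i)

/-- Renaming of a statement (local variables included). -/
def Stmt.ren {S : Sig} (σ : Ren S) : Stmt S → Stmt S
  | .bot => .bot
  | .skip => .skip
  | @Stmt.init _ _ _ _ q => .init fun i => (q i).ren σ
  | @Stmt.unit _ _ _ _ q U => .unit (fun i => (q i).ren σ) U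
  | .seq S₁ S₂ => .seq (S₁.ren σ) (S₂.ren σ)
  | @Stmt.case _ _ _ _ q _ _ M b => .case (fun i => (q i).ren σ) M fun m => (b m).ren σ
  | @Stmt.loc _ _ _ _ q body => .loc (fun i => (q i).ren σ) (body.ren σ)
  | .call f a => .call f fun i => σ _ (a i)

/-- Renaming of an operator: the renamed operator does to `σ v` what `A` does to `v`. -/
def Op.ren {S : Sig} (σ : Ren S) (A : Op S) : Op S :=
  Matrix.of fun x y => A (fun v => x (AnyVar.ren σ v)) (fun v => y (AnyVar.ren σ v))

/-- `σ` leaves every variable in `s` unchanged. -/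
def Ren.Fixes {S : Sig} (σ : Ren S) (s : Set (AnyVar S)) : Prop := ∀ v ∈ s, AnyVar.ren σ v = v

/-! ## Parameterized quantum predicate terms -/

/-- A quantum predicate variable `𝒳_q`, ranging over the quantum predicates on the variables
`q = supp`. -/
structure PVar (S : Sig) where
  name : ℕ
  supp : Set (AnyVar S)

def PVar.ren {S : Sig} (σ : Ren S) (X : PVar S) : PVar S := ⟨X.name, AnyVar.ren σ '' X.supp⟩

/-- Assignments of quantum predicates to the quantum predicate variables. -/
def IsAssignment {S : Sig} (v : PVar S → Op S) : Prop :=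
  ∀ X, LocalTo X.supp (v X) ∧ IsPred (v X)

/-- The dual `ℰ*(A) = ∑ₖ Eₖ† A Eₖ` of the operation `ℰ = ∑ₖ Eₖ ◇ Eₖ†`, given by Kraus operators. -/
def dual {S : Sig} (E : List (Op S)) (A : Op S) : Op S := (E.map fun K => Kᴴ * A * K).sum

/-- A parameterized quantum predicate term `ℰ*(ℬ) + ℱ*(I)`: the base `ℬ` is the tensor product of
the predicate variables in `params`, which have pairwise disjoint variables (and of the identity on
the other variables), and `ℰ`, `ℱ` are quantum operations in Kraus form with
`ℰ*(I) + ℱ*(I) ⊑ I`. -/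
structure PQPT (S : Sig) where
  params : List (PVar S)
  disj : params.Pairwise fun X Y => X ≠ Y ∧ Disjoint X.supp Y.supp
  E : List (Op S)
  F : List (Op S)
  bound : Loewner (dual E 1 + dual F 1) 1

/-- The set of parameters. -/
def PQPT.Params {S : Sig} (P : PQPT S) : Set (PVar S) := {X | X ∈ P.params}

/-- The denotation under an assignment.  The factors of the base act on disjoint sets of variables,
so their product is their tensor product. -/
def PQPT.den {S : Sig} (P : PQPT S) (v : PVar S → Op S) : Op S :=
  dual P.E (P.params.map v).prod + dual P.F 1

/-- `R` is a term on the variables `s`. -/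
def PQPT.On {S : Sig} (R : PQPT S) (s : Set (AnyVar S)) : Prop :=
  (∀ Y ∈ R.params, Y.supp ⊆ s) ∧ (∀ K ∈ R.E, LocalTo s K) ∧ ∀ K ∈ R.F, LocalTo s K

/-- `P'` is the renamed term `P[σ]`. -/
def IsRen {S : Sig} (σ : Ren S) (P P' : PQPT S) : Prop :=
  P'.params = P.params.map (PVar.ren σ) ∧ P'.E = P.E.map (Op.ren σ) ∧ P'.F = P.F.map (Op.ren σ)

open Classical in
/-- `P'` is (a term denoting) the result `P[R/𝒳]` of substituting `R` for `𝒳` in `P`; if `P` has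
two or more parameters, `R` must be of the form `ℰ*(ℬ)` or `ℱ*(I)`. -/
def IsSubst {S : Sig} (X : PVar S) (R P P' : PQPT S) : Prop :=
  (2 ≤ P.params.length → R.E = [] ∨ R.F = []) ∧
  P'.Params = {Y | (Y ∈ P.Params ∧ Y ≠ X) ∨ (X ∈ P.Params ∧ Y ∈ R.Params)} ∧
  ∀ v, IsAssignment v → P'.den v = P.den (Function.update v X (R.den v))

/-- The tuple `r` is fresh for `P`, i.e. `P` has the form `P₀ ⊗ I_r`: no parameter of `P` ranges
over predicates on variables that `r` may denote, and `P` acts as the identity on `r` (it commutes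
with all operators on `r`). -/
def Fresh {S : Sig} {ι : Type} {Γ : ι → S.Ty} (r : Refs S Γ) (P : PQPT S) : Prop :=
  (∀ X ∈ P.Params, ∀ x i, targetAt r x i ∉ X.supp) ∧
  ∀ v, IsAssignment v → ∀ A : Matrix (Vals S Γ) (Vals S Γ) ℂ, Commute (lift r A) (P.den v)

/-- The set of true Löwner ordering formulas `P ⊑ Q`, as a set of pairs `(P, Q)`. -/
def trueOrder (S : Sig) : Set (PQPT S × PQPT S) :=
  {c | c.1.Params = c.2.Params ∧ ∀ v, IsAssignment v → Loewner (c.1.den v) (c.2.den v)}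

/-! ## The proof systems -/

/-- Partial-correctness triples `{pre} prog {post}`. -/
structure Triple (S : Sig) where
  pre : PQPT S
  prog : Stmt S
  post : PQPT S

/-- `QBE D T A P S Q`: the triple `{P} S {Q}` is derivable from the Löwner ordering formulas in `T`
and the triples in `A` by the axioms and rules of the extended base proof system.
A precondition displayed as a formula, such as `U† P U`, stands for any term that has the same
parameters as `P` and denotes it. -/
inductive QBE {S : Sig} (D : Decl S) (T : Set (PQPT S × PQPT S)) (A : Set (Triple S)) :
    PQPT S → Stmt S → PQPT S → Prop
  | hyp {P C Q} (h : (⟨P, C, Q⟩ : Triple S) ∈ A) : QBE D T A P C Q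
  /-- (A Bot) -/
  | bot {P' P : PQPT S} (hp : P'.Params = P.Params)
      (hd : ∀ v, IsAssignment v → P'.den v = 1) : QBE D T A P' .bot P
  /-- (A Skip) -/
  | skip {P : PQPT S} : QBE D T A P .skip P
  /-- (A Init) -/
  | init {ι : Type} [Finite ι] {Γ : ι → S.Ty} {q : Refs S Γ} {P' P : PQPT S} (hq : Distinct q)
      (hp : P'.Params = P.Params)
      (hd : ∀ v, IsAssignment v → P'.den v =
        ∑ k : Vals S Γ, (lift q (Matrix.single (fun i => S.zero (Γ i)) k 1))ᴴ * P.den v *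
          lift q (Matrix.single (fun i => S.zero (Γ i)) k 1)) :
      QBE D T A P' (.init q) P
  /-- (A Unit) -/
  | unit {ι : Type} [Finite ι] {Γ : ι → S.Ty} {q : Refs S Γ}
      {U : Matrix (Vals S Γ) (Vals S Γ) ℂ} {P' P : PQPT S} (hq : Distinct q)
      (hU : U * Uᴴ = 1 ∧ Uᴴ * U = 1) (hp : P'.Params = P.Params)
      (hd : ∀ v, IsAssignment v → P'.den v = (lift q U)ᴴ * P.den v * lift q U) :
      QBE D T A P' (.unit q U) P
  /-- (R Comp) -/
  | comp {P Q R : PQPT S} {C₁ C₂ : Stmt S} (h₁ : QBE D T A P C₁ Q) (h₂ : QBE D T A Q C₂ R) :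
      QBE D T A P (.seq C₁ C₂) R
  /-- (R Case) -/
  | case {ι : Type} [Finite ι] {Γ : ι → S.Ty} {q : Refs S Γ} {μ : Type} [Fintype μ]
      {M : μ → Matrix (Vals S Γ) (Vals S Γ) ℂ} {b : μ → Stmt S} {P : μ → PQPT S} {P' Q : PQPT S}
      (hq : Distinct q) (hM : ∑ m, (M m)ᴴ * M m = 1)
      (h : ∀ m, QBE D T A (P m) (b m) Q) (hp : P'.Params = Q.Params)
      (hd : ∀ v, IsAssignment v →
        P'.den v = ∑ m, (lift q (M m))ᴴ * (P m).den v * lift q (M m)) :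
      QBE D T A P' (.case q M b) Q
  /-- (R Order) -/
  | order {P P' Q' Q : PQPT S} {C : Stmt S} (hP : (P, P') ∈ T) (h : QBE D T A P' C Q')
      (hQ : (Q', Q) ∈ T) : QBE D T A P C Q
  /-- (R Subst) -/
  | subst {X : PVar S} {R P P' Q Q' : PQPT S} {C : Stmt S} (hR : R.On X.supp)
      (hP : IsSubst X R P P') (hQ : IsSubst X R Q Q') (h : QBE D T A P C Q) :
      QBE D T A P' C Q'
  /-- (R Loc), where `r = q[σ]` and `C[r/q] = C[σ]`.  A call is renamed through its actual
  parameters only, so a renaming has to fix the global variables of the procedures. -/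
  | loc {ι : Type} [Finite ι] {Γ : ι → S.Ty} {q : Refs S Γ} {C : Stmt S} {P Q : PQPT S}
      {σ : Ren S} (hg : σ.Fixes D.globals) (hf : σ.Fixes (Stmt.loc q C).free)
      (hr : Distinct fun i => (q i).ren σ)
      (hP : Fresh (fun i => (q i).ren σ) P) (hQ : Fresh (fun i => (q i).ren σ) Q)
      (h : QBE D T A P (.seq (.init fun i => (q i).ren σ) (C.ren σ)) Q) :
      QBE D T A P (.loc q C) Q
  /-- (R Adap) -/
  | adap {σ : Ren S} {P P' Q Q' : PQPT S} {C : Stmt S} (hg : σ.Fixes D.globals)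
      (hP : IsRen σ P P') (hQ : IsRen σ Q Q') (h : QBE D T A P C Q) :
      QBE D T A P' (C.ren σ) Q'

/-- The family of triples `{Pᵢ} call fᵢ(yᵢ) {Qᵢ}`, with the formal parameters as actual ones. -/
def callTriples {S : Sig} (D : Decl S) (P Q : S.Proc → PQPT S) : Set (Triple S) :=
  Set.range fun f => ⟨P f, .call f (D.formal f), Q f⟩

/-- The triples that (Rp pRec) infers: members of a family `{Pᵢ} call fᵢ(yᵢ) {Qᵢ}` from which,
taken as hypotheses, all `{Pᵢ} Sᵢ {Qᵢ}` for the bodies `Sᵢ` are derivable in the extended base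
proof system. -/
def pRecTriples {S : Sig} (D : Decl S) (T : Set (PQPT S × PQPT S)) : Set (Triple S) :=
  {t | ∃ P Q : S.Proc → PQPT S, (∀ f, (P f).Params = (Q f).Params) ∧
    (∀ f, QBE D T (callTriples D P Q) (P f) (D.body f) (Q f)) ∧ t ∈ callTriples D P Q}

/-- `T ⊢_qPP {P} C {Q}`: derivability in the proof system qPP for partial correctness, which is the
extended base proof system together with (Rp pRec). -/
def QPP {S : Sig} (D : Decl S) (T : Set (PQPT S × PQPT S)) (P : PQPT S) (C : Stmt S)
    (Q : PQPT S) : Prop :=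
  QBE D T (pRecTriples D T) P C Q

/-! ## Closed assertions -/

/-- A projection as a term without parameters. -/
def PQPT.ofProjection {S : Sig} (Pr : Op S) (h₁ : Prᴴ = Pr) (h₂ : Pr * Pr = Pr) : PQPT S where
  params := []
  disj := List.Pairwise.nil
  E := []
  F := [Pr]
  bound := by
    have h : (1 : Op S) - (dual [] 1 + dual [Pr] 1) = (1 - Pr)ᴴ * (1 - Pr) := by
      simp [dual, h₁, h₂, mul_sub, sub_mul]
    unfold Loewner
    rw [h]
    exact Matrix.posSemidef_conjTranspose_mul_self _

/-- The identity predicate `I`. -/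
def PQPT.one (S : Sig) : PQPT S := PQPT.ofProjection 1 (by simp) (by simp)

open Classical in
/-- The projection onto the span of the basis states with property `c`. -/
def PQPT.basis {S : Sig} (c : Conf S → Prop) : PQPT S :=
  PQPT.ofProjection (Matrix.diagonal fun x => if c x then 1 else 0)
    (by
      rw [Matrix.diagonal_conjTranspose]
      congr 1
      funext x
      by_cases h : c x <;> simp [h])
    (by
      rw [Matrix.diagonal_mul_diagonal]
      congr 1
      funext x
      by_cases h : c x <;> simp [h])

/-! ## Tuples and gates -/

def oneTy {S : Sig} (τ : S.Ty) : Unit → S.Ty := fun _ => τ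

def oneRef {S : Sig} {τ : S.Ty} (r : Ref S τ) : Refs S (oneTy τ) := fun _ => r

def pairTy {S : Sig} (τ₁ τ₂ : S.Ty) : Bool → S.Ty
  | false => τ₁
  | true => τ₂

def pairRef {S : Sig} {τ₁ τ₂ : S.Ty} (r₁ : Ref S τ₁) (r₂ : Ref S τ₂) : Refs S (pairTy τ₁ τ₂)
  | false => r₁
  | true => r₂

/-- An operator on the space of one reference. -/
def gate₁ {S : Sig} {τ : S.Ty} (A : Matrix (S.Val τ) (S.Val τ) ℂ) :
    Matrix (Vals S (oneTy τ)) (Vals S (oneTy τ)) ℂ :=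
  Matrix.of fun u w => A (u ()) (w ())

/-- An operator on the space of a pair of references. -/
def gate₂ {S : Sig} {τ₁ τ₂ : S.Ty}
    (A : Matrix (S.Val τ₁ × S.Val τ₂) (S.Val τ₁ × S.Val τ₂) ℂ) :
    Matrix (Vals S (pairTy τ₁ τ₂)) (Vals S (pairTy τ₁ τ₂)) ℂ :=
  Matrix.of fun u w => A (u false, u true) (w false, w true)

/-- The operator `|x⟩ ↦ |f x⟩`. -/
def basisMap {α : Type} [DecidableEq α] (f : α → α) : Matrix α α ℂ :=
  Matrix.of fun y x => if y = f x then 1 else 0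

/-- The Hadamard gate. -/
def hadamard : Matrix (ZMod 2) (ZMod 2) ℂ :=
  Matrix.of fun a b => (1 / (Real.sqrt 2 : ℂ)) * if a = 1 ∧ b = 1 then -1 else 1

/-- The Pauli `X` gate. -/
def pauliX : Matrix (ZMod 2) (ZMod 2) ℂ := basisMap fun a => a + 1

/-- `H^{⊗n}`. -/
def hadamardN (n : ℕ) : Matrix (Fin n → ZMod 2) (Fin n → ZMod 2) ℂ :=
  Matrix.of fun a b => ∏ i, hadamard (a i) (b i)

/-! ## Recursive quantum Fourier sampling -/

namespace RQFS

/-- The types: counters (space of dimension `2^m`), strings in `{0,1}^n`, and bits. -/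
inductive Ty : Type
  | cnt | str | bit

/-- Names of counters: `p`, `q`, and a reservoir. -/
inductive CntName (N : ℕ) : Type
  | p | q | fresh (k : Fin N)

/-- Names of qubits: `Y`, `Y'`, `Z`, and a reservoir. -/
inductive BitName (N : ℕ) : Type
  | Y | Y' | Z | fresh (k : Fin N)

/-- The parameters of the procedure: a counter and a target qubit. -/
inductive Par : Type
  | ctr | tgt

instance : Finite Ty :=
  Finite.of_injective (fun τ : Ty => match τ with
    | .cnt => (0 : Fin 3)
    | .str => 1
    | .bit => 2) fun a b => by cases a <;> cases b <;> simp

instance (N : ℕ) : Finite (CntName N) :=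
  Finite.of_injective (fun a : CntName N => match a with
    | .p => (Sum.inl 0 : Fin 2 ⊕ Fin N)
    | .q => Sum.inl 1
    | .fresh k => Sum.inr k) fun a b => by cases a <;> cases b <;> simp

instance (N : ℕ) : Finite (BitName N) :=
  Finite.of_injective (fun a : BitName N => match a with
    | .Y => (Sum.inl 0 : Fin 3 ⊕ Fin N)
    | .Y' => Sum.inl 1
    | .Z => Sum.inl 2
    | .fresh k => Sum.inr k) fun a b => by cases a <;> cases b <;> simp

abbrev Str (n : ℕ) : Type := Fin n → ZMod 2

abbrev Val (n m : ℕ) : Ty → Type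
  | .cnt => Fin (2 ^ m)
  | .str => Str n
  | .bit => ZMod 2

abbrev Name (N : ℕ) : Ty → Type
  | .cnt => CntName N
  | .str => Fin N
  | .bit => BitName N

/-- There is one array, `X`, of strings indexed by a counter. -/
abbrev Arr : Ty → Ty → Type
  | .cnt, .str => Unit
  | _, _ => Empty

abbrev parTy : Par → Ty
  | .ctr => .cnt
  | .tgt => .bit

/-- The signature, with a reservoir of `N` further simple variables of each type. -/
def sig (n m N : ℕ) : Sig where
  Ty := Ty
  Val := Val n m
  Name := Name N
  Arr := Arr
  Proc := Unit
  Par := fun _ => Par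
  parTy := fun _ => parTy
  zero := fun τ => match τ with
    | .cnt => ⟨0, Nat.two_pow_pos m⟩
    | .str => fun _ => 0
    | .bit => 0
  finTy := inferInstanceAs (Finite Ty)
  finVal := fun τ => by cases τ <;> infer_instance
  finName := fun τ => by cases τ <;> infer_instance
  finArr := fun ι τ => by cases ι <;> cases τ <;> infer_instance

section

variable (n m N : ℕ)

/-- The variables `q`, `p`, `Y`, `Y'`, `Z`. -/
def q : Ref (sig n m N) Ty.cnt := .var (Sum.inl (CntName.q : CntName N))
def p : Ref (sig n m N) Ty.cnt := .var (Sum.inl (CntName.p : CntName N))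
def Y : Ref (sig n m N) Ty.bit := .var (Sum.inl (BitName.Y : BitName N))
def Y' : Ref (sig n m N) Ty.bit := .var (Sum.inl (BitName.Y' : BitName N))
def Z : Ref (sig n m N) Ty.bit := .var (Sum.inl (BitName.Z : BitName N))

/-- The array element `X[q]`. -/
def Xq : Ref (sig n m N) Ty.str :=
  .elem (S := sig n m N) (ι := Ty.cnt) (τ := Ty.str) () (Sum.inl (CntName.q : CntName N))

/-- The array component `X[k]`. -/
def X (k : Fin (2 ^ m)) : Ref (sig n m N) Ty.str :=
  .var (S := sig n m N) (τ := Ty.str) (Sum.inr ⟨Ty.cnt, (), k⟩)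

/-- Actual parameters. -/
def args (a : CntName N) (b : BitName N) :
    ∀ i : (sig n m N).Par (), (sig n m N).Name ((sig n m N).parTy () i)
  | .ctr => a
  | .tgt => b

/-- The operators `U_{+1}` and `U_{-1}` (modulo `2^m`). -/
def plusOne : Matrix (Fin (2 ^ m)) (Fin (2 ^ m)) ℂ := basisMap (finRotate (2 ^ m))
def minusOne : Matrix (Fin (2 ^ m)) (Fin (2 ^ m)) ℂ := basisMap (finRotate (2 ^ m)).symm

/-- The measurement `M`, telling `i < l`, `i = l` and `l < i` apart. -/
def measM (l : ℕ) : Fin 3 → Matrix (Fin (2 ^ m)) (Fin (2 ^ m)) ℂ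
  | 0 => Matrix.diagonal fun i => if i.val < l then 1 else 0
  | 1 => Matrix.diagonal fun i => if i.val = l then 1 else 0
  | 2 => Matrix.diagonal fun i => if l < i.val then 1 else 0

/-- The oracle `𝒢 |s⟩|y⟩ = |s⟩|y ⊕ g(s)⟩`. -/
def oracleG (g : Str n → ZMod 2) : Matrix (Str n × ZMod 2) (Str n × ZMod 2) ℂ :=
  basisMap fun a => (a.1, a.2 + g a.1)

/-- The types of the tuple `(X[1], …, X[l], Y)`. -/
def pathTy (l : ℕ) : Option (Fin l) → (sig n m N).Ty
  | none => Ty.bit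
  | some _ => Ty.str

/-- The tuple `(X[1], …, X[l], Y)`. -/
def pathRef (l : ℕ) (hlm : l < 2 ^ m) : Refs (sig n m N) (pathTy n m N l)
  | none => Y n m N
  | some j => X n m N ⟨j.val + 1, by omega⟩

/-- The map `(x₁, …, x_l, y) ↦ (x₁, …, x_l, y ⊕ g(s_{(x₁, …, x_l)}))`. -/
def oracleMap (l : ℕ) (g : Str n → ZMod 2) (s : List (Str n) → Str n)
    (u : Vals (sig n m N) (pathTy n m N l)) : Vals (sig n m N) (pathTy n m N l)
  | none =>
    let y : ZMod 2 := u none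
    let x : Fin l → Str n := fun j => u (some j)
    let b : ZMod 2 := y + g (s (List.ofFn x))
    b
  | some j => u (some j)

/-- The oracle `𝒪 |x₁⟩…|x_l⟩|y⟩ = |x₁⟩…|x_l⟩|y ⊕ g(s_{(x₁, …, x_l)})⟩`. -/
def oracleO (l : ℕ) (g : Str n → ZMod 2) (s : List (Str n) → Str n) :
    Matrix (Vals (sig n m N) (pathTy n m N l)) (Vals (sig n m N) (pathTy n m N l)) ℂ :=
  basisMap (oracleMap n m N l g s)

/-- `call RQFS(q, Y')`. -/
def innerCall : Stmt (sig n m N) := .call () (args n m N .q .Y')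

/-- The part of the body between `local X[q], Y'` and `release X[q], Y'`. -/
def localBody (g : Str n → ZMod 2) : Stmt (sig n m N) :=
  .seq (.unit (pairRef (Xq n m N) (Y' n m N))
      (gate₂ (S := sig n m N) (τ₁ := Ty.str) (τ₂ := Ty.bit)
        (Matrix.kroneckerMap (· * ·) (hadamardN n) (hadamard * pauliX)))) <|
  .seq (innerCall n m N) <|
  .seq (.unit (oneRef (Xq n m N)) (gate₁ (S := sig n m N) (τ := Ty.str) (hadamardN n))) <|
  .seq (.unit (pairRef (Xq n m N) (Y n m N))
      (gate₂ (S := sig n m N) (τ₁ := Ty.str) (τ₂ := Ty.bit) (oracleG n g))) <|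
  .seq (.unit (oneRef (Xq n m N)) (gate₁ (S := sig n m N) (τ := Ty.str) (hadamardN n))) <|
  .seq (innerCall n m N)
    (.unit (pairRef (Xq n m N) (Y' n m N))
      (gate₂ (S := sig n m N) (τ₁ := Ty.str) (τ₂ := Ty.bit)
        (Matrix.kroneckerMap (· * ·) (hadamardN n) (pauliX * hadamard))))

/-- The branches of the body. -/
def branch (l : ℕ) (hlm : l < 2 ^ m) (g : Str n → ZMod 2) (s : List (Str n) → Str n) :
    Fin 3 → Stmt (sig n m N)
  | 0 =>
    .seq (.unit (oneRef (q n m N)) (gate₁ (S := sig n m N) (τ := Ty.cnt) (plusOne m))) <|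
    .seq (.loc (pairRef (Xq n m N) (Y' n m N)) (localBody n m N g))
      (.unit (oneRef (q n m N)) (gate₁ (S := sig n m N) (τ := Ty.cnt) (minusOne m)))
  | 1 => .unit (pathRef n m N l hlm) (oracleO n m N l g s)
  | 2 => .bot

/-- The declaration of the procedure `RQFS(q, Y)`. -/
def decl (l : ℕ) (hlm : l < 2 ^ m) (g : Str n → ZMod 2) (s : List (Str n) → Str n) :
    Decl (sig n m N) where
  formal := fun _ => args n m N .q .Y
  formal_inj := by
    intro f i j h
    cases i <;> cases j
    · rfl
    · exact absurd (congrArg Sigma.fst h) Ty.noConfusion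
    · exact absurd (congrArg Sigma.fst h) Ty.noConfusion
    · rfl
  body := fun _ =>
    .case (oneRef (q n m N)) (fun k => gate₁ (S := sig n m N) (τ := Ty.cnt) (measM m l k))
      (branch n m N l hlm g s)

/-- The measurement of a qubit in the computational basis. -/
def measZ : ZMod 2 → Matrix (ZMod 2) (ZMod 2) ℂ := fun k => Matrix.single k k 1

/-- The main program: `(p, Z) := |0⟩; call RQFS(p, Z); if □ k · M'[Z] = k → skip`, where
`M'` is the measurement of `Z` in the computational basis. -/
def main : Stmt (sig n m N) :=
  .seq (.init (pairRef (p n m N) (Z n m N))) <|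
  .seq (.call () (args n m N .p .Z))
    (.case (oneRef (Z n m N))
      (fun k : ZMod 2 => gate₁ (S := sig n m N) (τ := Ty.bit) (measZ k))
      fun _ => .skip)

/-- The assertion `|0⟩⟨0|_p ⊗ |b⟩⟨b|_Z`. -/
def post (b : ZMod 2) : PQPT (sig n m N) :=
  PQPT.basis fun x =>
    x ⟨Ty.cnt, Sum.inl (CntName.p : CntName N)⟩ = (sig n m N).zero Ty.cnt ∧
    x ⟨Ty.bit, Sum.inl (BitName.Z : BitName N)⟩ = b

end

end RQFS

end QHL

end

noncomputable section

namespace QHL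

variable {S : Sig}

/-! ## Löwner order -/

/-! At level `q = k ≤ l`, the call RQFS(q, Y) adds to `Y` the bit `h(x_k, …, x_1) = g(s_(x_1, …,
x_k))`, where `x_j` is the content of `X[j]`. The rule (Rp pRec) allows one triple as induction
hypothesis. It has to describe the call on superpositions, entangled with the strings and the
targets of all pending callers, and it has to serve at every level.

The specification therefore carries a parameter. The recursion stack at level `k` consists of `X[k],
…, X[1]` and of `k + 1` qubits: the target and the targets of the `k` callers, the latter under
fresh names. There are finitely many stacks of height at most `l`, so an injection `enc` writes them
into the unused string variables once `N` is large (`exists_encoding`). The predicate variable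
`store` lives on these variables and stands for an arbitrary predicate about the stack. A `frame`
pulls it back along the encoding and is block diagonal in the values of all remaining variables, the
counter included. The precondition is `specTerm` with `h`, the postcondition is `specTerm` with `0`:
whatever the stack is to satisfy after the call, it satisfies before the call once `h` is added to
its target.

The body is verified level by level (`body_spec`). At level `l` the oracle does exactly this. Above
`l` the precondition is `0`, which suits `⊥`. Below `l` the hypothesis is used twice. (R Adap) with
`shift` renames the target to `Y'` and pushes the caller's `Y` onto the stack. (R Subst) replaces
`store` by `popTerm`: the innermost string and target have an amplitude `ω` depending on the
history, and the popped stack, with `f` added to the caller's target, satisfies `store`.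
`frame_callee` identifies the outcome with `innerTerm`. The gates on the local variables and the
recursive calls now act on `ω` alone. The local variables `|0⟩|0⟩` become a uniform superposition
with target `H|1⟩`; the first call kicks back the phase `(-1)^(s·x)`; the Hadamard transform
produces the secret `s`; the oracle `𝒢` adds `g(s)`, which turns `f = h` into `f = 0`; the mirrored
steps uncompute. The local variables are then dropped by a Löwner inequality, and `local_block`
composes these steps.

For the main program the store is instantiated with the projection onto the code of the stack `([],
[g(s_∅)])` (`main_call`). Only partial correctness is claimed, so no termination argument enters. -/

theorem Loewner.refl (A : Op S) : Loewner A A := by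
  unfold Loewner
  rw [sub_self]
  exact Matrix.PosSemidef.zero

theorem Loewner.trans {A B C : Op S} (h₁ : Loewner A B) (h₂ : Loewner B C) : Loewner A C := by
  unfold Loewner at *
  have := h₁.add h₂
  rwa [sub_add_sub_cancel'] at this

theorem Loewner.conj {A B : Op S} (h : Loewner A B) (K : Op S) :
    Loewner (Kᴴ * A * K) (Kᴴ * B * K) := by
  unfold Loewner at *
  have := h.conjTranspose_mul_mul_same K
  rwa [mul_sub, sub_mul] at this

theorem Loewner.sum {ι : Type*} (s : Finset ι) {A B : ι → Op S}
    (h : ∀ i, Loewner (A i) (B i)) : Loewner (∑ i ∈ s, A i) (∑ i ∈ s, B i) := by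
  unfold Loewner at *
  rw [← Finset.sum_sub_distrib]
  exact Matrix.posSemidef_sum _ fun i _ => h i

theorem loewner_zero_iff {A : Op S} : Loewner 0 A ↔ A.PosSemidef := by
  simp [Loewner]

/-- If `K Kᴴ K = K`, then `Kᴴ K` is a projection. -/
theorem loewner_one_of_partialIsometry {K : Op S} (h : K * Kᴴ * K = K) : Loewner (Kᴴ * K) 1 := by
  have h₂ : Kᴴ * K * (Kᴴ * K) = Kᴴ * K := by
    rw [mul_assoc, ← mul_assoc K, h]
  have h₁ : (1 : Op S) - Kᴴ * K = (1 - Kᴴ * K)ᴴ * (1 - Kᴴ * K) := by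
    simp [mul_sub, sub_mul, Matrix.conjTranspose_mul, h₂]
  unfold Loewner
  rw [h₁]
  exact Matrix.posSemidef_conjTranspose_mul_self _

theorem loewner_diagonal_one {d : Conf S → ℂ} (h : ∀ c, d c ≤ 1) :
    Loewner (Matrix.diagonal d) 1 := by
  unfold Loewner
  rw [← Matrix.diagonal_one, Matrix.diagonal_sub]
  exact Matrix.PosSemidef.diagonal fun c => by simpa using h c

/-! ## Writing to a tuple of references -/

section setAt

variable {ι : Type} {Γ : ι → S.Ty}

open Classical in
/-- The basis state `c` with the values of the tuple `q` replaced by `u`. -/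
def setAt (q : Refs S Γ) (c : Conf S) (u : Vals S Γ) : Conf S := fun v =>
  if h : ∃ i, targetAt q c i = v then h.choose_spec ▸ u h.choose else c v

theorem setAt_target {q : Refs S Γ} (hq : Distinct q) (c : Conf S) (u : Vals S Γ) (i : ι) :
    setAt q c u (targetAt q c i) = u i := by
  have h : ∃ j, targetAt q c j = targetAt q c i := ⟨i, rfl⟩
  unfold setAt
  rw [dif_pos h]
  have key : ∀ (j : ι) (e : targetAt q c j = targetAt q c i),
      (e ▸ u j : S.Val (targetAt q c i).1) = u i := by
    intro j e
    obtain rfl := (hq c).1 e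
    rfl
  exact key _ h.choose_spec

theorem setAt_of_ne {q : Refs S Γ} {c : Conf S} {u : Vals S Γ} {v : AnyVar S}
    (h : ∀ i, v ≠ targetAt q c i) : setAt q c u v = c v := by
  unfold setAt
  rw [dif_neg]
  rintro ⟨i, hi⟩
  exact h i hi.symm

theorem target_congr {x y : Conf S} {τ : S.Ty} (r : Ref S τ)
    (h : ∀ v ∈ r.index, x v = y v) : r.target x = r.target y := by
  cases r with
  | var v => rfl
  | elem a i =>
    have := h ⟨_, i⟩ rfl
    simp [Ref.target, this]

theorem targetAt_congr {q : Refs S Γ} {x y : Conf S}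
    (h : ∀ j, ∀ v ∈ (q j).index, x v = y v) : targetAt q x = targetAt q y := by
  funext i
  unfold targetAt
  rw [target_congr (q i) (h i)]

/-- Overwriting does not move the references, because `Distinct` forbids a target to serve as an
index in the same tuple. -/
theorem targetAt_setAt {q : Refs S Γ} (hq : Distinct q) (c : Conf S) (u : Vals S Γ) :
    targetAt q (setAt q c u) = targetAt q c :=
  targetAt_congr fun j _ hv => setAt_of_ne fun i h => (hq c).2 i j (h ▸ hv)

theorem readAt_setAt {q : Refs S Γ} (hq : Distinct q) (c : Conf S) (u : Vals S Γ) :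
    readAt q (setAt q c u) = u := by
  funext i
  have h := target_congr (x := setAt q c u) (y := c) (q i) fun v hv =>
    setAt_of_ne fun j e => (hq c).2 j i (e ▸ hv)
  have h' := setAt_target hq c u i
  unfold readAt targetAt
  unfold targetAt at h'
  rw [h]
  exact h'

/-- `lift` is defined by agreement off the targets. In terms of overwriting, the condition becomes
an explicit graph, and products with a lift become sums over the values of the tuple. -/
theorem eq_setAt_iff {q : Refs S Γ} (hq : Distinct q) {x c : Conf S} :
    (∀ v, (∀ i, v ≠ targetAt q x i) → x v = c v) ↔ x = setAt q c (readAt q x) := by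
  constructor
  · intro h
    have ht : targetAt q x = targetAt q c := targetAt_congr fun j v hv =>
      h v fun i e => (hq x).2 i j (e ▸ hv)
    funext v
    by_cases hv : ∃ i, targetAt q c i = v
    · obtain ⟨i, rfl⟩ := hv
      rw [setAt_target hq]
      have h' := target_congr (x := x) (y := c) (q i) fun v hv =>
        h v fun j e => (hq x).2 j i (e ▸ hv)
      unfold readAt targetAt
      rw [h']
    · push Not at hv
      rw [setAt_of_ne fun i => (hv i).symm]
      exact h v fun i => ht ▸ (hv i).symm
  · intro h v hv
    rw [h] at hv
    rw [targetAt_setAt hq] at hv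
    rw [h, setAt_of_ne hv]

theorem eq_setAt_symm {q : Refs S Γ} (hq : Distinct q) {x c : Conf S}
    (h : x = setAt q c (readAt q x)) : c = setAt q x (readAt q c) := by
  rw [← eq_setAt_iff hq]
  intro v hv
  have ht : targetAt q x = targetAt q c := by rw [h, targetAt_setAt hq]
  exact ((eq_setAt_iff hq).2 h v (by rwa [ht])).symm

open Classical in
theorem lift_apply {q : Refs S Γ} (hq : Distinct q) (A : Matrix (Vals S Γ) (Vals S Γ) ℂ)
    (x c : Conf S) :
    lift q A x c = if x = setAt q c (readAt q x) then A (readAt q x) (readAt q c) else 0 := by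
  unfold lift
  rw [Matrix.of_apply]
  simp only [eq_setAt_iff hq]

theorem lift_conjTranspose {q : Refs S Γ} (hq : Distinct q)
    (A : Matrix (Vals S Γ) (Vals S Γ) ℂ) : (lift q A)ᴴ = lift q Aᴴ := by
  ext x c
  rw [Matrix.conjTranspose_apply, lift_apply hq, lift_apply hq]
  by_cases h : c = setAt q x (readAt q c)
  · rw [if_pos h, if_pos (eq_setAt_symm hq h), Matrix.conjTranspose_apply]
  · rw [if_neg h, if_neg fun h' => h (eq_setAt_symm hq h'), star_zero]

theorem setAt_injective {q : Refs S Γ} (hq : Distinct q) (c : Conf S) :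
    Function.Injective (setAt q c) := fun u w h => by
  rw [← readAt_setAt hq c u, h, readAt_setAt hq]

variable [Finite ι]

theorem mul_lift_apply {β : Type*} {q : Refs S Γ} (hq : Distinct q)
    (A : Matrix (Vals S Γ) (Vals S Γ) ℂ) (M : Matrix β (Conf S) ℂ) (e : β) (c : Conf S) :
    (M * lift q A) e c = ∑ u, M e (setAt q c u) * A u (readAt q c) := by
  rw [Matrix.mul_apply]
  refine (Fintype.sum_of_injective (setAt q c) (setAt_injective hq c) _ _ ?_ ?_).symm
  · intro x hx
    rw [lift_apply hq, if_neg, mul_zero]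
    exact fun h => hx ⟨_, h.symm⟩
  · intro u
    rw [lift_apply hq, readAt_setAt hq, if_pos rfl]

theorem lift_mul_apply {β : Type*} {q : Refs S Γ} (hq : Distinct q)
    (A : Matrix (Vals S Γ) (Vals S Γ) ℂ) (M : Matrix (Conf S) β ℂ) (c : Conf S) (e : β) :
    (lift q A * M) c e = ∑ u, A (readAt q c) u * M (setAt q c u) e := by
  rw [Matrix.mul_apply]
  refine (Fintype.sum_of_injective (setAt q c) (setAt_injective hq c) _ _ ?_ ?_).symm
  · intro x hx
    rw [lift_apply hq, if_neg, zero_mul]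
    exact fun h => hx ⟨_, (eq_setAt_symm hq h).symm⟩
  · intro u
    have h := eq_setAt_symm hq (x := setAt q c u) (c := c) (by rw [readAt_setAt hq])
    rw [lift_apply hq, if_pos h, readAt_setAt hq]

/-- Conjugation with the lift of a basis map. -/
theorem conj_lift_basisMap {q : Refs S Γ} (hq : Distinct q) (f : Vals S Γ → Vals S Γ) (M : Op S) :
    (lift q (basisMap f))ᴴ * M * lift q (basisMap f) =
      M.submatrix (fun c => setAt q c (f (readAt q c))) fun c => setAt q c (f (readAt q c)) := by
  ext c c'
  rw [mul_lift_apply hq, lift_conjTranspose hq]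
  simp only [lift_mul_apply hq, Matrix.conjTranspose_apply, basisMap, Matrix.of_apply,
    Matrix.submatrix_apply]
  simp

/-- Conjugation with the lift of a diagonal operator. -/
theorem conj_lift_diagonal {q : Refs S Γ} (hq : Distinct q) (d : Vals S Γ → ℂ) (M : Op S)
    (c c' : Conf S) :
    ((lift q (Matrix.diagonal d))ᴴ * M * lift q (Matrix.diagonal d)) c c' =
      star (d (readAt q c)) * M c c' * d (readAt q c') := by
  have hs : ∀ c, setAt q c (readAt q c) = c := fun c => ((eq_setAt_iff hq).1 fun _ _ => rfl).symm
  rw [mul_lift_apply hq, lift_conjTranspose hq, Matrix.diagonal_conjTranspose]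
  simp only [lift_mul_apply hq, Matrix.diagonal_apply]
  simp [hs]

/-- Conjugation with `|u⟩⟨k|` on `q`. -/
theorem conj_lift_single {q : Refs S Γ} (hq : Distinct q) (u k : Vals S Γ) (M : Op S)
    (c c' : Conf S) :
    ((lift q (Matrix.single u k 1))ᴴ * M * lift q (Matrix.single u k 1)) c c' =
      if readAt q c = k ∧ readAt q c' = k then M (setAt q c u) (setAt q c' u) else 0 := by
  rw [mul_lift_apply hq, lift_conjTranspose hq]
  simp only [lift_mul_apply hq, Matrix.conjTranspose_apply, Matrix.single, Matrix.of_apply]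
  by_cases h₁ : readAt q c = k <;> by_cases h₂ : readAt q c' = k <;>
    simp [h₁, h₂, eq_comm]
  · simp [Ne.symm h₂]
  · simp [Ne.symm h₁]
  · simp [Ne.symm h₂]

theorem sum_conj_lift_single {q : Refs S Γ} (hq : Distinct q) (u : Vals S Γ) (M : Op S)
    (c c' : Conf S) :
    (∑ k : Vals S Γ, (lift q (Matrix.single u k 1))ᴴ * M * lift q (Matrix.single u k 1)) c c' =
      if readAt q c = readAt q c' then M (setAt q c u) (setAt q c' u) else 0 := by
  rw [Matrix.sum_apply]
  simp only [conj_lift_single hq]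
  by_cases h : readAt q c = readAt q c'
  · simp [h]
  · rw [if_neg h]
    exact Finset.sum_eq_zero fun k _ => if_neg fun hk => h (hk.1.trans hk.2.symm)

end setAt

/-! ## Predicate terms with one parameter -/

theorem dual_toList {ι : Type*} [Fintype ι] (E : ι → Op S) (A : Op S) :
    dual (Finset.univ.toList.map E) A = ∑ i, (E i)ᴴ * A * E i := by
  unfold dual
  rw [List.map_map]
  exact Finset.sum_map_toList _ _

/-- The Kraus operators `|c⟩ ↦ w(c) |θ(c)⟩`, restricted to the basis states with `ρ(c) = r`. -/
def frameKraus (ρ θ : Conf S → Conf S) (w : Conf S → ℂ) (r : Conf S) : Op S :=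
  Matrix.of fun e c => if e = θ c ∧ ρ c = r then w c else 0

/-- The predicate obtained from `B` by the operation with Kraus operators `frameKraus ρ θ w r`. -/
def frame (ρ θ : Conf S → Conf S) (w : Conf S → ℂ) (B : Op S) : Op S :=
  Matrix.of fun c c' => if ρ c = ρ c' then star (w c) * w c' * B (θ c) (θ c') else 0

theorem frame_eq_sum (ρ θ : Conf S → Conf S) (w : Conf S → ℂ) (B : Op S) :
    frame ρ θ w B = ∑ r, (frameKraus ρ θ w r)ᴴ * B * frameKraus ρ θ w r := by
  ext c c'
  rw [Matrix.sum_apply]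
  have h : ∀ r, ((frameKraus ρ θ w r)ᴴ * B * frameKraus ρ θ w r) c c' =
      if ρ c = r then (if ρ c' = r then star (w c) * w c' * B (θ c) (θ c') else 0) else 0 := by
    intro r
    simp only [Matrix.mul_apply, frameKraus, Matrix.conjTranspose_apply, Matrix.of_apply]
    by_cases h₁ : ρ c = r <;> by_cases h₂ : ρ c' = r <;> simp [h₁, h₂, apply_ite, ite_mul]
    ring
  simp only [h, frame, Matrix.of_apply]
  simp [eq_comm]

theorem frame_mono (ρ θ : Conf S → Conf S) (w : Conf S → ℂ) {A B : Op S} (h : Loewner A B) :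
    Loewner (frame ρ θ w A) (frame ρ θ w B) := by
  rw [frame_eq_sum, frame_eq_sum]
  exact Loewner.sum _ fun r => h.conj _

/-- Nothing matters where the weight vanishes, and `ρ` matters only through its fibres. -/
theorem frame_congr {ρ ρ' θ θ' : Conf S → Conf S} {w w' : Conf S → ℂ} {B : Op S}
    (hw : ∀ c, w c = w' c) (hθ : ∀ c, w c ≠ 0 → θ c = θ' c)
    (hρ : ∀ c c', w c ≠ 0 → w c' ≠ 0 → (ρ c = ρ c' ↔ ρ' c = ρ' c')) :
    frame ρ θ w B = frame ρ' θ' w' B := by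
  ext c c'
  simp only [frame, Matrix.of_apply, ← hw]
  by_cases h : w c = 0
  · simp [h]
  by_cases h' : w c' = 0
  · simp [h']
  rw [hθ c h, hθ c' h']
  simp only [hρ c c' h h']

/-- Shrinking the set of Kraus operators makes the predicate smaller. -/
theorem loewner_sum_conj_of_sub {ι : Type*} [Fintype ι] {E E' : ι → Op S} {B : Op S}
    (hB : B.PosSemidef) (h : ∀ i, E i = E' i ∨ E i = 0) :
    Loewner (∑ i, (E i)ᴴ * B * E i) (∑ i, (E' i)ᴴ * B * E' i) := by
  refine Loewner.sum _ fun i => ?_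
  rcases h i with h | h
  · rw [h]
    exact Loewner.refl _
  · rw [h]
    simpa [loewner_zero_iff] using hB.conjTranspose_mul_mul_same _

/-- Distinct states in the support with equal `ρ` have distinct `θ`, where a diagonal operator
vanishes; so no off-diagonal entry survives. -/
theorem frame_diagonal {ρ θ : Conf S → Conf S} {w : Conf S → ℂ}
    (hw : ∀ c, w c = 0 ∨ w c = 1)
    (hi : ∀ c c', w c ≠ 0 → w c' ≠ 0 → ρ c = ρ c' → θ c = θ c' → c = c') (d : Conf S → ℂ) :
    frame ρ θ w (Matrix.diagonal d) = Matrix.diagonal fun c => w c * d (θ c) := by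
  ext c c'
  simp only [frame, Matrix.of_apply, Matrix.diagonal_apply]
  by_cases h : c = c'
  · subst h
    rcases hw c with h | h <;> simp [h]
  · rw [if_neg h]
    by_cases h₁ : w c = 0
    · simp [h₁]
    by_cases h₂ : w c' = 0
    · simp [h₂]
    by_cases h₃ : ρ c = ρ c'
    · rw [if_neg fun h₄ => h (hi c c' h₁ h₂ h₃ h₄)]
      simp
    · simp [h₃]

theorem frame_bound_of_injective {ρ θ : Conf S → Conf S} {w : Conf S → ℂ}
    (hw : ∀ c, w c = 0 ∨ w c = 1)
    (hi : ∀ c c', w c ≠ 0 → w c' ≠ 0 → ρ c = ρ c' → θ c = θ c' → c = c') :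
    Loewner (frame ρ θ w 1) 1 := by
  rw [← Matrix.diagonal_one, frame_diagonal hw hi, Matrix.diagonal_one]
  exact loewner_diagonal_one fun c => by rcases hw c with h | h <;> simp [h]

theorem frame_comp (ρ θ d : Conf S → Conf S) (w : Conf S → ℂ) (B : Op S) :
    frame (ρ ∘ d) (θ ∘ d) (w ∘ d) B = (frame ρ θ w B).submatrix d d := rfl

/-- Precomposing with `d` passes to a submatrix, which preserves positivity; injectivity of `d`
preserves the identity. It is used for renamings and for shifts of the counter. -/
theorem frame_bound_comp {ρ θ : Conf S → Conf S} {w : Conf S → ℂ}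
    (h : Loewner (frame ρ θ w 1) 1) {d : Conf S → Conf S} (hd : Function.Injective d) :
    Loewner (frame (ρ ∘ d) (θ ∘ d) (w ∘ d) 1) 1 := by
  unfold Loewner at *
  have := Matrix.PosSemidef.submatrix h d
  rwa [Matrix.submatrix_sub, Pi.sub_apply, Pi.sub_apply, Matrix.submatrix_one d hd] at this

/-- The term `ℰ*(X)` with the Kraus operators `frameKraus ρ θ w r`. -/
def frameTerm (X : PVar S) (ρ θ : Conf S → Conf S) (w : Conf S → ℂ)
    (h : Loewner (frame ρ θ w 1) 1) : PQPT S where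
  params := [X]
  disj := List.pairwise_singleton _ _
  E := Finset.univ.toList.map (frameKraus ρ θ w)
  F := []
  bound := by
    rw [dual_toList, ← frame_eq_sum]
    simpa [dual] using h

theorem frameTerm_den (X : PVar S) {ρ θ : Conf S → Conf S} {w : Conf S → ℂ}
    (h : Loewner (frame ρ θ w 1) 1) (v : PVar S → Op S) :
    (frameTerm X ρ θ w h).den v = frame ρ θ w (v X) := by
  simp only [PQPT.den, frameTerm]
  rw [dual_toList, List.map_singleton, List.prod_singleton, ← frame_eq_sum]
  simp [dual]

theorem frameTerm_Params (X : PVar S) {ρ θ : Conf S → Conf S} {w : Conf S → ℂ}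
    (h : Loewner (frame ρ θ w 1) 1) : (frameTerm X ρ θ w h).Params = {X} := by
  ext Y
  simp [PQPT.Params, frameTerm]

/-- Conjugation with an operator under which the weights transform linearly. -/
theorem conj_frame_of_kraus {ρ θ θ' : Conf S → Conf S} {w w' : Conf S → ℂ} {L B : Op S}
    (h : ∀ r, frameKraus ρ θ w r * L = frameKraus ρ θ' w' r) :
    Lᴴ * frame ρ θ w B * L = frame ρ θ' w' B := by
  rw [frame_eq_sum, frame_eq_sum, Finset.mul_sum, Finset.sum_mul]
  refine Finset.sum_congr rfl fun r _ => ?_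
  rw [← h, Matrix.conjTranspose_mul]
  simp only [mul_assoc]

/-- The weights form a bra, which `A` multiplies from the right. Since `ρ` and `θ` ignore `q` on the
support, one Kraus index and one output state serve all values of the tuple. -/
theorem frameKraus_mul_lift {ι : Type} [Finite ι] {Γ : ι → S.Ty} {q : Refs S Γ} (hq : Distinct q)
    (A : Matrix (Vals S Γ) (Vals S Γ) ℂ) {ρ θ : Conf S → Conf S} {w w' : Conf S → ℂ}
    (h : ∀ c u, w (setAt q c u) ≠ 0 → ρ (setAt q c u) = ρ c ∧ θ (setAt q c u) = θ c)
    (hw : ∀ c, w' c = ∑ u, w (setAt q c u) * A u (readAt q c)) (r : Conf S) :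
    frameKraus ρ θ w r * lift q A = frameKraus ρ θ w' r := by
  ext e c
  rw [mul_lift_apply hq]
  simp only [frameKraus, Matrix.of_apply, hw]
  by_cases h₁ : e = θ c ∧ ρ c = r
  · rw [if_pos h₁]
    refine Finset.sum_congr rfl fun u _ => ?_
    by_cases h₀ : w (setAt q c u) = 0
    · simp [h₀]
    · rw [(h c u h₀).1, (h c u h₀).2, if_pos h₁]
  · rw [if_neg h₁]
    refine Finset.sum_eq_zero fun u _ => ?_
    by_cases h₀ : w (setAt q c u) = 0
    · simp [h₀]
    · rw [(h c u h₀).1, (h c u h₀).2, if_neg h₁, zero_mul]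

/-! ## Renaming -/

/-- The basis state that gives `v` the value of `σ v` in `c`. -/
def Conf.pre (σ : Ren S) (c : Conf S) : Conf S := fun v => c (AnyVar.ren σ v)

theorem AnyVar.ren_surjective (σ : Ren S) : Function.Surjective (AnyVar.ren σ) := by
  rintro ⟨τ, v | v⟩
  · exact ⟨⟨τ, Sum.inl ((σ τ).symm v)⟩, by simp [AnyVar.ren, Var.ren]⟩
  · exact ⟨⟨τ, Sum.inr v⟩, by simp [AnyVar.ren, Var.ren]⟩

theorem AnyVar.ren_injective (σ : Ren S) : Function.Injective (AnyVar.ren σ) :=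
  Finite.injective_iff_surjective.2 (AnyVar.ren_surjective σ)

theorem Conf.pre_injective (σ : Ren S) : Function.Injective (Conf.pre σ) := by
  intro c c' h
  funext v
  obtain ⟨v, rfl⟩ := AnyVar.ren_surjective σ v
  exact congrFun h v

/-- The Kraus index `r` is a mere label and is not renamed; the renaming acts on the input state,
and on the output through the hypothesis relating `θ` and `θ'`. -/
theorem ren_frameKraus (σ : Ren S) {ρ θ θ' : Conf S → Conf S} {w : Conf S → ℂ} (r : Conf S)
    (h : ∀ c, θ (Conf.pre σ c) = Conf.pre σ (θ' c)) :
    Op.ren σ (frameKraus ρ θ w r) =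
      frameKraus (ρ ∘ Conf.pre σ) θ' (w ∘ Conf.pre σ) r := by
  ext e c
  have h' := h c
  simp only [Op.ren, frameKraus, Matrix.of_apply, Function.comp]
  change (if Conf.pre σ e = θ (Conf.pre σ c) ∧ ρ (Conf.pre σ c) = r then _ else _) = _
  simp only [h', (Conf.pre_injective σ).eq_iff]
  rfl

theorem isRen_frameTerm (σ : Ren S) {X : PVar S} {ρ θ θ' : Conf S → Conf S} {w : Conf S → ℂ}
    (h : Loewner (frame ρ θ w 1) 1)
    (h' : Loewner (frame (ρ ∘ Conf.pre σ) θ' (w ∘ Conf.pre σ) 1) 1)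
    (hX : PVar.ren σ X = X) (hθ : ∀ c, θ (Conf.pre σ c) = Conf.pre σ (θ' c)) :
    IsRen σ (frameTerm X ρ θ w h) (frameTerm X (ρ ∘ Conf.pre σ) θ' (w ∘ Conf.pre σ) h') := by
  refine ⟨?_, ?_, rfl⟩
  · simp [frameTerm, hX]
  · simp only [frameTerm, List.map_map]
    refine List.map_congr_left fun r _ => ?_
    exact (ren_frameKraus σ r hθ).symm


/-! ### Overwriting a single variable in a basis state. -/

instance (S : Sig) : DecidableEq (AnyVar S) := Classical.decEq _

/-- The basis state `c` with the value of `v` replaced by `a`. -/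
def Conf.set {S : Sig} (c : Conf S) (v : AnyVar S) (a : S.Val v.1) : Conf S :=
  Function.update (β := fun v : AnyVar S => S.Val v.1) c v a

theorem Conf.set_self {S : Sig} (c : Conf S) (v : AnyVar S) (a : S.Val v.1) : c.set v a v = a :=
  Function.update_self (β := fun v : AnyVar S => S.Val v.1) v a c

theorem Conf.set_of_ne {S : Sig} {c : Conf S} {v w : AnyVar S} {a : S.Val v.1} (h : w ≠ v) :
    c.set v a w = c w :=
  Function.update_of_ne (β := fun v : AnyVar S => S.Val v.1) h a c

theorem Conf.set_set {S : Sig} (c : Conf S) (v : AnyVar S) (a b : S.Val v.1) :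
    (c.set v a).set v b = c.set v b :=
  Function.update_idem (β := fun v : AnyVar S => S.Val v.1) a b c

theorem Conf.set_apply_self {S : Sig} (c : Conf S) (v : AnyVar S) : c.set v (c v) = c :=
  Function.update_eq_self (β := fun v : AnyVar S => S.Val v.1) v c

/-! ## Single references and pairs -/

section tuples

theorem oneRef_distinct {τ : S.Ty} {r : Ref S τ}
    (h : ∀ x, (⟨τ, r.target x⟩ : AnyVar S) ∉ r.index) : Distinct (oneRef r) :=
  fun x => ⟨fun _ _ _ => rfl, fun _ _ => h x⟩

theorem pairRef_distinct {τ₁ τ₂ : S.Ty} {r₁ : Ref S τ₁} {r₂ : Ref S τ₂}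
    (hne : ∀ x, (⟨τ₁, r₁.target x⟩ : AnyVar S) ≠ ⟨τ₂, r₂.target x⟩)
    (h₁ : ∀ x, (⟨τ₁, r₁.target x⟩ : AnyVar S) ∉ r₁.index ∪ r₂.index)
    (h₂ : ∀ x, (⟨τ₂, r₂.target x⟩ : AnyVar S) ∉ r₁.index ∪ r₂.index) :
    Distinct (pairRef r₁ r₂) := by
  intro x
  constructor
  · rintro (_ | _) (_ | _) h
    · rfl
    · exact absurd h (hne x)
    · exact absurd h.symm (hne x)
    · rfl
  · rintro (_ | _) (_ | _)
    · exact fun h => h₁ x (Or.inl h)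
    · exact fun h => h₁ x (Or.inr h)
    · exact fun h => h₂ x (Or.inl h)
    · exact fun h => h₂ x (Or.inr h)

theorem setAt_oneRef {τ : S.Ty} {r : Ref S τ} (hr : Distinct (oneRef r)) (c : Conf S)
    (u : Vals S (oneTy τ)) :
    setAt (oneRef r) c u = c.set ⟨τ, r.target c⟩ (u ()) := by
  funext v
  by_cases h : v = ⟨τ, r.target c⟩
  · subst h
    have h := Conf.set_self c ⟨τ, r.target c⟩ (u ())
    exact (setAt_target hr c u ()).trans h.symm
  · exact (setAt_of_ne fun _ => h).trans (Conf.set_of_ne h).symm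

theorem setAt_pairRef {τ₁ τ₂ : S.Ty} {r₁ : Ref S τ₁} {r₂ : Ref S τ₂}
    (hr : Distinct (pairRef r₁ r₂)) (c : Conf S) (u : Vals S (pairTy τ₁ τ₂)) :
    setAt (pairRef r₁ r₂) c u =
      (c.set ⟨τ₁, r₁.target c⟩ (u false)).set ⟨τ₂, r₂.target c⟩ (u true) := by
  have hne : (⟨τ₁, r₁.target c⟩ : AnyVar S) ≠ ⟨τ₂, r₂.target c⟩ := fun h =>
    Bool.false_ne_true ((hr c).1 (a₁ := false) (a₂ := true) h)
  funext v
  by_cases h₂ : v = ⟨τ₂, r₂.target c⟩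
  · subst h₂
    have h := Conf.set_self (c.set ⟨τ₁, r₁.target c⟩ (u false)) ⟨τ₂, r₂.target c⟩ (u true)
    exact (setAt_target hr c u true).trans h.symm
  refine Eq.trans ?_ (Conf.set_of_ne h₂).symm
  by_cases h₁ : v = ⟨τ₁, r₁.target c⟩
  · subst h₁
    have h := Conf.set_self c ⟨τ₁, r₁.target c⟩ (u false)
    exact (setAt_target hr c u false).trans h.symm
  · refine Eq.trans (setAt_of_ne ?_) (Conf.set_of_ne h₁).symm
    rintro (_ | _)
    · exact h₁
    · exact h₂

end tuples

namespace RQFS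

variable {n m N : ℕ}

/-! ## Variables and their values -/

/-- The counter named `a`. -/
def cntVar (a : CntName N) : AnyVar (sig n m N) := ⟨Ty.cnt, Sum.inl a⟩

/-- The qubit named `b`. -/
def bitVar (b : BitName N) : AnyVar (sig n m N) := ⟨Ty.bit, Sum.inl b⟩

/-- The simple string variable named `i`. -/
def strVar (i : Fin N) : AnyVar (sig n m N) := ⟨Ty.str, Sum.inl i⟩

/-- The array component `X[k]`. -/
def arrVar (k : Fin (2 ^ m)) : AnyVar (sig n m N) := ⟨Ty.str, Sum.inr ⟨Ty.cnt, (), k⟩⟩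

theorem anyVar_cases (v : AnyVar (sig n m N)) :
    (∃ a, v = cntVar a) ∨ (∃ b, v = bitVar b) ∨ (∃ i, v = strVar i) ∨ ∃ k, v = arrVar k := by
  obtain ⟨τ, v | ⟨ι, a, k⟩⟩ := v
  · cases τ
    · exact Or.inl ⟨v, rfl⟩
    · exact Or.inr (Or.inr (Or.inl ⟨v, rfl⟩))
    · exact Or.inr (Or.inl ⟨v, rfl⟩)
  · cases ι <;> cases τ <;> first | exact a.elim | skip
    exact Or.inr (Or.inr (Or.inr ⟨k, rfl⟩))

theorem bitVar_injective : Function.Injective (bitVar (n := n) (m := m) (N := N)) := by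
  intro a b h
  exact Sum.inl.inj (eq_of_heq (Sigma.mk.inj h).2)

theorem arrVar_injective : Function.Injective (arrVar (n := n) (m := m) (N := N)) := by
  intro a b h
  have h₁ := Sum.inr.inj (eq_of_heq (Sigma.mk.inj h).2)
  exact (Prod.mk.inj (eq_of_heq (Sigma.mk.inj h₁).2)).2

@[simp] theorem cntVar_ne_bitVar (a : CntName N) (b : BitName N) :
    (cntVar a : AnyVar (sig n m N)) ≠ bitVar b := fun h => Ty.noConfusion (congrArg Sigma.fst h)

@[simp] theorem cntVar_ne_arrVar (a : CntName N) (b : Fin (2 ^ m)) :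
    (cntVar a : AnyVar (sig n m N)) ≠ arrVar b := fun h => Ty.noConfusion (congrArg Sigma.fst h)

@[simp] theorem bitVar_ne_strVar (a : BitName N) (b : Fin N) :
    (bitVar a : AnyVar (sig n m N)) ≠ strVar b := fun h => Ty.noConfusion (congrArg Sigma.fst h)

@[simp] theorem bitVar_ne_arrVar (a : BitName N) (b : Fin (2 ^ m)) :
    (bitVar a : AnyVar (sig n m N)) ≠ arrVar b := fun h => Ty.noConfusion (congrArg Sigma.fst h)

@[simp] theorem strVar_ne_arrVar (a : Fin N) (b : Fin (2 ^ m)) :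
    (strVar a : AnyVar (sig n m N)) ≠ arrVar b := by
  intro h
  exact Sum.inl_ne_inr (eq_of_heq (Sigma.mk.inj h).2)

/-- The value of a counter. -/
def cnt (c : Conf (sig n m N)) (a : CntName N) : Fin (2 ^ m) := c (cntVar a)

/-- The value of a qubit. -/
def bit (c : Conf (sig n m N)) (b : BitName N) : ZMod 2 := c (bitVar b)

/-- The values of the simple string variables. -/
def strs (c : Conf (sig n m N)) : Fin N → Str n := fun i => c (strVar i)

/-- The value of an array component. -/
def arr (c : Conf (sig n m N)) (k : Fin (2 ^ m)) : Str n := c (arrVar k)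

def setCnt (c : Conf (sig n m N)) (a : CntName N) (k : Fin (2 ^ m)) : Conf (sig n m N) :=
  c.set (cntVar a) k

def setBit (c : Conf (sig n m N)) (b : BitName N) (y : ZMod 2) : Conf (sig n m N) :=
  c.set (bitVar b) y

def setArr (c : Conf (sig n m N)) (k : Fin (2 ^ m)) (x : Str n) : Conf (sig n m N) :=
  c.set (arrVar k) x

theorem setCnt_apply_of_ne {c : Conf (sig n m N)} {a : CntName N} {k : Fin (2 ^ m)}
    {v : AnyVar (sig n m N)} (h : v ≠ cntVar a) : setCnt c a k v = c v := Conf.set_of_ne h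

theorem setBit_apply_of_ne {c : Conf (sig n m N)} {b : BitName N} {y : ZMod 2}
    {v : AnyVar (sig n m N)} (h : v ≠ bitVar b) : setBit c b y v = c v := Conf.set_of_ne h

theorem setArr_apply_of_ne {c : Conf (sig n m N)} {k : Fin (2 ^ m)} {x : Str n}
    {v : AnyVar (sig n m N)} (h : v ≠ arrVar k) : setArr c k x v = c v := Conf.set_of_ne h

@[simp] theorem cnt_setCnt (c : Conf (sig n m N)) (a : CntName N) (k : Fin (2 ^ m)) :
    cnt (setCnt c a k) a = k := Conf.set_self _ _ _

@[simp] theorem bit_setBit (c : Conf (sig n m N)) (b : BitName N) (y : ZMod 2) :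
    bit (setBit c b y) b = y := Conf.set_self _ _ _

@[simp] theorem arr_setArr (c : Conf (sig n m N)) (k : Fin (2 ^ m)) (x : Str n) :
    arr (setArr c k x) k = x := Conf.set_self _ _ _

theorem bit_setBit_of_ne (c : Conf (sig n m N)) {b b' : BitName N} (y : ZMod 2) (h : b' ≠ b) :
    bit (setBit c b y) b' = bit c b' :=
  setBit_apply_of_ne fun e => h (bitVar_injective e)

theorem arr_setArr_of_ne (c : Conf (sig n m N)) {k k' : Fin (2 ^ m)} (x : Str n) (h : k' ≠ k) :
    arr (setArr c k x) k' = arr c k' :=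
  setArr_apply_of_ne fun e => h (arrVar_injective e)

@[simp] theorem bit_setCnt (c : Conf (sig n m N)) (a : CntName N) (k : Fin (2 ^ m))
    (b : BitName N) : bit (setCnt c a k) b = bit c b :=
  setCnt_apply_of_ne (cntVar_ne_bitVar _ _).symm

@[simp] theorem arr_setCnt (c : Conf (sig n m N)) (a : CntName N) (k : Fin (2 ^ m))
    (j : Fin (2 ^ m)) : arr (setCnt c a k) j = arr c j :=
  setCnt_apply_of_ne (cntVar_ne_arrVar _ _).symm

@[simp] theorem cnt_setBit (c : Conf (sig n m N)) (b : BitName N) (y : ZMod 2)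
    (a : CntName N) : cnt (setBit c b y) a = cnt c a :=
  setBit_apply_of_ne (cntVar_ne_bitVar _ _)

@[simp] theorem arr_setBit (c : Conf (sig n m N)) (b : BitName N) (y : ZMod 2)
    (k : Fin (2 ^ m)) : arr (setBit c b y) k = arr c k :=
  setBit_apply_of_ne (bitVar_ne_arrVar _ _).symm

@[simp] theorem cnt_setArr (c : Conf (sig n m N)) (k : Fin (2 ^ m)) (x : Str n)
    (a : CntName N) : cnt (setArr c k x) a = cnt c a :=
  setArr_apply_of_ne (cntVar_ne_arrVar _ _)

@[simp] theorem bit_setArr (c : Conf (sig n m N)) (k : Fin (2 ^ m)) (x : Str n)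
    (b : BitName N) : bit (setArr c k x) b = bit c b :=
  setArr_apply_of_ne (bitVar_ne_arrVar _ _)

theorem setCnt_setCnt (c : Conf (sig n m N)) (a : CntName N) (k k' : Fin (2 ^ m)) :
    setCnt (setCnt c a k) a k' = setCnt c a k' := Conf.set_set _ _ _ _

theorem setCnt_cnt (c : Conf (sig n m N)) (a : CntName N) : setCnt c a (cnt c a) = c :=
  Conf.set_apply_self _ _

/-! ## Tuples and gates of the program -/

theorem q_distinct : Distinct (oneRef (q n m N)) := oneRef_distinct fun _ h => h

theorem Z_distinct : Distinct (oneRef (Z n m N)) := oneRef_distinct fun _ h => h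

theorem Xq_distinct : Distinct (oneRef (Xq n m N)) :=
  oneRef_distinct fun _ h => Ty.noConfusion (congrArg Sigma.fst h)

theorem pair_Xq_distinct (b : BitName N) :
    Distinct (pairRef (Xq n m N) (Ref.var (S := sig n m N) (τ := Ty.bit) (Sum.inl b))) := by
  refine pairRef_distinct (fun _ h => Ty.noConfusion (congrArg Sigma.fst h)) ?_ ?_
  · rintro _ (h | h)
    · exact Ty.noConfusion (congrArg Sigma.fst h)
    · exact h
  · rintro _ (h | h)
    · exact Ty.noConfusion (congrArg Sigma.fst h)
    · exact h

theorem Xq_Y_distinct : Distinct (pairRef (Xq n m N) (Y n m N)) := pair_Xq_distinct _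

theorem Xq_Y'_distinct : Distinct (pairRef (Xq n m N) (Y' n m N)) := pair_Xq_distinct _

theorem p_Z_distinct : Distinct (pairRef (p n m N) (Z n m N)) := by
  refine pairRef_distinct (fun _ h => Ty.noConfusion (congrArg Sigma.fst h)) ?_ ?_ <;>
  · rintro _ (h | h) <;> exact h

theorem pathRef_distinct {l : ℕ} (hlm : l < 2 ^ m) : Distinct (pathRef n m N l hlm) := by
  intro x
  constructor
  · rintro (_ | i) (_ | j) h
    · rfl
    · exact absurd h (bitVar_ne_arrVar _ _)
    · exact absurd h.symm (bitVar_ne_arrVar _ _)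
    · have := arrVar_injective (n := n) (N := N) h
      simp only [Fin.mk.injEq, Nat.add_right_cancel_iff] at this
      rw [Fin.ext this]
  · rintro i (_ | j) h
    · exact h
    · exact h

theorem setAt_q (c : Conf (sig n m N)) (u) :
    setAt (oneRef (q n m N)) c u = setCnt c .q (u ()) := setAt_oneRef q_distinct c u

theorem setAt_Xq (c : Conf (sig n m N)) (u) :
    setAt (oneRef (Xq n m N)) c u = setArr c (cnt c .q) (u ()) := setAt_oneRef Xq_distinct c u

theorem setAt_Xq_Y (c : Conf (sig n m N)) (u) : setAt (pairRef (Xq n m N) (Y n m N)) c u =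
    setBit (setArr c (cnt c .q) (u false)) .Y (u true) := setAt_pairRef Xq_Y_distinct c u

theorem setAt_Xq_Y' (c : Conf (sig n m N)) (u) : setAt (pairRef (Xq n m N) (Y' n m N)) c u =
    setBit (setArr c (cnt c .q) (u false)) .Y' (u true) := setAt_pairRef Xq_Y'_distinct c u

theorem setAt_p_Z (c : Conf (sig n m N)) (u) : setAt (pairRef (p n m N) (Z n m N)) c u =
    setBit (setCnt c .p (u false)) .Z (u true) := setAt_pairRef p_Z_distinct c u

theorem gate₁_basisMap {S : Sig} {τ : S.Ty} [DecidableEq (S.Val τ)] (f : S.Val τ → S.Val τ) :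
    gate₁ (basisMap f) = basisMap fun (u : Vals S (oneTy τ)) (_ : Unit) => f (u ()) := by
  have key : ∀ (a b : S.Val τ) (p : Prop) [Decidable p], (a = f b ↔ p) →
      basisMap f a b = if p then 1 else 0 := fun a b p _ h => if_congr h rfl rfl
  ext u w
  let g : Vals S (oneTy τ) → Vals S (oneTy τ) := fun u _ => f (u ())
  exact key (u ()) (w ()) (u = g w)
    ⟨fun h => funext fun _ => h, fun h => congrFun h ()⟩

theorem gate₁_diagonal {S : Sig} {τ : S.Ty} [DecidableEq (S.Val τ)] (d : S.Val τ → ℂ) :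
    gate₁ (Matrix.diagonal d) = Matrix.diagonal fun (u : Vals S (oneTy τ)) => d (u ()) := by
  have key : ∀ (a b : S.Val τ) (p : Prop) [Decidable p], (a = b ↔ p) →
      Matrix.diagonal d a b = if p then d a else 0 := fun a b p _ h => if_congr h rfl rfl
  ext u w
  exact key (u ()) (w ()) _ ⟨fun h => funext fun _ => h, fun h => congrFun h ()⟩

theorem sum_vals_one (f : Str n → ℂ) :
    ∑ u : Vals (sig n m N) (oneTy (S := sig n m N) Ty.str), f (u ()) = ∑ x, f x :=
  Fintype.sum_equiv (⟨fun u => u (), fun x _ => x, fun _ => rfl, fun _ => rfl⟩ :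
    Vals (sig n m N) (oneTy (S := sig n m N) Ty.str) ≃ Str n) _ _ fun _ => rfl

theorem sum_vals_pair (f : Str n → ZMod 2 → ℂ) :
    ∑ u : Vals (sig n m N) (pairTy (S := sig n m N) Ty.str Ty.bit), f (u false) (u true) =
      ∑ x, ∑ y, f x y := by
  rw [← Fintype.sum_prod_type']
  exact Fintype.sum_equiv
    { toFun := fun u => ((u false : Str n), (u true : ZMod 2))
      invFun := fun x b => match b with
        | false => x.1
        | true => x.2
      left_inv := fun u => by
        funext b
        cases b <;> rfl
      right_inv := fun _ => rfl } _ _ fun _ => rfl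

/-! ## The Hadamard transform -/

theorem hadamard_apply (a b : ZMod 2) :
    hadamard a b = (1 / (Real.sqrt 2 : ℂ)) * if a = 1 ∧ b = 1 then -1 else 1 := rfl

theorem zmod_two_cases (a : ZMod 2) : a = 0 ∨ a = 1 := by
  revert a
  decide

theorem sum_zmod_two (f : ZMod 2 → ℂ) : ∑ a, f a = f 0 + f 1 := Fin.sum_univ_two f

theorem one_div_sqrt_two_mul_self : (1 / (Real.sqrt 2 : ℂ)) * (1 / (Real.sqrt 2 : ℂ)) = 1 / 2 := by
  have h : ((Real.sqrt 2 : ℝ) : ℂ) * (Real.sqrt 2 : ℝ) = 2 := by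
    rw [← Complex.ofReal_mul, Real.mul_self_sqrt (by norm_num)]
    norm_num
  rw [div_mul_div_comm, h, one_mul]

theorem hadamard_mul_self : hadamard * hadamard = 1 := by
  ext a b
  have h := one_div_sqrt_two_mul_self
  rw [Matrix.mul_apply, sum_zmod_two]
  simp only [hadamard_apply]
  rcases zmod_two_cases a with rfl | rfl <;> rcases zmod_two_cases b with rfl | rfl <;>
    simp only [zero_ne_one, one_ne_zero, false_and, and_false, and_self, if_true, if_false,
      Matrix.one_apply_eq, Matrix.one_apply_ne, ne_eq, not_false_eq_true] <;>
    first | ring1 | linear_combination 2 * h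

theorem hadamard_comm (a b : ZMod 2) : hadamard a b = hadamard b a := by
  simp only [hadamard_apply, and_comm]

theorem star_hadamard (a b : ZMod 2) : star (hadamard a b) = hadamard a b := by
  rw [hadamard_apply]
  split_ifs <;> simp

/-- The character `(-1)^b`. -/
def sgn (b : ZMod 2) : ℂ := if b = 1 then -1 else 1

theorem sgn_zero : sgn 0 = 1 := if_neg zero_ne_one

theorem sgn_add (a b : ZMod 2) : sgn (a + b) = sgn a * sgn b := by
  have h : (1 + 1 : ZMod 2) = 0 := rfl
  rcases zmod_two_cases a with rfl | rfl <;> rcases zmod_two_cases b with rfl | rfl <;>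
    simp [sgn, h]

theorem sgn_mul_self (a : ZMod 2) : sgn a * sgn a = 1 := by
  rcases zmod_two_cases a with rfl | rfl <;> simp [sgn]

theorem hadamard_one_add (a b : ZMod 2) : hadamard 1 (a + b) = sgn b * hadamard 1 a := by
  have h : (1 + 1 : ZMod 2) = 0 := rfl
  rcases zmod_two_cases a with rfl | rfl <;> rcases zmod_two_cases b with rfl | rfl <;>
    simp [hadamard_apply, sgn, h]

theorem hadamard_eq_sgn (a b : ZMod 2) : hadamard a b = sgn (a * b) * hadamard 0 b := by
  rcases zmod_two_cases a with rfl | rfl <;> rcases zmod_two_cases b with rfl | rfl <;>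
    simp [hadamard_apply, sgn]

theorem hadamardN_mul_self (n : ℕ) : hadamardN n * hadamardN n = 1 := by
  ext a b
  simp only [Matrix.mul_apply, hadamardN, Matrix.of_apply, ← Finset.prod_mul_distrib]
  rw [← Fintype.prod_sum fun i j => hadamard (a i) j * hadamard j (b i)]
  simp only [← Matrix.mul_apply, hadamard_mul_self, Matrix.one_apply, Finset.prod_ite_zero,
    Finset.prod_const_one, Finset.mem_univ, true_imp_iff, funext_iff]

theorem hadamardN_comm (a b : Str n) : hadamardN n a b = hadamardN n b a := by
  simp only [hadamardN, Matrix.of_apply, hadamard_comm]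

theorem star_hadamardN (a b : Str n) : star (hadamardN n a b) = hadamardN n a b := by
  simp only [hadamardN, Matrix.of_apply, star_prod, star_hadamard]

theorem sgn_sum {ι : Type*} (s : Finset ι) (f : ι → ZMod 2) :
    sgn (∑ i ∈ s, f i) = ∏ i ∈ s, sgn (f i) := by
  classical
  induction s using Finset.induction_on with
  | empty => simp [sgn_zero]
  | insert i s hi ih => rw [Finset.sum_insert hi, Finset.prod_insert hi, sgn_add, ih]

/-- The factor by which row `a` differs from row `0` is the phase that a recursive call has to
supply. -/
theorem hadamardN_eq_sgn (a b : Str n) : hadamardN n a b = sgn (a ⬝ᵥ b) * hadamardN n 0 b := by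
  simp only [hadamardN, Matrix.of_apply, dotProduct, sgn_sum, ← Finset.prod_mul_distrib]
  exact Finset.prod_congr rfl fun i _ => hadamard_eq_sgn _ _

theorem hadamard_isUnitary : hadamard * hadamardᴴ = 1 ∧ hadamardᴴ * hadamard = 1 := by
  have : hadamardᴴ = hadamard := by
    ext a b
    rw [Matrix.conjTranspose_apply, star_hadamard, hadamard_comm]
  rw [this]
  exact ⟨hadamard_mul_self, hadamard_mul_self⟩

theorem hadamardN_conjTranspose : (hadamardN n)ᴴ = hadamardN n := by
  ext a b
  rw [Matrix.conjTranspose_apply, star_hadamardN, hadamardN_comm]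

theorem sum_hadamardN_sq (a : Str n) : ∑ x, star (hadamardN n a x) * hadamardN n a x = 1 := by
  have := congrFun (congrFun (hadamardN_mul_self n) a) a
  rw [Matrix.mul_apply, Matrix.one_apply_eq] at this
  rw [← this]
  exact Finset.sum_congr rfl fun x _ => by rw [star_hadamardN, hadamardN_comm x a]

theorem sum_hadamard_sq (a : ZMod 2) : ∑ y, star (hadamard a y) * hadamard a y = 1 := by
  have := congrFun (congrFun hadamard_mul_self a) a
  rw [Matrix.mul_apply, Matrix.one_apply_eq] at this
  rw [← this]
  exact Finset.sum_congr rfl fun x _ => by rw [star_hadamard, hadamard_comm x a]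


/-! ## The recursion stack -/

/-- The array index `k`. -/
def idx (m k : ℕ) : Fin (2 ^ m) := ⟨k % 2 ^ m, Nat.mod_lt _ (Nat.two_pow_pos m)⟩

theorem idx_eq_mk {k : ℕ} (h : k < 2 ^ m) : idx m k = ⟨k, h⟩ := Fin.ext (Nat.mod_eq_of_lt h)

theorem idx_val (k : Fin (2 ^ m)) : idx m k.val = k := Fin.ext (Nat.mod_eq_of_lt k.isLt)

/-- The qubits holding the target and the targets of the callers, innermost first. -/
def stackBit (N : ℕ) : ℕ → BitName N
  | 0 => .Y
  -- The default `.Y` plays no role: at the levels that matter, `j < l ≤ N`.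
  | j + 1 => if h : j < N then .fresh ⟨j, h⟩ else .Y

/-- The strings `X[k], …, X[1]`. -/
def path : ℕ → Conf (sig n m N) → List (Str n)
  | 0, _ => []
  | k + 1, c => arr c (idx m (k + 1)) :: path k c

/-- The targets of the callers, innermost first. -/
def below (k : ℕ) (c : Conf (sig n m N)) : List (ZMod 2) :=
  (List.range k).map fun j => bit c (stackBit N (j + 1))

/-- The current target and the targets of the callers, innermost first. -/
def stack (k : ℕ) (c : Conf (sig n m N)) : List (ZMod 2) :=
  (List.range (k + 1)).map fun j => bit c (stackBit N j)

theorem stack_eq_cons (k : ℕ) (c : Conf (sig n m N)) : stack k c = bit c .Y :: below k c := by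
  simp [stack, below, List.range_succ_eq_map, stackBit, Function.comp_def]

theorem path_length (k : ℕ) (c : Conf (sig n m N)) : (path k c).length = k := by
  induction k with
  | zero => rfl
  | succ k ih => simp [path, ih]

theorem stack_length (k : ℕ) (c : Conf (sig n m N)) : (stack k c).length = k + 1 := by
  simp [stack]

theorem path_congr {k : ℕ} {c c' : Conf (sig n m N)}
    (h : ∀ j, 1 ≤ j → j ≤ k → arr c (idx m j) = arr c' (idx m j)) : path k c = path k c' := by
  induction k with
  | zero => rfl
  | succ k ih =>
    rw [path, path, h _ (by omega) le_rfl, ih fun j h₁ h₂ => h j h₁ (by omega)]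

theorem arr_eq_of_path_eq {k : ℕ} {c c' : Conf (sig n m N)} (h : path k c = path k c')
    (j : ℕ) (h₁ : 1 ≤ j) (h₂ : j ≤ k) : arr c (idx m j) = arr c' (idx m j) := by
  induction k with
  | zero => omega
  | succ k ih =>
    rw [path, path, List.cons.injEq] at h
    rcases Nat.lt_or_ge j (k + 1) with hj | hj
    · exact ih h.2 (by omega)
    · rw [show j = k + 1 by omega]
      exact h.1

theorem bit_eq_of_stack_eq {k : ℕ} {c c' : Conf (sig n m N)} (h : stack k c = stack k c')
    (j : ℕ) (hj : j ≤ k) : bit c (stackBit N j) = bit c' (stackBit N j) :=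
  List.map_inj_left.1 h j (List.mem_range.2 (by omega))

theorem below_congr {k : ℕ} {c c' : Conf (sig n m N)}
    (h : ∀ j < k, bit c (stackBit N (j + 1)) = bit c' (stackBit N (j + 1))) :
    below k c = below k c' :=
  List.map_inj_left.2 fun j hj => h j (List.mem_range.1 hj)

/-- The variables that hold the recursion stack at level `k`. -/
def frameVars (k : ℕ) : Set (AnyVar (sig n m N)) :=
  {v | (∃ j, 1 ≤ j ∧ j ≤ k ∧ v = arrVar (idx m j)) ∨ ∃ j ≤ k, v = bitVar (stackBit N j)}

/-- The recursion level: the value of the counter `q`. -/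
def level (c : Conf (sig n m N)) : ℕ := (cnt c .q).val

open Classical in
/-- The values of the variables outside the recursion stack. -/
def rest (c : Conf (sig n m N)) : Conf (sig n m N) := fun v =>
  if v ∈ frameVars (level c) then (sig n m N).zero v.1 else c v

theorem cntVar_notMem_frameVars (a : CntName N) (k : ℕ) :
    (cntVar a : AnyVar (sig n m N)) ∉ frameVars k := by
  rintro (⟨j, _, _, h⟩ | ⟨j, _, h⟩)
  · exact cntVar_ne_arrVar _ _ h
  · exact cntVar_ne_bitVar _ _ h

theorem rest_of_mem {c : Conf (sig n m N)} {v : AnyVar (sig n m N)}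
    (h : v ∈ frameVars (level c)) : rest c v = (sig n m N).zero v.1 := if_pos h

theorem rest_of_notMem {c : Conf (sig n m N)} {v : AnyVar (sig n m N)}
    (h : v ∉ frameVars (level c)) : rest c v = c v := if_neg h

/-- The counter is never on the stack, so states with equal rests have the same level and hide the
same variables. -/
theorem rest_eq_iff {c c' : Conf (sig n m N)} :
    rest c = rest c' ↔ cnt c .q = cnt c' .q ∧ ∀ v, v ∉ frameVars (level c) → c v = c' v := by
  constructor
  · intro h
    have hq : cnt c .q = cnt c' .q :=
      (rest_of_notMem (cntVar_notMem_frameVars _ _)).symm.trans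
        ((congrFun h (cntVar .q)).trans (rest_of_notMem (cntVar_notMem_frameVars _ _)))
    have hl : level c = level c' := congrArg Fin.val hq
    exact ⟨hq, fun v hv => (rest_of_notMem hv).symm.trans
      ((congrFun h v).trans (rest_of_notMem (hl ▸ hv)))⟩
  · rintro ⟨hq, h⟩
    have hl : level c = level c' := congrArg Fin.val hq
    funext v
    by_cases hv : v ∈ frameVars (level c)
    · rw [rest_of_mem hv, rest_of_mem (hl ▸ hv)]
    · rw [rest_of_notMem hv, rest_of_notMem (hl ▸ hv), h v hv]

/-- The recursion stack. -/
def data (c : Conf (sig n m N)) : List (Str n) × List (ZMod 2) :=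
  (path (level c) c, stack (level c) c)

/-- The stacks of height at most `l`. -/
def IsStack (l : ℕ) : Set (List (Str n) × List (ZMod 2)) :=
  {d | d.1.length ≤ l ∧ d.2.length = d.1.length + 1}

theorem data_mem {l : ℕ} {c : Conf (sig n m N)} (h : level c ≤ l) : data c ∈ IsStack l := by
  simp [data, IsStack, path_length, stack_length, h]

/-- This injectivity is what bounds the specification terms by `I`. -/
theorem eq_of_data_eq {c c' : Conf (sig n m N)} (h : data c = data c') (hr : rest c = rest c') :
    c = c' := by
  obtain ⟨hq, h'⟩ := rest_eq_iff.1 hr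
  have hl : level c = level c' := congrArg Fin.val hq
  simp only [data, ← hl, Prod.mk.injEq] at h
  funext v
  by_cases hv : v ∈ frameVars (level c)
  · rcases hv with ⟨j, h₁, h₂, rfl⟩ | ⟨j, h₂, rfl⟩
    · exact arr_eq_of_path_eq h.1 j h₁ h₂
    · exact bit_eq_of_stack_eq h.2 j h₂
  · exact h' v hv

theorem isStack_finite (n l : ℕ) : (IsStack l : Set (List (Str n) × List (ZMod 2))).Finite := by
  refine Set.Finite.subset ((List.finite_length_le (Str n) l).prod
    (List.finite_length_le (ZMod 2) (l + 1))) ?_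
  rintro d ⟨h₁, h₂⟩
  exact ⟨h₁, by simp only [Set.mem_ofPred_eq]; omega⟩

/-- The stacks of height at most `l` can be stored in sufficiently many string variables. -/
theorem exists_encoding (n l : ℕ) (hn : 0 < n) : ∃ N₀ : ℕ, ∀ N, N₀ ≤ N →
    ∃ enc : List (Str n) × List (ZMod 2) → Fin N → Str n, Set.InjOn enc (IsStack l) := by
  -- The number of stacks is a sufficient bound, because `N < (2 ^ n) ^ N` when `n > 0`.
  refine ⟨(IsStack l : Set (List (Str n) × List (ZMod 2))).ncard, fun N hN => ?_⟩
  obtain ⟨f, -, hf⟩ := (isStack_finite n l).exists_injOn_of_encard_le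
    (t := (Set.univ : Set (Fin N → Str n))) (by
      rw [← (isStack_finite n l).cast_ncard_eq, ← Set.finite_univ.cast_ncard_eq, Set.ncard_univ,
        Nat.card_eq_fintype_card]
      simp only [Fintype.card_pi, Finset.prod_const, Finset.card_univ, Fintype.card_fin, ZMod.card]
      exact_mod_cast hN.trans (Nat.lt_pow_self (Nat.one_lt_pow hn.ne' one_lt_two)).le)
  exact ⟨f, hf⟩

/-! ## Operators on the string variables -/

/-- The basis state `c` with the simple string variables set to `t`. -/
def setStrs (c : Conf (sig n m N)) (t : Fin N → Str n) : Conf (sig n m N) := fun v =>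
  match v with
  | ⟨Ty.str, Sum.inl i⟩ => t i
  | v => c v

theorem strs_setStrs (c : Conf (sig n m N)) (t : Fin N → Str n) : strs (setStrs c t) = t := rfl

theorem setStrs_apply_of_ne (c : Conf (sig n m N)) (t : Fin N → Str n) {v : AnyVar (sig n m N)}
    (h : ∀ i, v ≠ strVar i) : setStrs c t v = c v := by
  rcases anyVar_cases v with ⟨a, rfl⟩ | ⟨a, rfl⟩ | ⟨a, rfl⟩ | ⟨a, rfl⟩
  · rfl
  · rfl
  · exact absurd rfl (h a)
  · rfl

theorem setStrs_eq_iff {c c' : Conf (sig n m N)} {t t' : Fin N → Str n} :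
    setStrs c t = setStrs c' t' ↔ t = t' ∧ ∀ v, (∀ i, v ≠ strVar i) → c v = c' v := by
  constructor
  · intro h
    refine ⟨by rw [← strs_setStrs c t, h, strs_setStrs], fun v hv => ?_⟩
    rw [← setStrs_apply_of_ne c t hv, h, setStrs_apply_of_ne c' t' hv]
  · rintro ⟨rfl, h⟩
    funext v
    by_cases hv : ∃ i, v = strVar i
    · obtain ⟨i, rfl⟩ := hv
      rfl
    · push Not at hv
      rw [setStrs_apply_of_ne c t hv, setStrs_apply_of_ne c' t hv, h v hv]

/-- The basis state with all variables zero. -/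
def zeroConf (n m N : ℕ) : Conf (sig n m N) := fun v => (sig n m N).zero v.1

/-- The basis state with string variables `t` and all other variables zero. -/
def emb (t : Fin N → Str n) : Conf (sig n m N) := setStrs (zeroConf n m N) t

/-- The operator `|t⟩ ↦ w(t) |tr(t)⟩` on the simple string variables. -/
def strOp (tr : (Fin N → Str n) → Fin N → Str n) (w : (Fin N → Str n) → ℂ) : Op (sig n m N) :=
  Matrix.of fun e c => if e = setStrs c (tr (strs c)) then w (strs c) else 0

open Classical in
theorem strOp_localTo (tr : (Fin N → Str n) → Fin N → Str n) (w : (Fin N → Str n) → ℂ) :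
    LocalTo (Set.range (strVar (n := n) (m := m))) (strOp tr w) := by
  refine ⟨fun a b => if (fun i => a ⟨strVar i, i, rfl⟩) = tr (fun i => b ⟨strVar i, i, rfl⟩) then
    w (fun i => b ⟨strVar i, i, rfl⟩) else 0, fun x y => ⟨fun h => ?_, ?_⟩⟩
  · have h' : x = setStrs y (tr (strs y)) ↔ strs x = tr (strs y) := by
      constructor
      · intro e
        rw [e, strs_setStrs]
      · intro e
        funext v
        by_cases hv : ∃ i, v = strVar i
        · obtain ⟨i, rfl⟩ := hv
          exact congrFun e i
        · push Not at hv
          rw [setStrs_apply_of_ne _ _ hv]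
          exact h v (by rintro ⟨i, rfl⟩; exact hv i rfl)
    exact if_congr h' rfl rfl
  · rintro ⟨v, hv, hne⟩
    refine if_neg fun e => hne ?_
    rw [e, setStrs_apply_of_ne]
    rintro i rfl
    exact hv ⟨i, rfl⟩

theorem conj_strOp_apply (tr : (Fin N → Str n) → Fin N → Str n) (w : (Fin N → Str n) → ℂ)
    (B : Op (sig n m N)) (t t' : Fin N → Str n) :
    ((strOp tr w)ᴴ * B * strOp tr w : Op (sig n m N)) (emb t) (emb t') =
      star (w t) * w t' * B (emb (tr t)) (emb (tr t')) := by
  have h : ∀ t, setStrs (emb t : Conf (sig n m N)) (tr (strs (emb t : Conf (sig n m N)))) =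
      emb (tr t) := by
    intro t
    unfold emb
    rw [setStrs_eq_iff]
    exact ⟨rfl, fun v hv => setStrs_apply_of_ne _ _ hv⟩
  have h' : ∀ t, strs (emb t : Conf (sig n m N)) = t := fun t => rfl
  simp only [Matrix.mul_apply, strOp, Matrix.conjTranspose_apply, Matrix.of_apply, h]
  simp [apply_ite, ite_mul, h']
  ring

/-- Substituting a term with a single Kraus operator `strOp` for the store stays within frames: the
maps compose and the weights multiply. -/
theorem frame_strOp (ρ : Conf (sig n m N) → Conf (sig n m N)) (t : Conf (sig n m N) → Fin N → Str n)
    (w : Conf (sig n m N) → ℂ) (tr : (Fin N → Str n) → Fin N → Str n)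
    (w' : (Fin N → Str n) → ℂ) (B : Op (sig n m N)) :
    frame ρ (fun c => emb (t c)) w ((strOp tr w')ᴴ * B * strOp tr w') =
      frame ρ (fun c => emb (tr (t c))) (fun c => w c * w' (t c)) B := by
  ext c c'
  simp only [frame, Matrix.of_apply]
  split_ifs
  · rw [conj_strOp_apply, star_mul']
    ring
  · rfl

/-- Each row of the operator lives on one fibre of `tr`. The hypothesis makes every nonzero row a
unit vector, and different fibres give orthogonal rows, so the operator is a partial isometry. -/
theorem strOp_bound {tr : (Fin N → Str n) → Fin N → Str n} {w : (Fin N → Str n) → ℂ}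
    (h : ∀ t, w t ≠ 0 → ∑ t', (if tr t' = tr t then w t' * star (w t') else 0) = 1) :
    Loewner ((strOp tr w : Op (sig n m N))ᴴ * strOp tr w) 1 := by
  refine loewner_one_of_partialIsometry ?_
  ext e c
  have h₁ : (strOp tr w * (strOp tr w)ᴴ * strOp tr w : Op (sig n m N)) e c =
      ∑ c', (if e = setStrs c' (tr (strs c')) then w (strs c') else 0) *
        star (if setStrs c (tr (strs c)) = setStrs c' (tr (strs c')) then w (strs c') else 0) *
          w (strs c) := by
    simp only [Matrix.mul_apply (M := strOp tr w * (strOp tr w)ᴴ)]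
    simp only [strOp, Matrix.of_apply, mul_ite, mul_zero, Finset.sum_ite_eq',
      Finset.mem_univ, if_true]
    rw [Matrix.mul_apply, Finset.sum_mul]
    rfl
  rw [h₁, ← Finset.sum_mul]
  simp only [strOp, Matrix.of_apply]
  by_cases hw : w (strs c) = 0
  · simp [hw]
  have h₂ := h _ hw
  by_cases he : e = setStrs c (tr (strs c))
  · rw [if_pos he]
    have : ∑ c', (if e = setStrs c' (tr (strs c')) then w (strs c') else 0) *
        star (if setStrs c (tr (strs c)) = setStrs c' (tr (strs c')) then w (strs c') else 0) =
        ∑ t', (if tr t' = tr (strs c) then w t' * star (w t') else 0) := by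
      refine (Fintype.sum_of_injective (setStrs c) ?_ _ _ ?_ ?_).symm
      · intro t t' ht
        exact (setStrs_eq_iff.1 ht).1
      · intro c' hc'
        rw [if_neg, zero_mul]
        intro h₃
        refine hc' ⟨strs c', ?_⟩
        rw [he] at h₃
        have h₄ := (setStrs_eq_iff.1 h₃).2
        funext v
        by_cases hv : ∃ i, v = strVar i
        · obtain ⟨i, rfl⟩ := hv
          rfl
        · push Not at hv
          rw [setStrs_apply_of_ne _ _ hv, h₄ v hv]
      · intro t
        have h₃ : ∀ t', setStrs c (tr (strs c)) = setStrs (setStrs c t) t' ↔ t' = tr (strs c) :=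
          fun t' => by
            rw [setStrs_eq_iff]
            refine ⟨fun h => h.1.symm, fun h => ⟨h.symm, fun v hv => ?_⟩⟩
            rw [setStrs_apply_of_ne _ _ hv]
        rw [he]
        simp only [strs_setStrs, h₃]
        split_ifs <;> simp
    rw [this, h₂, one_mul]
  · rw [if_neg he]
    have : ∀ c', (if e = setStrs c' (tr (strs c')) then w (strs c') else 0) *
        star (if setStrs c (tr (strs c)) = setStrs c' (tr (strs c')) then w (strs c') else 0)
          = 0 := by
      intro c'
      by_cases h₃ : e = setStrs c' (tr (strs c'))
      · rw [if_neg (c := setStrs c _ = _) fun h₄ => he (h₃.trans h₄.symm), star_zero, mul_zero]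
      · rw [if_neg h₃, zero_mul]
    rw [Finset.sum_eq_zero fun c' _ => this c', zero_mul]


/-! ## Renamings of counters and qubits -/

/-- The renaming given by permutations of the counters and of the qubits. -/
def mkRen (π₁ : Equiv.Perm (CntName N)) (π₂ : Equiv.Perm (BitName N)) : Ren (sig n m N) := fun τ =>
  match τ with
  | Ty.cnt => π₁
  | Ty.str => Equiv.refl _
  | Ty.bit => π₂

variable {π₁ : Equiv.Perm (CntName N)} {π₂ : Equiv.Perm (BitName N)}

theorem ren_bitVar (b : BitName N) :
    AnyVar.ren (mkRen π₁ π₂) (bitVar b : AnyVar (sig n m N)) = bitVar (π₂ b) := rfl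

theorem cnt_pre (c : Conf (sig n m N)) (a : CntName N) :
    cnt (Conf.pre (mkRen π₁ π₂) c) a = cnt c (π₁ a) := rfl

theorem bit_pre (c : Conf (sig n m N)) (b : BitName N) :
    bit (Conf.pre (mkRen π₁ π₂) c) b = bit c (π₂ b) := rfl

theorem pre_emb (t : Fin N → Str n) :
    Conf.pre (mkRen π₁ π₂) (emb t : Conf (sig n m N)) = emb t := by
  funext v
  rcases anyVar_cases v with ⟨a, rfl⟩ | ⟨a, rfl⟩ | ⟨a, rfl⟩ | ⟨a, rfl⟩ <;> rfl

/-- The predicate variable on the simple string variables. -/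
def store (n m N : ℕ) : PVar (sig n m N) := ⟨0, Set.range strVar⟩

theorem store_ren : PVar.ren (mkRen π₁ π₂) (store n m N) = store n m N := by
  have : AnyVar.ren (mkRen π₁ π₂) '' Set.range (strVar (n := n) (m := m) (N := N)) =
      Set.range strVar := by
    rw [← Set.range_comp]
    rfl
  simp only [PVar.ren, store, this]

/-- Here `q` and `Y` are formal parameters, `Y'` is bound by the local block, and `X[q]` is reached
only through its index; what remains are the components named by `𝒪`. Hence renamings of counters
and qubits always meet the side condition of (R Adap). -/
theorem mem_globals {l : ℕ} {hlm : l < 2 ^ m} {g : Str n → ZMod 2}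
    {s : List (Str n) → Str n} {v : AnyVar (sig n m N)}
    (h : v ∈ (decl n m N l hlm g s).globals) : ∃ k, v = arrVar k := by
  simp only [Decl.globals, Set.mem_iUnion, Set.mem_sdiff] at h
  obtain ⟨_, h, hn⟩ := h
  have hq : v ≠ cntVar .q := fun e => hn ⟨.ctr, e.symm⟩
  have hY : v ≠ bitVar .Y := fun e => hn ⟨.tgt, e.symm⟩
  have hu : ∀ {ι : Type} [Finite ι] {Γ : ι → (sig n m N).Ty} {r : Refs (sig n m N) Γ} {U},
      v ∈ (Stmt.unit r U).free → ∃ i, v ∈ (r i).named ∪ (r i).index := fun h => by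
    simpa only [Stmt.free, Set.mem_iUnion] using h
  have h₁ : ∀ U, v ∉ (Stmt.unit (oneRef (q n m N)) U).free := fun U h => by
    obtain ⟨i, h | h⟩ := hu h
    · exact hq h
    · exact h
  have h₂ : ∀ U, v ∉ (Stmt.unit (oneRef (Xq n m N)) U).free := fun U h => by
    obtain ⟨i, h | h⟩ := hu h
    · exact h
    · exact hq h
  have h₃ : ∀ U, v ∉ (Stmt.unit (pairRef (Xq n m N) (Y n m N)) U).free := fun U h => by
    obtain ⟨_ | _, h | h⟩ := hu h
    · exact h
    · exact hq h
    · exact hY h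
    · exact h
  have h₄ : ∀ U, v ∈ (Stmt.unit (pairRef (Xq n m N) (Y' n m N)) U).free → v = bitVar .Y' :=
    fun U h => by
      obtain ⟨_ | _, h | h⟩ := hu h
      · exact h.elim
      · exact absurd h hq
      · exact h
      · exact h.elim
  have h₅ : v ∈ (innerCall n m N).free → v = bitVar .Y' := fun h => by
    obtain ⟨i, rfl⟩ := h
    cases i
    · exact absurd rfl hq
    · rfl
  have h₆ : v ∈ (localBody n m N g).free → v = bitVar .Y' := fun h => by
    rcases h with h | h | h | h | h | h | h
    · exact h₄ _ h
    · exact h₅ h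
    · exact absurd h (h₂ _)
    · exact absurd h (h₃ _)
    · exact absurd h (h₂ _)
    · exact h₅ h
    · exact h₄ _ h
  have h₇ : v ∉ (Stmt.loc (pairRef (Xq n m N) (Y' n m N)) (localBody n m N g)).free := by
    rintro (⟨h, h'⟩ | h)
    · exact h' (Set.mem_iUnion.2 ⟨true, h₆ h⟩)
    · obtain ⟨_ | _, h⟩ := Set.mem_iUnion.1 h
      · exact hq h
      · exact h
  rcases h with h | h
  · obtain ⟨_, h | h⟩ := Set.mem_iUnion.1 h
    · exact absurd h hq
    · exact h.elim
  · obtain ⟨k, h⟩ := Set.mem_iUnion.1 h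
    match k, h with
    | 0, h =>
      rcases h with h | h | h
      · exact absurd h (h₁ _)
      · exact absurd h h₇
      · exact absurd h (h₁ _)
    | 1, h =>
      obtain ⟨_ | j, h | h⟩ := hu h
      · exact absurd h hY
      · exact h.elim
      · exact ⟨_, h⟩
      · exact h.elim
    | 2, h => exact h.elim

theorem mkRen_fixes_globals {l : ℕ} {hlm : l < 2 ^ m} {g : Str n → ZMod 2}
    {s : List (Str n) → Str n} :
    Ren.Fixes (mkRen π₁ π₂) (decl n m N l hlm g s).globals := by
  intro v hv
  obtain ⟨k, rfl⟩ := mem_globals hv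
  rfl

/-- Renaming and instantiating a hypothesis about the recursive call. -/
theorem call_rule {l : ℕ} {hlm : l < 2 ^ m} {g : Str n → ZMod 2} {s : List (Str n) → Str n}
    {T : Set (PQPT (sig n m N) × PQPT (sig n m N))} {A : Set (Triple (sig n m N))}
    {t₁ t₂ : Conf (sig n m N) → Fin N → Str n} {w : Conf (sig n m N) → ℂ}
    {h₁ : Loewner (frame rest (fun c => emb (t₁ c)) w 1) 1}
    {h₂ : Loewner (frame rest (fun c => emb (t₂ c)) w 1) 1}
    (hA : (⟨frameTerm (store n m N) rest (fun c => emb (t₁ c)) w h₁, .call () (args n m N .q .Y),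
      frameTerm (store n m N) rest (fun c => emb (t₂ c)) w h₂⟩ : Triple (sig n m N)) ∈ A)
    (π₁ : Equiv.Perm (CntName N)) (π₂ : Equiv.Perm (BitName N))
    {R P' Q' : PQPT (sig n m N)} (hR : R.On (Set.range strVar))
    (hP : P'.Params = R.Params) (hQ : Q'.Params = R.Params)
    (hP' : ∀ v, IsAssignment v → P'.den v = frame (rest ∘ Conf.pre (mkRen π₁ π₂))
      (fun c => emb (t₁ (Conf.pre (mkRen π₁ π₂) c))) (w ∘ Conf.pre (mkRen π₁ π₂)) (R.den v))
    (hQ' : ∀ v, IsAssignment v → Q'.den v = frame (rest ∘ Conf.pre (mkRen π₁ π₂))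
      (fun c => emb (t₂ (Conf.pre (mkRen π₁ π₂) c))) (w ∘ Conf.pre (mkRen π₁ π₂)) (R.den v)) :
    QBE (decl n m N l hlm g s) T A P' (.call () (args n m N (π₁ .q) (π₂ .Y))) Q' := by
  have hb : ∀ {t : Conf (sig n m N) → Fin N → Str n},
      Loewner (frame rest (fun c => emb (t c)) w 1) 1 →
      Loewner (frame (rest ∘ Conf.pre (mkRen π₁ π₂))
        (fun c => emb (t (Conf.pre (mkRen π₁ π₂) c))) (w ∘ Conf.pre (mkRen π₁ π₂)) 1) 1 :=
    fun h => frame_bound_comp h (Conf.pre_injective _)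
  have hsub : ∀ {t : Conf (sig n m N) → Fin N → Str n}
      {h : Loewner (frame (rest ∘ Conf.pre (mkRen π₁ π₂))
        (fun c => emb (t (Conf.pre (mkRen π₁ π₂) c))) (w ∘ Conf.pre (mkRen π₁ π₂)) 1) 1}
      {P : PQPT (sig n m N)}, P.Params = R.Params →
      (∀ v, IsAssignment v → P.den v = frame (rest ∘ Conf.pre (mkRen π₁ π₂))
        (fun c => emb (t (Conf.pre (mkRen π₁ π₂) c))) (w ∘ Conf.pre (mkRen π₁ π₂)) (R.den v)) →
      IsSubst (store n m N) R (frameTerm (store n m N) _ _ _ h) P := by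
    intro t h P hp hd
    -- With a single parameter the restriction on the form of `R` is void.
    refine ⟨fun h => absurd h (by simp [frameTerm]), ?_, fun v hv => ?_⟩
    · rw [hp, frameTerm_Params]
      ext Y
      simp
    · simp only [hd v hv, frameTerm_den, Function.update_self]
  have key := QBE.adap (T := T) (mkRen_fixes_globals (π₁ := π₁) (π₂ := π₂) (hlm := hlm) (g := g)
    (s := s)) (isRen_frameTerm (mkRen π₁ π₂) h₁ (hb h₁) store_ren fun c => (pre_emb _).symm)
    (isRen_frameTerm (mkRen π₁ π₂) h₂ (hb h₂) store_ren fun c => (pre_emb _).symm) (QBE.hyp hA)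
  have hc : Stmt.ren (mkRen π₁ π₂) (.call () (args n m N .q .Y)) =
      .call () (args n m N (π₁ .q) (π₂ .Y)) := by
    change Stmt.call (S := sig n m N) () _ = _
    congr 1
    funext i
    cases i <;> rfl
  rw [hc] at key
  exact QBE.subst (X := store n m N) hR (hsub hP hP') (hsub hQ hQ') key

/-! ## The specification of the procedure -/

/-- Adding `h(x₁, …, xₖ)` to the current target. -/
def flip (h : List (Str n) → ZMod 2) :
    List (Str n) × List (ZMod 2) → List (Str n) × List (ZMod 2)
  | (a, y :: t) => (a, (y + h a) :: t)
  | (a, []) => (a, [])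

/-- The strings that determine the added bit stay on the stack, so the addition can be undone. -/
theorem flip_injective (h : List (Str n) → ZMod 2) : Function.Injective (flip h) := by
  rintro ⟨a, _ | ⟨y, t⟩⟩ ⟨a', _ | ⟨y', t'⟩⟩ e <;>
    simp only [flip, Prod.mk.injEq, List.cons.injEq, reduceCtorEq, and_false] at e
  · rw [e.1]
  · obtain ⟨rfl, h₁, rfl⟩ := e
    rw [add_right_cancel h₁]

theorem flip_mem {l : ℕ} {h : List (Str n) → ZMod 2} {d : List (Str n) × List (ZMod 2)}
    (hd : d ∈ IsStack l) : flip h d ∈ IsStack l := by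
  obtain ⟨a, _ | ⟨y, t⟩⟩ := d
  · exact hd
  · exact hd

theorem indicator_cases (p : Prop) [Decidable p] :
    (if p then (1 : ℂ) else 0) = 0 ∨ (if p then (1 : ℂ) else 0) = 1 := by
  split_ifs
  · exact Or.inr rfl
  · exact Or.inl rfl

/-- The bound `L ≤ l + 1` keeps all stacks in the set on which `enc` is injective, so code and rest
recover the state. -/
theorem spec_injective {l L : ℕ} {enc : List (Str n) × List (ZMod 2) → Fin N → Str n}
    (henc : Set.InjOn enc (IsStack l)) (hL : L ≤ l + 1) (h : List (Str n) → ZMod 2)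
    (c c' : Conf (sig n m N)) (hc : (if level c < L then (1 : ℂ) else 0) ≠ 0)
    (hc' : (if level c' < L then (1 : ℂ) else 0) ≠ 0) (hr : rest c = rest c')
    (he : (emb (enc (flip h (data c))) : Conf (sig n m N)) = emb (enc (flip h (data c')))) :
    c = c' := by
  have h₁ : level c < L := by
    by_contra h
    exact hc (if_neg h)
  have h₂ : level c' < L := by
    by_contra h
    exact hc' (if_neg h)
  exact eq_of_data_eq (flip_injective h (henc (flip_mem (data_mem (by omega)))
    (flip_mem (data_mem (by omega))) (setStrs_eq_iff.1 he).1)) hr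

theorem spec_bound {l L : ℕ} {enc : List (Str n) × List (ZMod 2) → Fin N → Str n}
    (henc : Set.InjOn enc (IsStack l)) (hL : L ≤ l + 1) (h : List (Str n) → ZMod 2) :
    Loewner (frame rest (fun c : Conf (sig n m N) => emb (enc (flip h (data c))))
      (fun c => if level c < L then 1 else 0) 1) 1 :=
  frame_bound_of_injective (fun _ => indicator_cases _) (spec_injective henc hL h)

/-- The predicate that the store, read off the recursion stack after adding `h` to the target, is
`store`, at the levels below `L`. -/
def specTerm (m : ℕ) {l L : ℕ} {enc : List (Str n) × List (ZMod 2) → Fin N → Str n}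
    (henc : Set.InjOn enc (IsStack l)) (hL : L ≤ l + 1) (h : List (Str n) → ZMod 2) :
    PQPT (sig n m N) :=
  frameTerm (store n m N) rest (fun c => emb (enc (flip h (data c))))
    (fun c => if level c < L then 1 else 0) (spec_bound henc hL h)

/-! ## Popping the recursion stack -/

/-- The weight given to the innermost string and target. -/
def popWeight (ω : Str n → List (Str n) → ZMod 2 → ℂ) : List (Str n) × List (ZMod 2) → ℂ
  | (x :: xs, y :: _ :: _) => ω x xs y
  | _ => 0

/-- Removing the innermost string and target, and adding `f` to the new innermost target. -/
def popMap (f : List (Str n) → ZMod 2) :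
    List (Str n) × List (ZMod 2) → List (Str n) × List (ZMod 2)
  | (_ :: xs, _ :: y :: ys) => (xs, (y + f xs) :: ys)
  | d => d

/-- For each history, the weights of the innermost string and target are a unit vector. -/
def Normalized (ω : Str n → List (Str n) → ZMod 2 → ℂ) : Prop :=
  ∀ xs, ∑ x, ∑ y, ω x xs y * star (ω x xs y) = 1

section pop

variable {l : ℕ} (enc : List (Str n) × List (ZMod 2) → Fin N → Str n)

/-- A stack stored as `t`. -/
def decode (l : ℕ) (t : Fin N → Str n) : List (Str n) × List (ZMod 2) :=
  Function.invFunOn enc (IsStack l) t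

theorem decode_enc {enc : List (Str n) × List (ZMod 2) → Fin N → Str n}
    (henc : Set.InjOn enc (IsStack l)) {d} (hd : d ∈ IsStack l) : decode enc l (enc d) = d :=
  henc.leftInvOn_invFunOn hd

/-- `popMap` on stored stacks. -/
def storedMap (l : ℕ) (f : List (Str n) → ZMod 2) (t : Fin N → Str n) : Fin N → Str n :=
  enc (popMap f (decode enc l t))

open Classical in
/-- `popWeight` on stored stacks. -/
def storedWeight (l : ℕ) (ω : Str n → List (Str n) → ZMod 2 → ℂ) (t : Fin N → Str n) : ℂ :=
  -- Off the codes `decode` returns an arbitrary value; weight `0` discards it.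
  if t ∈ enc '' IsStack l then popWeight ω (decode enc l t) else 0

variable {enc}

theorem storedMap_enc (henc : Set.InjOn enc (IsStack l)) (f : List (Str n) → ZMod 2) {d}
    (hd : d ∈ IsStack l) : storedMap enc l f (enc d) = enc (popMap f d) := by
  rw [storedMap, decode_enc henc hd]

theorem storedWeight_enc (henc : Set.InjOn enc (IsStack l))
    (ω : Str n → List (Str n) → ZMod 2 → ℂ) {d} (hd : d ∈ IsStack l) :
    storedWeight enc l ω (enc d) = popWeight ω d := by
  rw [storedWeight, if_pos ⟨d, hd, rfl⟩, decode_enc henc hd]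

theorem exists_of_storedWeight_ne_zero (henc : Set.InjOn enc (IsStack l))
    {ω : Str n → List (Str n) → ZMod 2 → ℂ} {t : Fin N → Str n} (h : storedWeight enc l ω t ≠ 0) :
    ∃ x xs y y₁ ys, (x :: xs, y :: y₁ :: ys) ∈ IsStack l ∧ t = enc (x :: xs, y :: y₁ :: ys) := by
  by_cases ht : t ∈ enc '' IsStack l
  · obtain ⟨d, hd, rfl⟩ := ht
    rw [storedWeight_enc henc ω hd] at h
    obtain ⟨_ | ⟨x, xs⟩, _ | ⟨y, _ | ⟨y₁, ys⟩⟩⟩ := d <;> simp only [popWeight, ne_eq,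
      not_true_eq_false] at h
    exact ⟨_, _, _, _, _, hd, rfl⟩
  · exact absurd (if_neg ht) h

theorem stored_bound (henc : Set.InjOn enc (IsStack l)) {ω : Str n → List (Str n) → ZMod 2 → ℂ}
    (hω : Normalized ω) (f : List (Str n) → ZMod 2) :
    Loewner ((strOp (storedMap enc l f) (storedWeight enc l ω) : Op (sig n m N))ᴴ *
      strOp (storedMap enc l f) (storedWeight enc l ω)) 1 := by
  refine strOp_bound fun t ht => ?_
  obtain ⟨x, xs, y, y₁, ys, hd, rfl⟩ := exists_of_storedWeight_ne_zero henc ht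
  have hpop : ∀ x y, (x :: xs, y :: y₁ :: ys) ∈ IsStack l := fun x y => hd
  have hmem : ∀ {x : Str n} {xs : List (Str n)} {y y₁ y₂ : ZMod 2} {ys : List (ZMod 2)},
      (x :: xs, y :: y₁ :: ys) ∈ IsStack l → (xs, y₂ :: ys) ∈ IsStack l := by
    intro x xs y y₁ y₂ ys h
    simp only [IsStack, Set.mem_ofPred_eq, List.length_cons] at h ⊢
    omega
  -- The stacks of nonzero weight that pop to the same stack share the history `xs` and differ only
  -- in the innermost string and target. The sum over the fibre is thus the one in `hω xs`.
  rw [← hω xs, ← Fintype.sum_prod_type']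
  refine (Fintype.sum_of_injective
    (fun z : Str n × ZMod 2 => enc (z.1 :: xs, z.2 :: y₁ :: ys)) ?_ _ _ ?_ ?_).symm
  · intro z z' hz
    have := henc (hpop z.1 z.2) (hpop z'.1 z'.2) hz
    simp only [Prod.mk.injEq, List.cons.injEq, and_true] at this
    exact Prod.ext this.1 this.2
  · intro t' ht'
    by_cases hw : storedWeight enc l ω t' = 0
    · simp [hw]
    obtain ⟨x', xs', y', y₁', ys', hd', rfl⟩ := exists_of_storedWeight_ne_zero henc hw
    refine if_neg fun e => ht' ?_
    rw [storedMap_enc henc f hd, storedMap_enc henc f hd'] at e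
    have := henc (hmem hd') (hmem hd) e
    simp only [Prod.mk.injEq, List.cons.injEq] at this
    obtain ⟨rfl, h₁, rfl⟩ := this
    rw [add_left_inj] at h₁
    subst h₁
    exact ⟨(x', y'), rfl⟩
  · intro z
    rw [storedMap_enc henc f hd, storedMap_enc henc f (hpop _ _), storedWeight_enc henc ω (hpop _ _)]
    simp only [popMap, if_true, popWeight]

/-- The term on the store that pops the stack. -/
def popTerm (m : ℕ) (henc : Set.InjOn enc (IsStack l)) {ω : Str n → List (Str n) → ZMod 2 → ℂ}
    (hω : Normalized ω) (f : List (Str n) → ZMod 2) : PQPT (sig n m N) where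
  params := [store n m N]
  disj := List.pairwise_singleton _ _
  E := [strOp (storedMap enc l f) (storedWeight enc l ω)]
  F := []
  bound := by
    simpa [dual] using stored_bound henc hω f

theorem popTerm_on (henc : Set.InjOn enc (IsStack l)) {ω : Str n → List (Str n) → ZMod 2 → ℂ}
    (hω : Normalized ω) (f : List (Str n) → ZMod 2) :
    (popTerm m henc hω f).On (Set.range strVar) := by
  refine ⟨fun Y hY => ?_, fun K hK => ?_, fun K hK => ?_⟩
  · rw [List.mem_singleton.1 hY]
    exact subset_rfl
  · rw [List.mem_singleton.1 hK]
    exact strOp_localTo _ _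
  · exact absurd hK List.not_mem_nil

theorem popTerm_Params (henc : Set.InjOn enc (IsStack l))
    {ω : Str n → List (Str n) → ZMod 2 → ℂ} (hω : Normalized ω) (f : List (Str n) → ZMod 2) :
    (popTerm m henc hω f).Params = {store n m N} := by
  ext Y
  simp [PQPT.Params, popTerm]

theorem popTerm_den (henc : Set.InjOn enc (IsStack l)) {ω : Str n → List (Str n) → ZMod 2 → ℂ}
    (hω : Normalized ω) (f : List (Str n) → ZMod 2) (v : PVar (sig n m N) → Op (sig n m N)) :
    (popTerm m henc hω f).den v = (strOp (storedMap enc l f) (storedWeight enc l ω))ᴴ *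
      v (store n m N) * strOp (storedMap enc l f) (storedWeight enc l ω) := by
  simp [PQPT.den, popTerm, dual]

end pop

end RQFS


/-! ## Predicates independent of a tuple of references -/

section independent

variable {ι : Type} {Γ : ι → S.Ty}

/-- The tuple `q` belongs to the part of the state that `frame ρ θ w` leaves alone, and `ρ₀` reads
the rest of this part. -/
structure Untouched (q : Refs S Γ) (ρ ρ₀ θ : Conf S → Conf S) (w : Conf S → ℂ) : Prop where
  weight : ∀ c u, w (setAt q c u) = w c
  theta : ∀ c u, w c ≠ 0 → θ (setAt q c u) = θ c
  base : ∀ c u, ρ₀ (setAt q c u) = ρ₀ c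
  rho : ∀ c c', w c ≠ 0 → w c' ≠ 0 → (ρ c = ρ c' ↔ ρ₀ c = ρ₀ c' ∧ readAt q c = readAt q c')

variable [Finite ι] {q : Refs S Γ} {ρ ρ₀ θ : Conf S → Conf S} {w : Conf S → ℂ}

/-- The predicate is the identity on `q` times a part whose entries ignore `q`. -/
theorem Untouched.commute (hq : Distinct q) (h : Untouched q ρ ρ₀ θ w)
    (A : Matrix (Vals S Γ) (Vals S Γ) ℂ) (B : Op S) : Commute (lift q A) (frame ρ θ w B) := by
  have key : ∀ c c', frame ρ θ w B c c' = if readAt q c = readAt q c' then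
      frame ρ₀ θ w B c c' else 0 := by
    intro c c'
    simp only [frame, Matrix.of_apply]
    by_cases h₁ : w c = 0
    · simp [h₁]
    by_cases h₂ : w c' = 0
    · simp [h₂]
    have h₃ := h.rho c c' h₁ h₂
    by_cases h₄ : ρ₀ c = ρ₀ c' <;> by_cases h₅ : readAt q c = readAt q c' <;> simp [h₃, h₄, h₅]
  have inv : ∀ c c' u, frame ρ₀ θ w B (setAt q c u) c' = frame ρ₀ θ w B c c' := by
    intro c c' u
    simp only [frame, Matrix.of_apply, h.weight, h.base]
    by_cases h₁ : w c = 0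
    · simp [h₁]
    · rw [h.theta c u h₁]
  have inv' : ∀ c c' u, frame ρ₀ θ w B c (setAt q c' u) = frame ρ₀ θ w B c c' := by
    intro c c' u
    simp only [frame, Matrix.of_apply, h.weight, h.base]
    by_cases h₁ : w c' = 0
    · simp [h₁]
    · rw [h.theta c' u h₁]
  ext c c'
  rw [lift_mul_apply hq, mul_lift_apply hq]
  simp only [key, inv, inv', readAt_setAt hq, mul_ite, ite_mul, mul_zero, zero_mul,
    Finset.sum_ite_eq, Finset.sum_ite_eq', Finset.mem_univ, if_true]
  rw [mul_comm]

/-- Initialising a tuple removes it from the part of the state that is read. -/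
theorem Untouched.init (hq : Distinct q) (h : Untouched q ρ ρ₀ θ w) {u₀ : Vals S Γ}
    {w₀ : Conf S → ℂ} (hw : ∀ c, w₀ (setAt q c u₀) = w c) (B : Op S) :
    ∑ k : Vals S Γ, (lift q (Matrix.single u₀ k 1))ᴴ * frame ρ₀ θ w₀ B *
      lift q (Matrix.single u₀ k 1) = frame ρ θ w B := by
  ext c c'
  rw [sum_conj_lift_single hq]
  simp only [frame, Matrix.of_apply, hw, h.base]
  by_cases h₁ : w c = 0
  · simp [h₁]
  by_cases h₂ : w c' = 0
  · simp [h₂]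
  rw [h.theta c u₀ h₁, h.theta c' u₀ h₂]
  have h₃ := h.rho c c' h₁ h₂
  by_cases h₄ : ρ₀ c = ρ₀ c' <;> by_cases h₅ : readAt q c = readAt q c' <;> simp [h₃, h₄, h₅]

/-- Among the columns of `A` only the one with index `u₀` is kept. -/
theorem Untouched.loewner (hq : Distinct q) (h : Untouched q ρ ρ₀ θ w) {u₀ : Vals S Γ}
    (hρ : ∀ c, ρ₀ c = ρ (setAt q c u₀)) (A : Matrix (Vals S Γ) (Vals S Γ) ℂ)
    {w₀ : Conf S → ℂ} (hw : ∀ c, w₀ c = w c * A u₀ (readAt q c)) {B : Op S}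
    (hB : B.PosSemidef) :
    Loewner (frame ρ₀ θ w₀ B) ((lift q A)ᴴ * frame ρ θ w B * lift q A) := by
  have e : (lift q A)ᴴ * frame ρ θ w B * lift q A =
      ∑ r, (frameKraus ρ θ w r * lift q A)ᴴ * B * (frameKraus ρ θ w r * lift q A) := by
    rw [frame_eq_sum, Finset.mul_sum, Finset.sum_mul]
    exact Finset.sum_congr rfl fun r _ => by simp only [Matrix.conjTranspose_mul, mul_assoc]
  rw [e, frame_eq_sum]
  refine loewner_sum_conj_of_sub hB fun r => ?_
  by_cases hr : ∃ c, w c ≠ 0 ∧ ρ₀ c = r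
  · obtain ⟨d, hd, rfl⟩ := hr
    refine Or.inl ?_
    ext e c
    rw [mul_lift_apply hq]
    simp only [frameKraus, Matrix.of_apply, hw, h.weight]
    by_cases hc : w c = 0
    · simp [hc]
    -- By `hρ` a value of `ρ₀` is the value of `ρ` at a state with `u₀` written to `q`, so the Kraus
    -- index `ρ₀ d` selects the summand `u = u₀`.
    have h₁ : ∀ u, ρ (setAt q c u) = ρ₀ d ↔ ρ₀ c = ρ₀ d ∧ u = u₀ := fun u => by
      rw [show ρ (setAt q c u) = ρ₀ d ↔ ρ (setAt q c u) = ρ (setAt q d u₀) by rw [hρ d],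
        h.rho _ _ (by rwa [h.weight]) (by rwa [h.weight]), h.base, h.base,
        readAt_setAt hq, readAt_setAt hq]
    simp only [h.theta c _ hc, h₁]
    by_cases h₂ : e = θ c ∧ ρ₀ c = ρ₀ d
    · simp [h₂]
    · rw [if_neg h₂, Finset.sum_eq_zero]
      intro u _
      rw [if_neg fun h₃ => h₂ ⟨h₃.1, h₃.2.1⟩, zero_mul]
  · refine Or.inr ?_
    ext e c
    simp only [frameKraus, Matrix.of_apply, hw, Matrix.zero_apply]
    split_ifs with h₁
    · rw [not_not.1 fun h₂ => hr ⟨c, h₂, h₁.2⟩, zero_mul]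
    · rfl

end independent

namespace RQFS

variable {n m N : ℕ}

/-! ## Calls from inside the procedure -/

/-- The basis state with the counter `q` lowered by one. -/
def dec (c : Conf (sig n m N)) : Conf (sig n m N) :=
  setCnt c .q ((finRotate (2 ^ m)).symm (cnt c .q))

/-- The basis state with the counter `q` raised by one. -/
def inc (c : Conf (sig n m N)) : Conf (sig n m N) := setCnt c .q (finRotate (2 ^ m) (cnt c .q))

theorem dec_inc (c : Conf (sig n m N)) : dec (inc c) = c := by
  simp [dec, inc, setCnt_setCnt, setCnt_cnt]

theorem inc_dec (c : Conf (sig n m N)) : inc (dec c) = c := by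
  simp [dec, inc, setCnt_setCnt, setCnt_cnt]

theorem dec_injective : Function.Injective (dec (n := n) (m := m) (N := N)) :=
  Function.LeftInverse.injective inc_dec

/-- The level of the caller. -/
def low (c : Conf (sig n m N)) : ℕ := level (dec c)

theorem val_finRotate {M : ℕ} (k : Fin M) (h : k.val + 1 < M) : (finRotate M k).val = k.val + 1 := by
  cases M with
  | zero => exact k.elim0
  | succ M =>
    refine coe_finRotate_of_ne_last fun e => ?_
    rw [e, Fin.val_last] at h
    exact lt_irrefl _ h

/-- The bound excludes level `0`, where `dec` wraps around and `low c = 2 ^ m - 1`. -/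
theorem level_eq_of_low {c : Conf (sig n m N)} (h : low c + 1 < 2 ^ m) : level c = low c + 1 := by
  have := val_finRotate _ h
  simpa [low, level, dec] using this

theorem low_eq_of_level {c : Conf (sig n m N)} {k : ℕ} (h : level c = k + 1) : low c = k := by
  have hk : k + 1 < 2 ^ m := h ▸ (cnt c .q).isLt
  have : finRotate (2 ^ m) ⟨k, by omega⟩ = cnt c .q :=
    Fin.ext ((val_finRotate ⟨k, by omega⟩ hk).trans h.symm)
  simp [low, level, dec, ← this]

theorem path_dec (k : ℕ) (c : Conf (sig n m N)) : path k (dec c) = path k c :=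
  path_congr fun _ _ _ => arr_setCnt _ _ _ _

theorem below_dec (k : ℕ) (c : Conf (sig n m N)) : below k (dec c) = below k c :=
  below_congr fun _ _ => bit_setCnt _ _ _ _

theorem data_dec (c : Conf (sig n m N)) :
    data (dec c) = (path (low c) c, bit c .Y :: below (low c) c) := by
  rw [data, stack_eq_cons, path_dec, below_dec]
  simp [dec, low]

theorem exists_shift (hN : 0 < N) : ∃ π : Equiv.Perm (BitName N), π .Y = .Y' ∧
    ∀ j < N, π (stackBit N (j + 1)) = stackBit N j := by
  -- The chain `fresh (N - 1) ↦ … ↦ fresh 0 ↦ Y ↦ Y'` is closed to a cycle by sending `Y'` to the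
  -- last fresh name.
  let f : BitName N → BitName N := fun b => match b with
    | .Y => .Y'
    | .Y' => .fresh ⟨N - 1, by omega⟩
    | .Z => .Z
    | .fresh k => stackBit N k.val
  have hf : Function.Surjective f := by
    rintro (_ | _ | _ | ⟨k, hk⟩)
    · exact ⟨.fresh ⟨0, hN⟩, rfl⟩
    · exact ⟨.Y, rfl⟩
    · exact ⟨.Z, rfl⟩
    · rcases Nat.lt_or_ge (k + 1) N with h | h
      · exact ⟨.fresh ⟨k + 1, h⟩, by simp [f, stackBit, hk]⟩
      · refine ⟨.Y', ?_⟩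
        have : k = N - 1 := by omega
        simp [f, this]
  refine ⟨Equiv.ofBijective f ⟨Finite.injective_iff_surjective.2 hf, hf⟩, rfl, fun j hj => ?_⟩
  simp [stackBit, hj, f]

/-- The renaming of qubits for a recursive call: the target becomes `Y'`, and the caller's target
is pushed on the stack. -/
def shift (hN : 0 < N) : Equiv.Perm (BitName N) := (exists_shift hN).choose

theorem shift_Y (hN : 0 < N) : shift hN .Y = .Y' := (exists_shift hN).choose_spec.1

theorem shift_stackBit (hN : 0 < N) {j : ℕ} (hj : j < N) :
    shift hN (stackBit N (j + 1)) = stackBit N j := (exists_shift hN).choose_spec.2 j hj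

theorem stackBit_ne (j : ℕ) : stackBit N j ≠ .Y' := by
  cases j with
  | zero => simp [stackBit]
  | succ j => by_cases h : j < N <;> simp [stackBit, h]

/-- The basis state seen by a recursive call. -/
def callee (hN : 0 < N) (c : Conf (sig n m N)) : Conf (sig n m N) :=
  Conf.pre (mkRen (Equiv.refl _) (shift hN)) c

/-- The names of the pending targets slide by one, so the caller's `Y` is part of the callee's
stack. This lets the specification keep coherences with the caller's target across the call. -/
theorem data_callee {l : ℕ} (hN : 0 < N) (hlN : l ≤ N) (hlm : l < 2 ^ m) {c : Conf (sig n m N)}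
    (h : low c < l) : data (callee hN c) =
      (arr c (cnt c .q) :: path (low c) c, bit c .Y' :: bit c .Y :: below (low c) c) := by
  have hl : level c = low c + 1 := level_eq_of_low (by omega)
  have hl' : level (callee hN c) = low c + 1 := hl
  have hi : idx m (low c + 1) = cnt c .q := by rw [← hl, level, idx_val]
  rw [data, hl', path]
  refine Prod.ext ?_ ?_
  · change arr c (idx m (low c + 1)) :: _ = _
    rw [hi]
    exact congrArg _ (path_congr fun j _ _ => rfl)
  · refine (stack_eq_cons _ _).trans ?_
    change bit c (shift hN .Y) :: below (low c + 1) (callee hN c) =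
      bit c .Y' :: (bit c .Y :: below (low c) c)
    rw [shift_Y, ← stack_eq_cons]
    refine congrArg _ (List.map_inj_left.2 fun j hj => ?_)
    change bit c (shift hN _) = _
    rw [shift_stackBit]
    have := List.mem_range.1 hj
    omega

/-- After renaming, the callee's stack occupies the caller's stack and, in addition, the two local
variables. -/
theorem mem_frameVars_succ (hN : 0 < N) {k : ℕ} (hk : k < N) {v : AnyVar (sig n m N)} :
    v ∈ frameVars (k + 1) ↔
      AnyVar.ren (mkRen (Equiv.refl _) (shift hN)) v ∈ frameVars k ∨
      AnyVar.ren (mkRen (Equiv.refl _) (shift hN)) v = arrVar (idx m (k + 1)) ∨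
      AnyVar.ren (mkRen (Equiv.refl _) (shift hN)) v = bitVar .Y' := by
  have hinj := AnyVar.ren_injective (mkRen (n := n) (m := m) (Equiv.refl _) (shift hN))
  constructor
  · rintro (⟨j, h₁, h₂, rfl⟩ | ⟨j, h₂, rfl⟩)
    · rcases Nat.lt_or_ge k j with h | h
      · rw [show j = k + 1 by omega]
        exact Or.inr (Or.inl rfl)
      · exact Or.inl (Or.inl ⟨j, h₁, h, rfl⟩)
    · cases j with
      | zero =>
        refine Or.inr (Or.inr ?_)
        rw [ren_bitVar]
        exact congrArg _ (shift_Y hN)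
      | succ j =>
        refine Or.inl (Or.inr ⟨j, by omega, ?_⟩)
        rw [ren_bitVar, shift_stackBit hN (by omega)]
  · rintro ((⟨j, h₁, h₂, h⟩ | ⟨j, h₂, h⟩) | h | h)
    · exact Or.inl ⟨j, h₁, by omega, hinj h⟩
    · refine Or.inr ⟨j + 1, by omega, hinj ?_⟩
      rw [h, ren_bitVar, shift_stackBit hN (by omega)]
    · exact Or.inl ⟨k + 1, by omega, le_rfl, hinj h⟩
    · refine Or.inr ⟨0, by omega, hinj ?_⟩
      rw [h, ren_bitVar]
      exact congrArg _ (shift_Y hN).symm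

/-- The basis state with the local variables `X[q]` and `Y'` set to zero. -/
def clear (c : Conf (sig n m N)) : Conf (sig n m N) := setBit (setArr c (cnt c .q) 0) .Y' 0

theorem rest_dec_eq_iff {c c' : Conf (sig n m N)} : rest (dec c) = rest (dec c') ↔
    cnt c .q = cnt c' .q ∧ ∀ v, v ∉ frameVars (low c) → c v = c' v := by
  rw [rest_eq_iff]
  have h₁ : ∀ c : Conf (sig n m N), cnt (dec c) .q = (finRotate (2 ^ m)).symm (cnt c .q) :=
    fun c => cnt_setCnt _ _ _
  rw [h₁, h₁, Equiv.apply_eq_iff_eq]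
  refine and_congr_right fun hq => forall₂_congr fun v _ => ?_
  by_cases hv : v = cntVar .q
  · subst hv
    have : dec c (cntVar .q) = dec c' (cntVar .q) := by
      change cnt (dec c) .q = cnt (dec c') .q
      rw [h₁, h₁, hq]
    exact iff_of_true this hq
  · rw [dec, dec, setCnt_apply_of_ne hv, setCnt_apply_of_ne hv]

theorem clear_apply {c : Conf (sig n m N)} {v : AnyVar (sig n m N)} (h₁ : v ≠ arrVar (cnt c .q))
    (h₂ : v ≠ bitVar .Y') : clear c v = c v := by
  rw [clear, setBit_apply_of_ne h₂, setArr_apply_of_ne h₁]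

theorem cnt_clear (c : Conf (sig n m N)) (a : CntName N) : cnt (clear c) a = cnt c a := by
  simp [clear]

theorem low_congr {c c' : Conf (sig n m N)} (h : cnt c .q = cnt c' .q) : low c = low c' := by
  simp [low, level, dec, h]

theorem rest_dec_clear_eq_iff {c c' : Conf (sig n m N)} :
    rest (dec (clear c)) = rest (dec (clear c')) ↔ cnt c .q = cnt c' .q ∧
      ∀ v, v ∉ frameVars (low c) → v ≠ arrVar (cnt c .q) → v ≠ bitVar .Y' → c v = c' v := by
  rw [rest_dec_eq_iff, cnt_clear, cnt_clear, low_congr (cnt_clear c .q)]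
  refine and_congr_right fun hq => forall₂_congr fun v _ => ?_
  by_cases h₁ : v = arrVar (cnt c .q)
  · subst h₁
    refine iff_of_true ?_ fun h => absurd rfl h
    have : ∀ c : Conf (sig n m N), arr (clear c) (cnt c .q) = 0 := fun c => by simp [clear]
    have h' := this c'
    rw [← hq] at h'
    exact (this c).trans h'.symm
  by_cases h₂ : v = bitVar .Y'
  · subst h₂
    exact iff_of_true ((bit_setBit _ _ _).trans (bit_setBit _ _ _).symm) fun _ h => absurd rfl h
  rw [clear_apply h₁ h₂, clear_apply (hq ▸ h₁) h₂]
  exact ⟨fun h _ _ => h, fun h => h h₁ h₂⟩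

/-- Both sides compare the same variables under different names: those outside the caller's stack,
without `X[q]` and `Y'`. -/
theorem rest_callee_eq_iff {l : ℕ} (hN : 0 < N) (hlN : l ≤ N) (hlm : l < 2 ^ m)
    {c c' : Conf (sig n m N)} (h : low c < l) :
    rest (callee hN c) = rest (callee hN c') ↔ rest (dec (clear c)) = rest (dec (clear c')) := by
  have hl : level c = low c + 1 := level_eq_of_low (by omega)
  have hl' : level (callee hN c) = low c + 1 := hl
  have hi : idx m (low c + 1) = cnt c .q := by rw [← hl, level, idx_val]
  rw [rest_eq_iff, rest_dec_clear_eq_iff, hl']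
  refine and_congr_right fun _ => ?_
  constructor
  · intro h v h₁ h₂ h₃
    obtain ⟨v, rfl⟩ := AnyVar.ren_surjective (mkRen (Equiv.refl _) (shift hN)) v
    refine h v ?_
    rw [mem_frameVars_succ hN (by omega), hi]
    tauto
  · intro h v h₁
    rw [mem_frameVars_succ hN (by omega), hi] at h₁
    push Not at h₁
    exact h _ h₁.1 h₁.2.1 h₁.2.2


/-! ## Predicates inside the procedure -/

/-- The part of the store that describes the callers, with `f` added to the caller's target. -/
def innerStore (enc : List (Str n) × List (ZMod 2) → Fin N → Str n) (f : List (Str n) → ZMod 2)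
    (c : Conf (sig n m N)) : Conf (sig n m N) :=
  emb (enc (path (low c) c, (bit c .Y + f (path (low c) c)) :: below (low c) c))

/-- The amplitude `ω` of the local variables `X[q]` and `Y'`. -/
def innerWeight (l : ℕ) (ω : Str n → List (Str n) → ZMod 2 → ℂ) (c : Conf (sig n m N)) : ℂ :=
  if low c < l then ω (arr c (cnt c .q)) (path (low c) c) (bit c .Y') else 0

variable {l : ℕ} {enc : List (Str n) × List (ZMod 2) → Fin N → Str n}

theorem lt_of_innerWeight_ne_zero {ω : Str n → List (Str n) → ZMod 2 → ℂ} {c : Conf (sig n m N)}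
    (h : innerWeight l ω c ≠ 0) : low c < l := by
  by_contra h'
  exact h (if_neg h')

/-- The specification of the callee, instantiated with a term that pops the stack. -/
theorem frame_callee (henc : Set.InjOn enc (IsStack l)) (hN : 0 < N) (hlN : l ≤ N)
    (hlm : l < 2 ^ m) {ω ω' : Str n → List (Str n) → ZMod 2 → ℂ} {f h : List (Str n) → ZMod 2}
    (hω : ∀ x xs y, xs.length < l → ω' x xs y = ω x xs (y + h (x :: xs))) (B : Op (sig n m N)) :
    frame (rest ∘ callee hN) (fun c => emb (enc (flip h (data (callee hN c)))))
      ((fun c => if level c < l + 1 then 1 else 0) ∘ callee hN)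
      ((strOp (storedMap enc l f) (storedWeight enc l ω))ᴴ * B *
        strOp (storedMap enc l f) (storedWeight enc l ω)) =
      frame (rest ∘ dec ∘ clear) (innerStore enc f) (innerWeight l ω') B := by
  rw [frame_strOp]
  have hlow : ∀ c : Conf (sig n m N), low c < l → level c = low c + 1 := fun c h =>
    level_eq_of_low (by omega)
  have hdata : ∀ c : Conf (sig n m N), low c < l → flip h (data (callee hN c)) =
      (arr c (cnt c .q) :: path (low c) c,
        (bit c .Y' + h (arr c (cnt c .q) :: path (low c) c)) :: bit c .Y :: below (low c) c) :=
    fun c hc => by rw [data_callee hN hlN hlm hc]; rfl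
  have hmem : ∀ c : Conf (sig n m N), level c < l + 1 → flip h (data (callee hN c)) ∈ IsStack l :=
    fun c hc => flip_mem (data_mem (Nat.lt_succ_iff.1 hc))
  have hw : ∀ c : Conf (sig n m N), (if level (callee hN c) < l + 1 then (1 : ℂ) else 0) *
      storedWeight enc l ω (enc (flip h (data (callee hN c)))) = innerWeight l ω' c := by
    intro c
    change (if level c < l + 1 then (1 : ℂ) else 0) * _ = _
    by_cases hc : low c < l
    · have := hlow c hc
      rw [if_pos (by omega), one_mul, storedWeight_enc henc ω (hmem c (by omega)), hdata c hc,
        innerWeight, if_pos hc, hω _ _ _ (by rwa [path_length])]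
      rfl
    · rw [innerWeight, if_neg hc]
      by_cases h₁ : level c < l + 1
      -- Level `0` is the only admissible level of a callee without an admissible caller. There the
      -- stack has no string, so `popWeight` vanishes, in agreement with `innerWeight`.
      · have h₀ : level c = 0 := by
          cases h₂ : level c with
          | zero => rfl
          | succ k =>
            have := low_eq_of_level h₂
            omega
        rw [storedWeight_enc henc ω (hmem c h₁)]
        have : (flip h (data (callee hN c))).1 = [] := by
          rw [data, stack_eq_cons]
          change path (level c) (callee hN c) = []
          rw [h₀]
          rfl
        generalize flip h (data (callee hN c)) = d at this
        obtain ⟨_, t⟩ := d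
        subst this
        simp [popWeight]
      · rw [if_neg h₁, zero_mul]
  refine frame_congr hw (fun c hc => ?_) fun c c' hc _ => ?_
  · have hc' := lt_of_innerWeight_ne_zero (hw c ▸ hc)
    rw [storedMap_enc henc f (hmem c (by have := hlow c hc'; omega)), hdata c hc']
    rfl
  · exact rest_callee_eq_iff hN hlN hlm (lt_of_innerWeight_ne_zero (hw c ▸ hc))

theorem inner_bound (henc : Set.InjOn enc (IsStack l)) (hN : 0 < N) (hlN : l ≤ N)
    (hlm : l < 2 ^ m) {ω : Str n → List (Str n) → ZMod 2 → ℂ} (hω : Normalized ω)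
    (f : List (Str n) → ZMod 2) :
    Loewner (frame (rest ∘ dec ∘ clear) (innerStore enc f)
      (innerWeight l ω : Conf (sig n m N) → ℂ) 1) 1 := by
  -- With `h = 0` the inner predicate is the renamed specification applied to a store predicate
  -- below `I`; both operations respect the bound.
  rw [← frame_callee henc hN hlN hlm (ω := ω) (h := fun _ => 0) (f := f)
    fun x xs y _ => by rw [add_zero]]
  have h₁ := stored_bound (m := m) henc hω f
  rw [← mul_one (strOp (storedMap enc l f) (storedWeight enc l ω))ᴴ] at h₁
  refine (frame_mono _ _ _ h₁).trans ?_
  exact frame_bound_comp (spec_bound henc le_rfl fun _ => 0) (Conf.pre_injective _)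

/-- The predicate that `X[q]` and `Y'` have the amplitude `ω`, and the callers' part of the stack,
after adding `f` to the caller's target, satisfies `store`. -/
def innerTerm (henc : Set.InjOn enc (IsStack l)) (hN : 0 < N) (hlN : l ≤ N)
    (hlm : l < 2 ^ m) {ω : Str n → List (Str n) → ZMod 2 → ℂ} (hω : Normalized ω)
    (f : List (Str n) → ZMod 2) : PQPT (sig n m N) :=
  frameTerm (store n m N) (rest ∘ dec ∘ clear) (innerStore enc f) (innerWeight l ω)
    (inner_bound henc hN hlN hlm hω f)

/-- The hypothesis adds `h` to the callee's target. Read through `popTerm`, this shifts the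
amplitude in its last argument and leaves the callers' part, with its `f`, unchanged. -/
theorem inner_call (henc : Set.InjOn enc (IsStack l)) (hN : 0 < N) (hlN : l ≤ N)
    (hlm : l < 2 ^ m) {ω ω' : Str n → List (Str n) → ZMod 2 → ℂ} (hω : Normalized ω)
    (hω' : Normalized ω') {f h : List (Str n) → ZMod 2} {g : Str n → ZMod 2}
    {s : List (Str n) → Str n} {T : Set (PQPT (sig n m N) × PQPT (sig n m N))}
    {A : Set (Triple (sig n m N))}
    (hA : (⟨specTerm m henc le_rfl h, .call () (args n m N .q .Y),
      specTerm m henc le_rfl fun _ => 0⟩ : Triple (sig n m N)) ∈ A)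
    (hωω' : ∀ x xs y, xs.length < l → ω' x xs y = ω x xs (y + h (x :: xs))) :
    QBE (decl n m N l hlm g s) T A (innerTerm henc hN hlN hlm hω' f) (innerCall n m N)
      (innerTerm henc hN hlN hlm hω f) := by
  have key := call_rule (hlm := hlm) (g := g) (s := s) (T := T) hA (Equiv.refl _) (shift hN)
    (R := popTerm m henc hω f) (P' := innerTerm henc hN hlN hlm hω' f)
    (Q' := innerTerm henc hN hlN hlm hω f) (popTerm_on henc hω f)
    ((frameTerm_Params _ _).trans (popTerm_Params henc hω f).symm)
    ((frameTerm_Params _ _).trans (popTerm_Params henc hω f).symm)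
    (fun v _ => by
      rw [innerTerm, frameTerm_den, popTerm_den]
      exact (frame_callee henc hN hlN hlm hωω' _).symm)
    (fun v _ => by
      rw [innerTerm, frameTerm_den, popTerm_den]
      exact (frame_callee henc hN hlN hlm (fun x xs y _ => by rw [add_zero]) _).symm)
  rw [shift_Y] at key
  exact key

/-! ### Independence of the callers' stack from the local variables. -/

theorem arrVar_notMem_frameVars {k : ℕ} {i : Fin (2 ^ m)} (h : k < i.val) :
    (arrVar i : AnyVar (sig n m N)) ∉ frameVars k := by
  rintro (⟨j, h₁, h₂, e⟩ | ⟨j, _, e⟩)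
  · have := congrArg Fin.val (arrVar_injective e)
    rw [idx_eq_mk (show j < 2 ^ m by have := i.isLt; omega)] at this
    simp only at this
    omega
  · exact bitVar_ne_arrVar _ _ e.symm

theorem Y'_notMem_frameVars (k : ℕ) : (bitVar .Y' : AnyVar (sig n m N)) ∉ frameVars k := by
  rintro (⟨j, _, _, e⟩ | ⟨j, _, e⟩)
  · exact bitVar_ne_arrVar _ _ e
  · exact stackBit_ne j (bitVar_injective e).symm

theorem path_setBit (k : ℕ) (c : Conf (sig n m N)) (b : BitName N) (y : ZMod 2) :
    path k (setBit c b y) = path k c :=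
  path_congr fun _ _ _ => arr_setBit _ _ _ _

theorem path_setArr (c : Conf (sig n m N)) {k : ℕ} {i : Fin (2 ^ m)} (h : k < i.val)
    (x : Str n) : path k (setArr c i x) = path k c :=
  path_congr fun j _ _ => arr_setArr_of_ne _ _ fun e => by
    have := congrArg Fin.val e
    rw [idx_eq_mk (show j < 2 ^ m by have := i.isLt; omega)] at this
    simp only at this
    omega

theorem below_setArr (k : ℕ) (c : Conf (sig n m N)) (i : Fin (2 ^ m)) (x : Str n) :
    below k (setArr c i x) = below k c :=
  below_congr fun _ _ => bit_setArr _ _ _ _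

theorem below_setBit_Y' (k : ℕ) (c : Conf (sig n m N)) (y : ZMod 2) :
    below k (setBit c .Y' y) = below k c :=
  below_congr fun _ _ => bit_setBit_of_ne _ _ (stackBit_ne _)

theorem below_setBit_Y (hk : l ≤ N) {k : ℕ} (h : k < l) (c : Conf (sig n m N)) (y : ZMod 2) :
    below k (setBit c .Y y) = below k c :=
  below_congr fun j hj => bit_setBit_of_ne _ _ (by simp [stackBit, show j < N by omega])

/-- The basis state with the local variables set. -/
def setLocal (c : Conf (sig n m N)) (x : Str n) (y : ZMod 2) : Conf (sig n m N) :=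
  setBit (setArr c (cnt c .q) x) .Y' y

theorem low_setLocal (c : Conf (sig n m N)) (x : Str n) (y : ZMod 2) :
    low (setLocal c x y) = low c := low_congr (by simp [setLocal])

theorem clear_setLocal (c : Conf (sig n m N)) (x : Str n) (y : ZMod 2) :
    clear (setLocal c x y) = clear c := by
  have h : cnt (setLocal c x y) .q = cnt c .q := by simp [setLocal]
  funext v
  by_cases h₁ : v = arrVar (cnt c .q)
  · subst h₁
    change arr (clear _) _ = arr (clear _) _
    simp [clear, h]
  by_cases h₂ : v = bitVar .Y'
  · subst h₂
    change bit (clear _) _ = bit (clear _) _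
    simp [clear]
  rw [clear_apply (h ▸ h₁) h₂, clear_apply h₁ h₂, setLocal, setBit_apply_of_ne h₂,
    setArr_apply_of_ne h₁]

theorem lt_cnt_of_low (hlm : l < 2 ^ m) {c : Conf (sig n m N)} (h : low c < l) :
    low c < (cnt c .q).val := by
  have : level c = low c + 1 := level_eq_of_low (by omega)
  rw [level] at this
  omega

theorem path_setLocal (hlm : l < 2 ^ m) {c : Conf (sig n m N)} (h : low c < l) (x : Str n)
    (y : ZMod 2) : path (low c) (setLocal c x y) = path (low c) c := by
  rw [setLocal, path_setBit, path_setArr _ (lt_cnt_of_low hlm h)]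

theorem innerStore_setLocal (hlm : l < 2 ^ m) {c : Conf (sig n m N)} (h : low c < l) (x : Str n)
    (y : ZMod 2) (f : List (Str n) → ZMod 2) :
    innerStore enc f (setLocal c x y) = innerStore enc f c := by
  have hY : bit (setLocal c x y) .Y = bit c .Y := by
    rw [setLocal, bit_setBit_of_ne _ _ (by simp), bit_setArr]
  simp only [innerStore, low_setLocal, path_setLocal hlm h, hY]
  rw [setLocal, below_setBit_Y', below_setArr]

theorem innerWeight_setLocal (hlm : l < 2 ^ m) (ω : Str n → List (Str n) → ZMod 2 → ℂ)
    (c : Conf (sig n m N)) (x : Str n) (y : ZMod 2) :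
    innerWeight l ω (setLocal c x y) = if low c < l then ω x (path (low c) c) y else 0 := by
  unfold innerWeight
  rw [low_setLocal]
  by_cases h : low c < l
  · rw [if_pos h, if_pos h, path_setLocal hlm h]
    simp [setLocal]
  · rw [if_neg h, if_neg h]

/-- The local variables do not belong to the caller's part of the stack. -/
theorem untouched_local (hlm : l < 2 ^ m) (f : List (Str n) → ZMod 2) :
    Untouched (pairRef (Xq n m N) (Y' n m N)) (rest ∘ dec) (rest ∘ dec ∘ clear)
      (innerStore enc f) fun c => if low c < l then 1 else 0 where
  weight c u := by
    rw [setAt_Xq_Y']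
    exact congrArg (fun k => if k < l then (1 : ℂ) else 0) (low_setLocal c (u false) (u true))
  theta c u h := by
    rw [setAt_Xq_Y']
    exact innerStore_setLocal hlm (by by_contra h'; exact h (if_neg h')) _ _ _
  base c u := by
    rw [setAt_Xq_Y']
    exact congrArg (fun c => rest (dec c)) (clear_setLocal c (u false) (u true))
  rho c c' h _ := by
    have hc : low c < l := by by_contra h'; exact h (if_neg h')
    simp only [Function.comp_apply]
    rw [rest_dec_eq_iff, rest_dec_clear_eq_iff]
    constructor
    · rintro ⟨hq, h⟩
      refine ⟨⟨hq, fun v hv _ _ => h v hv⟩, funext fun b => ?_⟩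
      cases b
      · change arr c (cnt c .q) = arr c' (cnt c' .q)
        rw [← hq]
        exact h _ (arrVar_notMem_frameVars (lt_cnt_of_low hlm hc))
      · exact h _ (Y'_notMem_frameVars _)
    · rintro ⟨⟨hq, h⟩, hr⟩
      refine ⟨hq, fun v hv => ?_⟩
      by_cases h₁ : v = arrVar (cnt c .q)
      · subst h₁
        have := congrFun hr false
        change arr c (cnt c .q) = arr c' (cnt c' .q) at this
        rw [← hq] at this
        exact this
      by_cases h₂ : v = bitVar .Y'
      · subst h₂
        exact congrFun hr true
      exact h v hv h₁ h₂

end RQFS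


/-! ## Unitary gates -/

theorem submatrix_unitary {α β : Type*} [Fintype α] [DecidableEq α] [Fintype β] [DecidableEq β]
    (e : α ≃ β) {U : Matrix β β ℂ} (h : U * Uᴴ = 1) :
    U.submatrix e e * (U.submatrix e e)ᴴ = 1 ∧ (U.submatrix e e)ᴴ * U.submatrix e e = 1 := by
  have h' : U.submatrix e e * (U.submatrix e e)ᴴ = 1 := by
    rw [Matrix.conjTranspose_submatrix, Matrix.submatrix_mul_equiv, h, Matrix.submatrix_one_equiv]
  exact ⟨h', mul_eq_one_comm.1 h'⟩

/-- Tuples of length one. -/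
def valsOne {S : Sig} (τ : S.Ty) : Vals S (oneTy τ) ≃ S.Val τ :=
  ⟨fun u => u (), fun x _ => x, fun _ => rfl, fun _ => rfl⟩

/-- Tuples of length two. -/
def valsPair {S : Sig} (τ₁ τ₂ : S.Ty) : Vals S (pairTy τ₁ τ₂) ≃ S.Val τ₁ × S.Val τ₂ where
  toFun u := (u false, u true)
  invFun x := fun b => match b with
    | false => x.1
    | true => x.2
  left_inv u := by
    funext b
    cases b <;> rfl
  right_inv _ := rfl

theorem gate₁_unitary {S : Sig} {τ : S.Ty} [Fintype (S.Val τ)] [DecidableEq (S.Val τ)]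
    {U : Matrix (S.Val τ) (S.Val τ) ℂ} (h : U * Uᴴ = 1) :
    gate₁ U * (gate₁ U)ᴴ = 1 ∧ (gate₁ U)ᴴ * gate₁ U = 1 :=
  submatrix_unitary (valsOne τ) h

theorem gate₂_unitary {S : Sig} {τ₁ τ₂ : S.Ty} [Fintype (S.Val τ₁)] [DecidableEq (S.Val τ₁)]
    [Fintype (S.Val τ₂)] [DecidableEq (S.Val τ₂)]
    {U : Matrix (S.Val τ₁ × S.Val τ₂) (S.Val τ₁ × S.Val τ₂) ℂ} (h : U * Uᴴ = 1) :
    gate₂ U * (gate₂ U)ᴴ = 1 ∧ (gate₂ U)ᴴ * gate₂ U = 1 :=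
  submatrix_unitary (valsPair τ₁ τ₂) h

theorem basisMap_unitary {α : Type} [Fintype α] [DecidableEq α] {f : α → α}
    (h : Function.Injective f) : basisMap f * (basisMap f)ᴴ = 1 ∧ (basisMap f)ᴴ * basisMap f = 1 := by
  have h' : (basisMap f)ᴴ * basisMap f = 1 := by
    ext a b
    simp [Matrix.mul_apply, basisMap, Matrix.one_apply, h.eq_iff, eq_comm]
  exact ⟨mul_eq_one_comm.1 h', h'⟩

theorem kronecker_unitary {α β : Type*} [Fintype α] [DecidableEq α] [Fintype β] [DecidableEq β]
    {U : Matrix α α ℂ} {V : Matrix β β ℂ} (hU : U * Uᴴ = 1) (hV : V * Vᴴ = 1) :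
    Matrix.kroneckerMap (· * ·) U V * (Matrix.kroneckerMap (· * ·) U V)ᴴ = 1 := by
  rw [Matrix.conjTranspose_kronecker, ← Matrix.mul_kronecker_mul, hU, hV, Matrix.one_kronecker_one]

theorem mul_unitary {α : Type*} [Fintype α] [DecidableEq α] {U V : Matrix α α ℂ}
    (hU : U * Uᴴ = 1) (hV : V * Vᴴ = 1) : U * V * (U * V)ᴴ = 1 := by
  rw [Matrix.conjTranspose_mul, mul_assoc, ← mul_assoc V, hV, one_mul, hU]

theorem gate₂_basisMap {S : Sig} {τ₁ τ₂ : S.Ty} [DecidableEq (S.Val τ₁)] [DecidableEq (S.Val τ₂)]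
    (f : S.Val τ₁ × S.Val τ₂ → S.Val τ₁ × S.Val τ₂) :
    gate₂ (basisMap f) = basisMap fun u : Vals S (pairTy τ₁ τ₂) =>
      (valsPair τ₁ τ₂).symm (f (valsPair τ₁ τ₂ u)) := by
  have key : ∀ (a b : S.Val τ₁ × S.Val τ₂) (p : Prop) [Decidable p], (a = f b ↔ p) →
      basisMap f a b = if p then 1 else 0 := fun a b p _ h => if_congr h rfl rfl
  ext u w
  exact key (valsPair τ₁ τ₂ u) (valsPair τ₁ τ₂ w)
    (u = (valsPair τ₁ τ₂).symm (f (valsPair τ₁ τ₂ w))) (Equiv.eq_symm_apply _).symm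

/-! ## Local variables that need no renaming -/

section

theorem AnyVar.ren_refl (v : AnyVar S) : AnyVar.ren (fun τ => Equiv.refl (S.Name τ)) v = v := by
  obtain ⟨τ, v | v⟩ := v <;> rfl

theorem Ref.ren_refl {τ : S.Ty} (r : Ref S τ) : r.ren (fun τ => Equiv.refl (S.Name τ)) = r := by
  rcases r with (v | v) | ⟨a, v | v⟩ <;> rfl

theorem Stmt.ren_refl (C : Stmt S) : C.ren (fun τ => Equiv.refl (S.Name τ)) = C := by
  induction C with
  | bot => rfl
  | skip => rfl
  | init q => simp only [Stmt.ren, Ref.ren_refl]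
  | unit q U => simp only [Stmt.ren, Ref.ren_refl]
  | seq _ _ h₁ h₂ => simp only [Stmt.ren, h₁, h₂]
  | case q M b h => simp only [Stmt.ren, Ref.ren_refl, h]
  | loc q C h => simp only [Stmt.ren, Ref.ren_refl, h]
  | call f a => rfl

theorem QBE.loc_self {D : Decl S} {T : Set (PQPT S × PQPT S)} {A : Set (Triple S)} {ι : Type}
    [Finite ι] {Γ : ι → S.Ty} {q : Refs S Γ} {C : Stmt S} {P Q : PQPT S} (hr : Distinct q)
    (hP : Fresh q P) (hQ : Fresh q Q) (h : QBE D T A P (.seq (.init q) C) Q) :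
    QBE D T A P (.loc q C) Q := by
  refine QBE.loc (σ := fun τ => Equiv.refl (S.Name τ)) (fun v _ => AnyVar.ren_refl v)
    (fun v _ => AnyVar.ren_refl v) ?_ ?_ ?_ ?_ <;> simpa only [Ref.ren_refl, Stmt.ren_refl]

theorem QBE.of_order {D : Decl S} {A : Set (Triple S)} {P P' Q Q' : PQPT S} {C : Stmt S}
    (hp : P.Params = P'.Params) (hP : ∀ v, IsAssignment v → Loewner (P.den v) (P'.den v))
    (h : QBE D (trueOrder S) A P' C Q')
    (hq : Q'.Params = Q.Params) (hQ : ∀ v, IsAssignment v → Loewner (Q'.den v) (Q.den v)) :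
    QBE D (trueOrder S) A P C Q :=
  QBE.order ⟨hp, hP⟩ h ⟨hq, hQ⟩

theorem IsAssignment.posSemidef {v : PVar S → Op S} (h : IsAssignment v) (X : PVar S) :
    (v X).PosSemidef := loewner_zero_iff.1 (h X).2.1

end

namespace RQFS

variable {n m N l : ℕ} {enc : List (Str n) × List (ZMod 2) → Fin N → Str n}
  {D : Decl (sig n m N)} {T : Set (PQPT (sig n m N) × PQPT (sig n m N))}
  {A : Set (Triple (sig n m N))}
  {ω ω' : Str n → List (Str n) → ZMod 2 → ℂ}

theorem hadamardN_unitary : hadamardN n * (hadamardN n)ᴴ = 1 := by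
  rw [hadamardN_conjTranspose, hadamardN_mul_self]

theorem setLocal_bit (c : Conf (sig n m N)) (x : Str n) :
    setLocal c x (bit c .Y') = setArr c (cnt c .q) x := by
  have h : bit (setArr c (cnt c .q) x) .Y' = bit c .Y' := bit_setArr _ _ _ _
  rw [setLocal, ← h]
  exact Conf.set_apply_self _ _

/-! ## Steps of the procedure body -/

/-- Amplitudes are Kraus weights, hence bras: the backward rule multiplies them by the gate on the
right, and the rest of the predicate does not see `X[q]`. -/
theorem inner_hadamard (henc : Set.InjOn enc (IsStack l)) (hN : 0 < N) (hlN : l ≤ N)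
    (hlm : l < 2 ^ m) (hω : Normalized ω) (hω' : Normalized ω') (f : List (Str n) → ZMod 2)
    (h : ∀ x xs y, ω' x xs y = ∑ z, ω z xs y * hadamardN n z x) :
    QBE D T A (innerTerm henc hN hlN hlm hω' f)
      (.unit (oneRef (Xq n m N)) (gate₁ (S := sig n m N) (τ := Ty.str) (hadamardN n)))
      (innerTerm henc hN hlN hlm hω f) := by
  have hU : hadamardN n * (hadamardN n)ᴴ = 1 := hadamardN_unitary
  refine QBE.unit Xq_distinct (@gate₁_unitary (sig n m N) Ty.str
    (inferInstanceAs (Fintype (Str n))) (inferInstanceAs (DecidableEq (Str n))) _ hU)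
    ((frameTerm_Params _ _).trans (frameTerm_Params _ _).symm) fun v _ => ?_
  rw [innerTerm, innerTerm, frameTerm_den, frameTerm_den]
  refine (conj_frame_of_kraus (frameKraus_mul_lift Xq_distinct _ (fun c u hw => ?_)
    fun c => ?_)).symm
  · have e : setAt (oneRef (Xq n m N)) c u = setLocal c (u ()) (bit c .Y') :=
      (setAt_Xq c u).trans (setLocal_bit c (u ())).symm
    rw [e] at hw ⊢
    have hl := lt_of_innerWeight_ne_zero hw
    have hl' : low (setLocal c (u ()) (bit c .Y')) = low c := low_setLocal c (u ()) _
    refine ⟨congrArg (fun c => rest (dec c)) (clear_setLocal c (u ()) _), ?_⟩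
    exact innerStore_setLocal hlm (hl' ▸ hl) (u ()) _ f
  · have e : ∀ u, innerWeight l ω (setAt (oneRef (Xq n m N)) c u) =
        if low c < l then ω (u ()) (path (low c) c) (bit c .Y') else 0 := fun u => by
      rw [setAt_Xq]
      refine Eq.trans (congrArg _ (setLocal_bit c (u ())).symm) ?_
      exact innerWeight_setLocal hlm ω c (u ()) _
    simp only [e]
    refine Eq.trans ?_ (sum_vals_one fun x => (if low c < l then
      ω x (path (low c) c) (bit c .Y') else 0) * hadamardN n x (arr c (cnt c .q))).symm
    unfold innerWeight
    split_ifs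
    · rw [h]
    · simp

theorem weight_pair (hlm : l < 2 ^ m) (ω : Str n → List (Str n) → ZMod 2 → ℂ)
    (U : Matrix (Str n × ZMod 2) (Str n × ZMod 2) ℂ) (c : Conf (sig n m N)) :
    ∑ u, innerWeight l ω (setAt (pairRef (Xq n m N) (Y' n m N)) c u) *
      gate₂ (S := sig n m N) (τ₁ := Ty.str) (τ₂ := Ty.bit) U u
        (readAt (pairRef (Xq n m N) (Y' n m N)) c) =
      innerWeight l (fun x xs y => ∑ z, ∑ b, ω z xs b * U (z, b) (x, y)) c := by
  have e : ∀ u, innerWeight l ω (setAt (pairRef (Xq n m N) (Y' n m N)) c u) =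
      if low c < l then ω (u false) (path (low c) c) (u true) else 0 := fun u => by
    rw [setAt_Xq_Y']
    exact innerWeight_setLocal hlm ω c (u false) (u true)
  simp only [e]
  refine Eq.trans (sum_vals_pair fun x y => (if low c < l then
    ω x (path (low c) c) y else 0) * U (x, y) (arr c (cnt c .q), bit c .Y')) ?_
  unfold innerWeight
  split_ifs
  · rfl
  · simp

theorem inner_pair (henc : Set.InjOn enc (IsStack l)) (hN : 0 < N) (hlN : l ≤ N)
    (hlm : l < 2 ^ m) (hω : Normalized ω) (hω' : Normalized ω') (f : List (Str n) → ZMod 2)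
    {U : Matrix (Str n × ZMod 2) (Str n × ZMod 2) ℂ} (hU : U * Uᴴ = 1)
    (h : ∀ x xs y, ω' x xs y = ∑ z, ∑ b, ω z xs b * U (z, b) (x, y)) :
    QBE D T A (innerTerm henc hN hlN hlm hω' f)
      (.unit (pairRef (Xq n m N) (Y' n m N)) (gate₂ (S := sig n m N) (τ₁ := Ty.str)
        (τ₂ := Ty.bit) U))
      (innerTerm henc hN hlN hlm hω f) := by
  obtain rfl : ω' = fun x xs y => ∑ z, ∑ b, ω z xs b * U (z, b) (x, y) :=
    funext fun x => funext fun xs => funext fun y => h x xs y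
  refine QBE.unit Xq_Y'_distinct (@gate₂_unitary (sig n m N) Ty.str Ty.bit
    (inferInstanceAs (Fintype (Str n))) (inferInstanceAs (DecidableEq (Str n)))
    (inferInstanceAs (Fintype (ZMod 2))) (inferInstanceAs (DecidableEq (ZMod 2))) _ hU)
    ((frameTerm_Params _ _).trans (frameTerm_Params _ _).symm) fun v _ => ?_
  rw [innerTerm, innerTerm, frameTerm_den, frameTerm_den]
  refine (conj_frame_of_kraus (frameKraus_mul_lift Xq_Y'_distinct _ (fun c u hw => ?_)
    fun c => (weight_pair hlm ω U c).symm)).symm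
  have e : setAt (pairRef (Xq n m N) (Y' n m N)) c u = setLocal c (u false) (u true) :=
    setAt_Xq_Y' c u
  rw [e] at hw ⊢
  have hl := lt_of_innerWeight_ne_zero hw
  have hl' : low (setLocal c (u false) (u true)) = low c := low_setLocal c (u false) (u true)
  exact ⟨congrArg (fun c => rest (dec c)) (clear_setLocal c (u false) (u true)),
    innerStore_setLocal hlm (hl' ▸ hl) (u false) (u true) f⟩

theorem Y_mem_frameVars (k : ℕ) : (bitVar .Y : AnyVar (sig n m N)) ∈ frameVars k :=
  Or.inr ⟨0, Nat.zero_le _, rfl⟩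

/-- Only strings of nonzero amplitude matter. By hypothesis the bit added to `Y` is, on these,
determined by the history, so `f` can absorb it. -/
theorem inner_oracle (henc : Set.InjOn enc (IsStack l)) (hN : 0 < N) (hlN : l ≤ N)
    (hlm : l < 2 ^ m) (hω : Normalized ω) {f f' : List (Str n) → ZMod 2} {g : Str n → ZMod 2}
    (h : ∀ x xs y, ω x xs y ≠ 0 → f' xs = g x + f xs) :
    QBE D T A (innerTerm henc hN hlN hlm hω f')
      (.unit (pairRef (Xq n m N) (Y n m N)) (gate₂ (S := sig n m N) (τ₁ := Ty.str)
        (τ₂ := Ty.bit) (oracleG n g)))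
      (innerTerm henc hN hlN hlm hω f) := by
  have hU : oracleG n g * (oracleG n g)ᴴ = 1 := by
    refine (basisMap_unitary ?_).1
    rintro ⟨x, y⟩ ⟨x', y'⟩ e
    simp only [Prod.mk.injEq] at e
    obtain ⟨rfl, e⟩ := e
    rw [add_right_cancel e]
  refine QBE.unit Xq_Y_distinct (@gate₂_unitary (sig n m N) Ty.str Ty.bit
    (inferInstanceAs (Fintype (Str n))) (inferInstanceAs (DecidableEq (Str n)))
    (inferInstanceAs (Fintype (ZMod 2))) (inferInstanceAs (DecidableEq (ZMod 2))) _ hU)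
    ((frameTerm_Params _ _).trans (frameTerm_Params _ _).symm) fun v _ => ?_
  rw [innerTerm, innerTerm, frameTerm_den, frameTerm_den, oracleG]
  have hG := @gate₂_basisMap (sig n m N) Ty.str Ty.bit (inferInstanceAs (DecidableEq (Str n)))
    (inferInstanceAs (DecidableEq (ZMod 2))) fun a : Str n × ZMod 2 => (a.1, a.2 + g a.1)
  refine Eq.trans ?_ (congrArg (fun G => (lift (pairRef (Xq n m N) (Y n m N)) G)ᴴ *
    frame (rest ∘ dec ∘ clear) (innerStore enc f) (innerWeight l ω) (v (store n m N)) *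
      lift (pairRef (Xq n m N) (Y n m N)) G) hG).symm
  rw [conj_lift_basisMap Xq_Y_distinct]
  have e : ∀ c : Conf (sig n m N), setAt (pairRef (Xq n m N) (Y n m N)) c
      ((valsPair (S := sig n m N) Ty.str Ty.bit).symm
        ((fun a : Str n × ZMod 2 => (a.1, a.2 + g a.1)) (valsPair (S := sig n m N) Ty.str Ty.bit
          (readAt (pairRef (Xq n m N) (Y n m N)) c)))) =
      setBit c .Y (bit c .Y + g (arr c (cnt c .q))) := by
    intro c
    rw [setAt_Xq_Y]
    exact congrArg (fun c' => setBit c' .Y (bit c .Y + g (arr c (cnt c .q))))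
      (Conf.set_apply_self c (arrVar (cnt c .q)))
  refine Eq.trans ?_ (congrArg (fun φ => (frame (rest ∘ dec ∘ clear) (innerStore enc f)
    (innerWeight l ω) (v (store n m N))).submatrix φ φ) (funext e)).symm
  rw [← frame_comp]
  have hlow : ∀ (c : Conf (sig n m N)) y, low (setBit c .Y y) = low c := fun c y =>
    low_congr (cnt_setBit _ _ _ _)
  refine frame_congr (fun c => ?_) (fun c hc => ?_) fun c c' hc _ => ?_
  · simp only [innerWeight, Function.comp_apply, hlow, path_setBit, arr_setBit, cnt_setBit]
    rw [bit_setBit_of_ne _ _ (by simp)]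
  · have hl := lt_of_innerWeight_ne_zero hc
    have hx : f' (path (low c) c) = g (arr c (cnt c .q)) + f (path (low c) c) :=
      h _ _ (bit c .Y') (by rwa [innerWeight, if_pos hl] at hc)
    simp only [innerStore, Function.comp_apply, hlow, path_setBit, bit_setBit,
      below_setBit_Y hlN hl, hx, add_assoc]
  · simp only [Function.comp_apply]
    rw [rest_dec_clear_eq_iff, rest_dec_clear_eq_iff, cnt_setBit, cnt_setBit, hlow]
    refine and_congr_right fun _ => forall₂_congr fun v hv => ?_
    have hY : v ≠ bitVar .Y := fun e => hv (e ▸ Y_mem_frameVars _)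
    rw [setBit_apply_of_ne hY, setBit_apply_of_ne hY]

end RQFS


/-! ## Conjugation of terms -/

section conj

theorem dual_map_mul (E : List (Op S)) (A L : Op S) :
    dual (E.map (· * L)) A = Lᴴ * dual E A * L := by
  induction E with
  | nil => simp [dual]
  | cons K E ih =>
    simp only [dual, List.map_cons, List.sum_cons, Matrix.conjTranspose_mul] at ih ⊢
    rw [ih, mul_add, add_mul]
    simp only [mul_assoc]

/-- The term denoting `L† P L`. -/
def PQPT.conj (P : PQPT S) (L : Op S) (h : Lᴴ * L = 1) : PQPT S where
  params := P.params
  disj := P.disj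
  E := P.E.map (· * L)
  F := P.F.map (· * L)
  bound := by
    rw [dual_map_mul, dual_map_mul, ← add_mul, ← mul_add]
    simpa only [mul_one, h] using P.bound.conj L

theorem PQPT.conj_den (P : PQPT S) (L : Op S) (h : Lᴴ * L = 1) (v : PVar S → Op S) :
    (P.conj L h).den v = Lᴴ * P.den v * L := by
  simp only [PQPT.den, PQPT.conj]
  rw [dual_map_mul, dual_map_mul, ← add_mul, ← mul_add]

variable {ι : Type} {Γ : ι → S.Ty} {q : Refs S Γ}

theorem setAt_setAt (hq : Distinct q) (c : Conf S) (u w : Vals S Γ) :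
    setAt q (setAt q c u) w = setAt q c w := by
  have h : ∀ v, (∀ i, v ≠ targetAt q (setAt q (setAt q c u) w) i) →
      setAt q (setAt q c u) w v = c v := fun v hv => by
    rw [targetAt_setAt hq] at hv
    rw [setAt_of_ne hv]
    rw [targetAt_setAt hq] at hv
    rw [setAt_of_ne hv]
  have := (eq_setAt_iff hq).1 h
  rwa [readAt_setAt hq] at this

theorem setAt_readAt (hq : Distinct q) (c : Conf S) : setAt q c (readAt q c) = c :=
  ((eq_setAt_iff hq).1 fun _ _ => rfl).symm

theorem eq_of_setAt_eq (hq : Distinct q) {c c' : Conf S} {u : Vals S Γ}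
    (h : setAt q c u = setAt q c' u) (hr : readAt q c = readAt q c') : c = c' := by
  rw [← setAt_readAt hq c, ← setAt_setAt hq c u, h, setAt_setAt hq, hr, setAt_readAt hq]

variable [Finite ι]

theorem lift_isometry (hq : Distinct q) {U : Matrix (Vals S Γ) (Vals S Γ) ℂ}
    (h : Uᴴ * U = 1) : (lift q U)ᴴ * lift q U = 1 := by
  ext x c
  rw [mul_lift_apply hq, lift_conjTranspose hq]
  simp only [lift_apply hq, setAt_setAt hq, readAt_setAt hq, ite_mul, zero_mul]
  by_cases hx : x = setAt q c (readAt q x)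
  · simp only [if_pos hx]
    rw [← Matrix.mul_apply, h, Matrix.one_apply, Matrix.one_apply]
    refine if_congr ⟨fun e => ?_, fun e => by rw [e]⟩ rfl rfl
    rw [hx, e]
    exact ((eq_setAt_iff hq).1 fun _ _ => rfl).symm
  · simp only [if_neg hx, Finset.sum_const_zero]
    refine (Matrix.one_apply_ne fun e => hx ?_).symm
    rw [e]
    exact (eq_setAt_iff hq).1 fun _ _ => rfl

theorem QBE.unit_conj {D : Decl S} {T : Set (PQPT S × PQPT S)} {A : Set (Triple S)}
    {U : Matrix (Vals S Γ) (Vals S Γ) ℂ} (hq : Distinct q) (hU : U * Uᴴ = 1 ∧ Uᴴ * U = 1)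
    (P : PQPT S) : QBE D T A (P.conj (lift q U) (lift_isometry hq hU.2)) (.unit q U) P :=
  QBE.unit hq hU rfl fun _ _ => PQPT.conj_den _ _ _ _

/-- The predicate `L† Q L` is denoted by a term, `PQPT.conj`, so (A Unit) applies to it and (R
Order) supplies the inequality. -/
theorem QBE.unit_order {D : Decl S} {A : Set (Triple S)}
    {U : Matrix (Vals S Γ) (Vals S Γ) ℂ} (hq : Distinct q) (hU : U * Uᴴ = 1 ∧ Uᴴ * U = 1)
    {P Q : PQPT S} (hp : P.Params = Q.Params)
    (h : ∀ v, IsAssignment v → Loewner (P.den v) ((lift q U)ᴴ * Q.den v * lift q U)) :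
    QBE D (trueOrder S) A P (.unit q U) Q :=
  QBE.of_order (P' := Q.conj (lift q U) (lift_isometry hq hU.2)) hp
    (fun v hv => by rw [PQPT.conj_den]; exact h v hv) (QBE.unit_conj hq hU Q) rfl
    fun _ _ => Loewner.refl _

end conj

namespace RQFS

variable {n m N l : ℕ} {enc : List (Str n) × List (ZMod 2) → Fin N → Str n}

/-! ## Amplitudes -/

theorem pauliX_apply (a b : ZMod 2) : pauliX a b = if a = b + 1 then 1 else 0 := rfl

theorem pauliX_unitary : pauliX * pauliXᴴ = 1 :=
  (basisMap_unitary fun _ _ h => add_right_cancel h).1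

theorem pauliX_mul_hadamard (y : ZMod 2) : (pauliX * hadamard) 0 y = hadamard 1 y := by
  rw [Matrix.mul_apply, sum_zmod_two]
  simp [pauliX_apply, show (1 + 1 : ZMod 2) = 0 from rfl]

theorem sum_hadamard_mul_pauliX (y : ZMod 2) :
    ∑ b, hadamard 1 b * (hadamard * pauliX) b y = if y = 0 then 1 else 0 := by
  rw [← Matrix.mul_apply, ← Matrix.mul_assoc, hadamard_mul_self, one_mul, pauliX_apply]
  rcases zmod_two_cases y with rfl | rfl <;> simp [show (1 + 1 : ZMod 2) = 0 from rfl]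

/-- The Fourier transform of the string `a`, with the target in the state `H|1⟩`. -/
def fourierAmp (a : List (Str n) → Str n) (x : Str n) (xs : List (Str n)) (y : ZMod 2) : ℂ :=
  hadamardN n (a xs) x * hadamard 1 y

/-- The string `a`, with the target in the state `H|1⟩`. -/
def secretAmp (a : List (Str n) → Str n) (x : Str n) (xs : List (Str n)) (y : ZMod 2) : ℂ :=
  (if a xs = x then 1 else 0) * hadamard 1 y

/-- The zero state. -/
def zeroAmp (x : Str n) (_ : List (Str n)) (y : ZMod 2) : ℂ :=
  (if 0 = x then 1 else 0) * if y = 0 then 1 else 0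

theorem normalized_of_mul {a : List (Str n) → Str n → ℂ} {b : ZMod 2 → ℂ}
    (ha : ∀ xs, ∑ x, star (a xs x) * a xs x = 1) (hb : ∑ y, star (b y) * b y = 1) :
    Normalized fun x xs y => a xs x * b y := by
  intro xs
  have h : (∑ x, star (a xs x) * a xs x) * ∑ y, star (b y) * b y = 1 := by
    rw [ha, hb, one_mul]
  rw [← h, Finset.sum_mul_sum]
  refine Finset.sum_congr rfl fun x _ => Finset.sum_congr rfl fun y _ => ?_
  rw [star_mul']
  ring

theorem fourierAmp_normalized (a : List (Str n) → Str n) : Normalized (fourierAmp a) :=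
  normalized_of_mul (fun xs => sum_hadamardN_sq (a xs)) (sum_hadamard_sq 1)

theorem secretAmp_normalized (a : List (Str n) → Str n) : Normalized (secretAmp a) :=
  normalized_of_mul (fun xs => by simp) (sum_hadamard_sq 1)

theorem zeroAmp_normalized : Normalized (zeroAmp (n := n)) :=
  normalized_of_mul (fun xs => by simp) (by simp)

theorem fourierAmp_secretAmp (a : List (Str n) → Str n) (x : Str n) (xs : List (Str n))
    (y : ZMod 2) : fourierAmp a x xs y = ∑ z, secretAmp a z xs y * hadamardN n z x := by
  simp only [secretAmp, fourierAmp, ite_mul, one_mul, zero_mul, Finset.sum_ite_eq,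
    Finset.mem_univ, if_true]
  ring

theorem secretAmp_fourierAmp (a : List (Str n) → Str n) (x : Str n) (xs : List (Str n))
    (y : ZMod 2) : secretAmp a x xs y = ∑ z, fourierAmp a z xs y * hadamardN n z x := by
  have h : ∑ z, hadamardN n (a xs) z * hadamardN n z x = if a xs = x then 1 else 0 := by
    rw [← Matrix.mul_apply, hadamardN_mul_self, Matrix.one_apply]
  rw [secretAmp, ← h, Finset.sum_mul]
  exact Finset.sum_congr rfl fun z _ => by rw [fourierAmp]; ring

/-- The Hadamard gates cancel those in the amplitude, and the Pauli gate turns `⟨1|` into `⟨0|`. -/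
theorem zeroAmp_fourierAmp (x : Str n) (xs : List (Str n)) (y : ZMod 2) :
    zeroAmp x xs y = ∑ z, ∑ b, fourierAmp (fun _ => 0) z xs b *
      Matrix.kroneckerMap (· * ·) (hadamardN n) (hadamard * pauliX) (z, b) (x, y) := by
  have h : ∑ z, hadamardN n 0 z * hadamardN n z x = if 0 = x then 1 else 0 := by
    rw [← Matrix.mul_apply, hadamardN_mul_self, Matrix.one_apply]
  rw [zeroAmp, ← h, ← sum_hadamard_mul_pauliX, Finset.sum_mul_sum]
  refine Finset.sum_congr rfl fun z _ => Finset.sum_congr rfl fun b _ => ?_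
  rw [fourierAmp, Matrix.kroneckerMap_apply]
  ring

/-- Phase kickback. -/
theorem fourierAmp_kickback {h : List (Str n) → ZMod 2} {a : List (Str n) → Str n} {x : Str n}
    {xs : List (Str n)} (hx : h (x :: xs) = a xs ⬝ᵥ x) (y : ZMod 2) :
    fourierAmp a x xs y = fourierAmp (fun _ => 0) x xs (y + h (x :: xs)) := by
  rw [fourierAmp, fourierAmp, hadamard_one_add, hx, hadamardN_eq_sgn]
  ring

/-- The phase is a sign and squares to `1`, so the same call that creates it also removes it. This
direction serves the first call, `fourierAmp_kickback` the second. -/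
theorem fourierAmp_kickback' {h : List (Str n) → ZMod 2} {a : List (Str n) → Str n} {x : Str n}
    {xs : List (Str n)} (hx : h (x :: xs) = a xs ⬝ᵥ x) (y : ZMod 2) :
    fourierAmp (fun _ => 0) x xs y = fourierAmp a x xs (y + h (x :: xs)) := by
  rw [fourierAmp, fourierAmp, hadamard_one_add, hx, hadamardN_eq_sgn (a xs)]
  linear_combination (-(hadamardN n 0 x) * hadamard 1 y) * sgn_mul_self (a xs ⬝ᵥ x)

theorem kron_unitary {U : Matrix (ZMod 2) (ZMod 2) ℂ} (h : U * Uᴴ = 1) :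
    Matrix.kroneckerMap (· * ·) (hadamardN n) U *
      (Matrix.kroneckerMap (· * ·) (hadamardN n) U)ᴴ = 1 :=
  kronecker_unitary hadamardN_unitary h

/-! ## The local block -/

theorem innerStore_eq (h : List (Str n) → ZMod 2) :
    (innerStore enc h : Conf (sig n m N) → Conf (sig n m N)) =
      (fun c => emb (enc (flip h (data c)))) ∘ dec := by
  funext c
  rw [Function.comp_apply, data_dec]
  rfl

theorem middle_bound (henc : Set.InjOn enc (IsStack l)) (h : List (Str n) → ZMod 2) :
    Loewner (frame (rest ∘ dec) (innerStore enc h)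
      (fun c : Conf (sig n m N) => if low c < l then 1 else 0) 1) 1 := by
  rw [innerStore_eq]
  exact frame_bound_comp (spec_bound (m := m) henc (Nat.le_succ l) h) dec_injective

/-- The specification at the levels below `l`, with the counter `q` raised by one. -/
def middleTerm (m : ℕ) (henc : Set.InjOn enc (IsStack l)) (h : List (Str n) → ZMod 2) :
    PQPT (sig n m N) :=
  frameTerm (store n m N) (rest ∘ dec) (innerStore enc h)
    (fun c => if low c < l then 1 else 0) (middle_bound henc h)

theorem middleTerm_eq (henc : Set.InjOn enc (IsStack l)) (h : List (Str n) → ZMod 2)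
    (v : PVar (sig n m N) → Op (sig n m N)) : (middleTerm m henc h).den v =
      ((specTerm m henc (Nat.le_succ l) h).den v).submatrix dec dec := by
  rw [middleTerm, specTerm, frameTerm_den, frameTerm_den, ← frame_comp, innerStore_eq]
  rfl

/-- With the counter raised, `X[q]` lies just above the caller's strings, and `Y'` is never a stack
qubit. Both belong to the rest, so (R Loc) applies without renaming. -/
theorem middleTerm_fresh (hlm : l < 2 ^ m) (henc : Set.InjOn enc (IsStack l))
    (h : List (Str n) → ZMod 2) :
    Fresh (pairRef (Xq n m N) (Y' n m N)) (middleTerm m henc h) := by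
  refine ⟨fun X hX x i => ?_, fun v _ B => ?_⟩
  · rw [middleTerm, frameTerm_Params, Set.mem_singleton_iff] at hX
    subst hX
    rintro ⟨j, hj⟩
    cases i
    · exact strVar_ne_arrVar _ _ hj
    · exact bitVar_ne_strVar _ _ hj.symm
  · rw [middleTerm, frameTerm_den]
    exact (untouched_local hlm h).commute Xq_Y'_distinct B _

theorem zeroAmp_setLocal (hlm : l < 2 ^ m) (c : Conf (sig n m N)) :
    innerWeight l zeroAmp (setLocal c 0 0) = if low c < l then 1 else 0 := by
  rw [innerWeight_setLocal hlm]
  simp [zeroAmp]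

section

variable {D : Decl (sig n m N)} {A : Set (Triple (sig n m N))}

theorem middle_init (henc : Set.InjOn enc (IsStack l)) (hN : 0 < N) (hlN : l ≤ N)
    (hlm : l < 2 ^ m) (f : List (Str n) → ZMod 2) {T : Set (PQPT (sig n m N) × PQPT (sig n m N))} :
    QBE D T A (middleTerm m henc f) (.init (pairRef (Xq n m N) (Y' n m N)))
      (innerTerm henc hN hlN hlm zeroAmp_normalized f) := by
  refine QBE.init Xq_Y'_distinct ((frameTerm_Params _ _).trans (frameTerm_Params _ _).symm)
    fun v _ => ?_
  rw [middleTerm, innerTerm, frameTerm_den, frameTerm_den]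
  refine ((untouched_local hlm f).init Xq_Y'_distinct (fun c => ?_) _).symm
  exact (congrArg (innerWeight l zeroAmp) (setAt_Xq_Y' c _)).trans (zeroAmp_setLocal hlm c)

/-- The zero values of the local variables. -/
def zeroLocal : Vals (sig n m N) (pairTy (S := sig n m N) Ty.str Ty.bit) :=
  fun i => (sig n m N).zero (pairTy (S := sig n m N) Ty.str Ty.bit i)

theorem gate₂_zeroLocal (c : Conf (sig n m N)) (U : Matrix (ZMod 2) (ZMod 2) ℂ) :
    gate₂ (S := sig n m N) (τ₁ := Ty.str) (τ₂ := Ty.bit)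
      (Matrix.kroneckerMap (· * ·) (hadamardN n) U) zeroLocal
        (readAt (pairRef (Xq n m N) (Y' n m N)) c) =
      hadamardN n 0 (arr c (cnt c .q)) * U 0 (bit c .Y') := rfl

/-- The postcondition leaves the local variables arbitrary. Requiring them to end in `|0⟩` is
stronger, and `⟨0|` pulled back through the gates is the Fourier amplitude of the zero string. -/
theorem inner_discard (henc : Set.InjOn enc (IsStack l)) (hN : 0 < N) (hlN : l ≤ N)
    (hlm : l < 2 ^ m) (f : List (Str n) → ZMod 2) :
    QBE D (trueOrder _) A (innerTerm henc hN hlN hlm (fourierAmp_normalized fun _ => 0) f)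
      (.unit (pairRef (Xq n m N) (Y' n m N)) (gate₂ (S := sig n m N) (τ₁ := Ty.str)
        (τ₂ := Ty.bit) (Matrix.kroneckerMap (· * ·) (hadamardN n) (pauliX * hadamard))))
      (middleTerm m henc f) := by
  refine QBE.unit_order Xq_Y'_distinct (@gate₂_unitary (sig n m N) Ty.str Ty.bit
    (inferInstanceAs (Fintype (Str n))) (inferInstanceAs (DecidableEq (Str n)))
    (inferInstanceAs (Fintype (ZMod 2))) (inferInstanceAs (DecidableEq (ZMod 2))) _
    (kron_unitary (mul_unitary pauliX_unitary hadamard_isUnitary.1)))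
    ((frameTerm_Params _ _).trans (frameTerm_Params _ _).symm) fun v hv => ?_
  have h₁ : ∀ c : Conf (sig n m N), (rest ∘ dec ∘ clear) c = (rest ∘ dec)
      (setAt (pairRef (Xq n m N) (Y' n m N)) c zeroLocal) :=
    fun c => (congrArg (rest ∘ dec) (setAt_Xq_Y' c zeroLocal)).symm
  have h₂ : ∀ c : Conf (sig n m N), innerWeight l (fourierAmp fun _ => 0) c =
      (if low c < l then 1 else 0) * gate₂ (S := sig n m N) (τ₁ := Ty.str)
        (τ₂ := Ty.bit) (Matrix.kroneckerMap (· * ·) (hadamardN n) (pauliX * hadamard)) zeroLocal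
          (readAt (pairRef (Xq n m N) (Y' n m N)) c) := fun c => by
    refine Eq.trans ?_ (congrArg ((if low c < l then 1 else 0) * ·)
      (gate₂_zeroLocal c (pauliX * hadamard)).symm)
    simp only [pauliX_mul_hadamard, innerWeight, fourierAmp, ite_mul, one_mul, zero_mul]
  rw [middleTerm, innerTerm, frameTerm_den, frameTerm_den]
  exact (untouched_local hlm f).loewner Xq_Y'_distinct h₁ _ h₂ (hv.posSemidef _)

end

theorem local_block {A : Set (Triple (sig n m N))} {g : Str n → ZMod 2}
    {s : List (Str n) → Str n} (henc : Set.InjOn enc (IsStack l)) (hN : 0 < N) (hlN : l ≤ N)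
    (hlm : l < 2 ^ m)
    (hs : ∀ xs : List (Str n), xs.length < l → ∀ x : Str n, g (s (xs ++ [x])) = s xs ⬝ᵥ x)
    (hA : (⟨specTerm m henc le_rfl fun xs => g (s xs.reverse), .call () (args n m N .q .Y),
      specTerm m henc le_rfl fun _ => 0⟩ : Triple (sig n m N)) ∈ A) :
    QBE (decl n m N l hlm g s) (trueOrder _) A (middleTerm m henc fun xs => g (s xs.reverse))
      (.loc (pairRef (Xq n m N) (Y' n m N)) (localBody n m N g))
      (middleTerm m henc fun _ => 0) := by
  -- Paths list the newest string first, whereas `s` expects it last; hence the reversals.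
  have hk : ∀ (x : Str n) (xs : List (Str n)), xs.length < l →
      (fun xs : List (Str n) => g (s xs.reverse)) (x :: xs) = s xs.reverse ⬝ᵥ x := by
    intro x xs h
    simp only [List.reverse_cons]
    exact hs _ (by simpa using h) x
  -- Once the string is the secret itself, `g x` is precisely the bit the specification asks for,
  -- and nothing remains to be added.
  have hf : ∀ x xs y, secretAmp (fun xs => s xs.reverse) x xs y ≠ 0 →
      g (s xs.reverse) = g x + 0 := by
    intro x xs y hx
    have : s xs.reverse = x := by
      by_contra h
      exact hx (by rw [secretAmp, if_neg h, zero_mul])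
    rw [this, add_zero]
  have h₀ := middle_init (D := decl n m N l hlm g s) (A := A) (T := trueOrder _) henc hN hlN hlm
    fun xs => g (s xs.reverse)
  have h₁ := inner_pair (D := decl n m N l hlm g s) (A := A) (T := trueOrder _) henc hN hlN hlm
    (fourierAmp_normalized fun _ => 0) zeroAmp_normalized (fun xs => g (s xs.reverse))
    (kron_unitary (mul_unitary hadamard_isUnitary.1 pauliX_unitary)) zeroAmp_fourierAmp
  have h₂ := inner_call (g := g) (s := s) (T := trueOrder _) (f := fun xs => g (s xs.reverse))
    (h := fun xs => g (s xs.reverse)) henc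
    hN hlN hlm (fourierAmp_normalized fun xs => s xs.reverse) (fourierAmp_normalized fun _ => 0) hA
    fun x xs y hx => fourierAmp_kickback' (h := fun xs => g (s xs.reverse))
      (a := fun xs => s xs.reverse) (hk x xs hx) y
  have h₃ := inner_hadamard (D := decl n m N l hlm g s) (A := A) (T := trueOrder _) henc hN hlN hlm
    (secretAmp_normalized fun xs => s xs.reverse) (fourierAmp_normalized fun xs => s xs.reverse)
    (fun xs => g (s xs.reverse)) (fourierAmp_secretAmp _)
  have h₄ := inner_oracle (D := decl n m N l hlm g s) (A := A) (T := trueOrder _) henc hN hlN hlm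
    (secretAmp_normalized fun xs => s xs.reverse) hf
  have h₅ := inner_hadamard (D := decl n m N l hlm g s) (A := A) (T := trueOrder _) henc hN hlN hlm
    (fourierAmp_normalized fun xs => s xs.reverse) (secretAmp_normalized fun xs => s xs.reverse)
    (fun _ => 0) (secretAmp_fourierAmp _)
  have h₆ := inner_call (g := g) (s := s) (T := trueOrder _) (f := fun _ => 0)
    (h := fun xs => g (s xs.reverse)) henc
    hN hlN hlm (fourierAmp_normalized fun _ => 0) (fourierAmp_normalized fun xs => s xs.reverse) hA
    fun x xs y hx => fourierAmp_kickback (h := fun xs => g (s xs.reverse))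
      (a := fun xs => s xs.reverse) (hk x xs hx) y
  have h₇ := inner_discard (D := decl n m N l hlm g s) (A := A) henc hN hlN hlm fun _ => 0
  refine QBE.loc_self Xq_Y'_distinct (middleTerm_fresh hlm henc _) (middleTerm_fresh hlm henc _) ?_
  exact h₀.comp (h₁.comp (h₂.comp (h₃.comp (h₄.comp (h₅.comp (h₆.comp h₇))))))

end RQFS


theorem setAt_eq {S : Sig} {ι : Type} {Γ : ι → S.Ty} {q : Refs S Γ} (hq : Distinct q)
    {c x : Conf S} {u : Vals S Γ} (h₁ : ∀ i, x (targetAt q c i) = u i)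
    (h₂ : ∀ v, (∀ i, v ≠ targetAt q c i) → x v = c v) : setAt q c u = x := by
  funext v
  by_cases h : ∃ i, v = targetAt q c i
  · obtain ⟨i, rfl⟩ := h
    rw [setAt_target hq, h₁]
  · push Not at h
    rw [setAt_of_ne h, h₂ v h]

namespace RQFS

variable {n m N l : ℕ} {enc : List (Str n) × List (ZMod 2) → Fin N → Str n}

/-! ## The branches of the procedure body -/

section

variable {D : Decl (sig n m N)} {T : Set (PQPT (sig n m N) × PQPT (sig n m N))}
  {A : Set (Triple (sig n m N))}

theorem conj_lift_q {U : Matrix (Fin (2 ^ m)) (Fin (2 ^ m)) ℂ} {f : Fin (2 ^ m) → Fin (2 ^ m)}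
    (hU : U = basisMap f) (B : Op (sig n m N)) :
    (lift (oneRef (q n m N)) (gate₁ (S := sig n m N) (τ := Ty.cnt) U))ᴴ * B *
      lift (oneRef (q n m N)) (gate₁ (S := sig n m N) (τ := Ty.cnt) U) =
    B.submatrix (fun c => setCnt c .q (f (cnt c .q))) fun c => setCnt c .q (f (cnt c .q)) := by
  subst hU
  have hG := @gate₁_basisMap (sig n m N) Ty.cnt (inferInstanceAs (DecidableEq (Fin (2 ^ m)))) f
  refine (congrArg (fun G => (lift (oneRef (q n m N)) G)ᴴ * B * lift (oneRef (q n m N)) G)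
    hG).trans ?_
  refine (conj_lift_basisMap q_distinct _ B).trans ?_
  have e : ∀ c : Conf (sig n m N), setAt (oneRef (q n m N)) c
      (fun _ => f (readAt (oneRef (q n m N)) c ())) = setCnt c .q (f (cnt c .q)) :=
    fun c => setAt_q c _
  exact congrArg (fun φ => B.submatrix φ φ) (funext e)

theorem gate₁_cnt_unitary {U : Matrix (Fin (2 ^ m)) (Fin (2 ^ m)) ℂ}
    {f : Fin (2 ^ m) → Fin (2 ^ m)} (hU : U = basisMap f) (hf : Function.Injective f) :
    gate₁ (S := sig n m N) (τ := Ty.cnt) U * (gate₁ (S := sig n m N) (τ := Ty.cnt) U)ᴴ = 1 ∧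
      (gate₁ (S := sig n m N) (τ := Ty.cnt) U)ᴴ * gate₁ (S := sig n m N) (τ := Ty.cnt) U = 1 :=
  @gate₁_unitary (sig n m N) Ty.cnt (inferInstanceAs (Fintype (Fin (2 ^ m))))
    (inferInstanceAs (DecidableEq (Fin (2 ^ m)))) _ (hU ▸ (basisMap_unitary hf).1)

theorem unit_plusOne (henc : Set.InjOn enc (IsStack l)) (h : List (Str n) → ZMod 2) :
    QBE D T A (specTerm m henc (Nat.le_succ l) h)
      (.unit (oneRef (q n m N)) (gate₁ (S := sig n m N) (τ := Ty.cnt) (plusOne m)))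
      (middleTerm m henc h) := by
  refine QBE.unit q_distinct (gate₁_cnt_unitary rfl (finRotate (2 ^ m)).injective)
    ((frameTerm_Params _ _).trans (frameTerm_Params _ _).symm) fun v _ => ?_
  refine Eq.trans ?_ (conj_lift_q rfl _).symm
  rw [middleTerm_eq, Matrix.submatrix_submatrix]
  have e : (dec ∘ fun c : Conf (sig n m N) => setCnt c .q (finRotate (2 ^ m) (cnt c .q))) = id :=
    funext dec_inc
  rw [e, Matrix.submatrix_id_id]

theorem unit_minusOne (henc : Set.InjOn enc (IsStack l)) (h : List (Str n) → ZMod 2) :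
    QBE D T A (middleTerm m henc h)
      (.unit (oneRef (q n m N)) (gate₁ (S := sig n m N) (τ := Ty.cnt) (minusOne m)))
      (specTerm m henc (Nat.le_succ l) h) := by
  refine QBE.unit q_distinct (gate₁_cnt_unitary rfl (finRotate (2 ^ m)).symm.injective)
    ((frameTerm_Params _ _).trans (frameTerm_Params _ _).symm) fun v _ => ?_
  exact (middleTerm_eq henc h v).trans (conj_lift_q rfl _).symm

end

/-- The rest records the counter, so every Kraus operator belongs to one level, and lowering `L`
deletes whole Kraus operators. -/
theorem specTerm_mono (henc : Set.InjOn enc (IsStack l)) {L L' : ℕ} (hL : L ≤ l + 1)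
    (hL' : L' ≤ l + 1) (hLL' : L ≤ L') (h : List (Str n) → ZMod 2)
    {v : PVar (sig n m N) → Op (sig n m N)} (hv : IsAssignment v) :
    Loewner ((specTerm m henc hL h).den v) ((specTerm m henc hL' h).den v) := by
  rw [specTerm, specTerm, frameTerm_den, frameTerm_den, frame_eq_sum, frame_eq_sum]
  refine loewner_sum_conj_of_sub (hv.posSemidef _) fun r => ?_
  have key : ∀ {c : Conf (sig n m N)}, rest c = r → level c = level r := fun {c} e => by
    have := (rest_of_notMem (cntVar_notMem_frameVars .q (level c))).symm.trans
      (congrFun e (cntVar .q))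
    exact congrArg Fin.val this
  by_cases hr : level r < L
  · refine Or.inl ?_
    ext e c
    simp only [frameKraus, Matrix.of_apply]
    refine if_ctx_congr Iff.rfl (fun hc => ?_) fun _ => rfl
    rw [key hc.2, if_pos hr, if_pos (by omega)]
  · refine Or.inr ?_
    ext e c
    simp only [frameKraus, Matrix.of_apply]
    split_ifs with h₁ h₂
    · exact absurd (key h₁.2 ▸ h₂) hr
    · rfl
    · rfl

theorem branch_zero {A : Set (Triple (sig n m N))} {g : Str n → ZMod 2}
    {s : List (Str n) → Str n} (henc : Set.InjOn enc (IsStack l)) (hN : 0 < N) (hlN : l ≤ N)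
    (hlm : l < 2 ^ m)
    (hs : ∀ xs : List (Str n), xs.length < l → ∀ x : Str n, g (s (xs ++ [x])) = s xs ⬝ᵥ x)
    (hA : (⟨specTerm m henc le_rfl fun xs => g (s xs.reverse), .call () (args n m N .q .Y),
      specTerm m henc le_rfl fun _ => 0⟩ : Triple (sig n m N)) ∈ A) :
    QBE (decl n m N l hlm g s) (trueOrder _) A
      (specTerm m henc (Nat.le_succ l) fun xs => g (s xs.reverse)) (branch n m N l hlm g s 0)
      (specTerm m henc le_rfl fun _ => 0) := by
  have h := (unit_plusOne henc fun xs => g (s xs.reverse)).comp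
    ((local_block henc hN hlN hlm hs hA).comp (unit_minusOne henc fun _ => 0))
  exact QBE.of_order rfl (fun _ _ => Loewner.refl _) h
    ((frameTerm_Params _ _).trans (frameTerm_Params _ _).symm)
    fun v hv => specTerm_mono henc _ _ (Nat.le_succ l) _ hv

/-! ### The oracle -/

theorem oracleMap_injective {g : Str n → ZMod 2} {s : List (Str n) → Str n} :
    Function.Injective (oracleMap n m N l g s) := by
  intro u u' h
  have h₁ : ∀ j, u (some j) = u' (some j) := fun j => congrFun h (some j)
  have h₂ : (fun j : Fin l => u (some j)) = fun j => u' (some j) := funext h₁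
  have h₃ := congrFun h none
  funext i
  cases i with
  | none =>
    have h₄ : ∀ {y y' : ZMod 2} {x x' : Fin l → Str n}, x = x' →
        y + g (s (List.ofFn x)) = y' + g (s (List.ofFn x')) → y = y' := by
      rintro y y' x _ rfl h
      exact add_right_cancel h
    exact h₄ h₂ h₃
  | some j => exact h₁ j

/-- The strings `X[1], …, X[k]`. -/
theorem ofFn_arr {k : ℕ} (hk : k < 2 ^ m) (c : Conf (sig n m N)) :
    List.ofFn (fun j : Fin k => arr c ⟨j.val + 1, by omega⟩) = (path k c).reverse := by
  induction k with
  | zero => rfl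
  | succ k ih =>
    rw [List.ofFn_succ', path, List.reverse_cons, ← ih (by omega), List.concat_eq_append]
    rw [idx_eq_mk hk]
    rfl

theorem setAt_pathRef (hlm : l < 2 ^ m) (g : Str n → ZMod 2) (s : List (Str n) → Str n)
    (c : Conf (sig n m N)) : setAt (pathRef n m N l hlm) c
      (oracleMap n m N l g s (readAt (pathRef n m N l hlm) c)) =
    setBit c .Y (bit c .Y + g (s (path l c).reverse)) := by
  refine setAt_eq (pathRef_distinct hlm) (fun i => ?_) fun v hv =>
    setBit_apply_of_ne (hv none)
  cases i with
  | none =>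
    refine (bit_setBit c .Y _).trans ?_
    rw [← ofFn_arr hlm]
    rfl
  | some j => exact setBit_apply_of_ne (bitVar_ne_arrVar _ _).symm

theorem oracleO_unitary {g : Str n → ZMod 2} {s : List (Str n) → Str n} :
    oracleO n m N l g s * (oracleO n m N l g s)ᴴ = 1 ∧
      (oracleO n m N l g s)ᴴ * oracleO n m N l g s = 1 :=
  basisMap_unitary oracleMap_injective

theorem conj_lift_oracleO (hlm : l < 2 ^ m) (g : Str n → ZMod 2) (s : List (Str n) → Str n)
    (B : Op (sig n m N)) :
    (lift (pathRef n m N l hlm) (oracleO n m N l g s))ᴴ * B *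
      lift (pathRef n m N l hlm) (oracleO n m N l g s) =
    B.submatrix (fun c => setBit c .Y (bit c .Y + g (s (path l c).reverse)))
      fun c => setBit c .Y (bit c .Y + g (s (path l c).reverse)) := by
  refine (conj_lift_basisMap (pathRef_distinct hlm) _ B).trans ?_
  exact congrArg (fun φ => B.submatrix φ φ) (funext (setAt_pathRef hlm g s))

/-- At level `l`, the oracle adds the value of the specification to the target. -/
theorem frame_setBit (hlN : l ≤ N) (h : List (Str n) → ZMod 2) {B : Op (sig n m N)}
    {c c' : Conf (sig n m N)} (hc : level c = l) (hc' : level c' = l) :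
    frame rest (fun c => emb (enc (flip (fun _ => 0) (data c))))
        (fun c => if level c < l + 1 then 1 else 0) B
        (setBit c .Y (bit c .Y + h (path l c))) (setBit c' .Y (bit c' .Y + h (path l c'))) =
      frame rest (fun c => emb (enc (flip h (data c))))
        (fun c => if level c < l + 1 then 1 else 0) B c c' := by
  have hlev : ∀ (c : Conf (sig n m N)) y, level (setBit c .Y y) = level c := fun c y =>
    congrArg Fin.val (cnt_setBit _ _ _ _)
  have hdata : ∀ {c : Conf (sig n m N)}, level c = l →
      flip (fun _ => 0) (data (setBit c .Y (bit c .Y + h (path l c)))) = flip h (data c) := by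
    intro c hc
    have hb : below l (setBit c .Y (bit c .Y + h (path l c))) = below l c :=
      below_congr fun j hj => bit_setBit_of_ne _ _ (by simp [stackBit, show j < N by omega])
    simp only [data, hlev, hc, stack_eq_cons, path_setBit, bit_setBit, hb, flip, add_zero]
  have hrest : rest (setBit c .Y (bit c .Y + h (path l c))) =
      rest (setBit c' .Y (bit c' .Y + h (path l c'))) ↔ rest c = rest c' := by
    rw [rest_eq_iff, rest_eq_iff, cnt_setBit, cnt_setBit, hlev]
    refine and_congr_right fun _ => forall₂_congr fun v hv => ?_
    have hY : v ≠ bitVar .Y := fun e => hv (e ▸ Y_mem_frameVars _)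
    rw [setBit_apply_of_ne hY, setBit_apply_of_ne hY]
  simp only [frame, Matrix.of_apply, hrest, hlev, hdata hc, hdata hc']

/-! ### The procedure -/

/-- The term `0` with parameter `store`. -/
def zeroTerm (n m N : ℕ) : PQPT (sig n m N) where
  params := [store n m N]
  disj := List.pairwise_singleton _ _
  E := []
  F := []
  bound := by
    simpa [dual, loewner_zero_iff] using Matrix.PosSemidef.one

/-- The term `I` with parameter `store`. -/
def oneTerm (n m N : ℕ) : PQPT (sig n m N) where
  params := [store n m N]
  disj := List.pairwise_singleton _ _
  E := []
  F := [1]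
  bound := by
    simpa [dual] using Loewner.refl _

theorem zeroTerm_den (v : PVar (sig n m N) → Op (sig n m N)) : (zeroTerm n m N).den v = 0 := by
  simp [PQPT.den, zeroTerm, dual]

theorem oneTerm_den (v : PVar (sig n m N) → Op (sig n m N)) : (oneTerm n m N).den v = 1 := by
  simp [PQPT.den, oneTerm, dual]

theorem zeroTerm_Params : (zeroTerm n m N).Params = {store n m N} := by
  ext Y
  simp [PQPT.Params, zeroTerm]

theorem oneTerm_Params : (oneTerm n m N).Params = {store n m N} := by
  ext Y
  simp [PQPT.Params, oneTerm]

/-- (A Bot) offers `I`, but `specTerm` vanishes above level `l`. The precondition is strengthened to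
`0`, with `store` kept as a formal parameter so that the parameters match. -/
theorem zero_bot {D : Decl (sig n m N)} {A : Set (Triple (sig n m N))} {P : PQPT (sig n m N)}
    (hP : P.Params = {store n m N}) : QBE D (trueOrder _) A (zeroTerm n m N) .bot P := by
  refine QBE.of_order (P' := oneTerm n m N) (zeroTerm_Params.trans oneTerm_Params.symm)
    (fun v _ => ?_) (QBE.bot (oneTerm_Params.trans hP.symm) fun v _ => oneTerm_den v) rfl
    fun _ _ => Loewner.refl _
  rw [zeroTerm_den, oneTerm_den]
  exact loewner_zero_iff.2 Matrix.PosSemidef.one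

/-- The measurement `M` as diagonal operators. -/
def levelProj (l : ℕ) : Fin 3 → Fin (2 ^ m) → ℂ
  | 0, i => if i.val < l then 1 else 0
  | 1, i => if i.val = l then 1 else 0
  | 2, i => if l < i.val then 1 else 0

theorem measM_eq (l : ℕ) (k : Fin 3) : measM m l k = Matrix.diagonal (levelProj l k) := by
  fin_cases k <;> rfl

theorem gate₁_measM (l : ℕ) (k : Fin 3) :
    gate₁ (S := sig n m N) (τ := Ty.cnt) (measM m l k) =
      Matrix.diagonal fun u : Vals (sig n m N) (oneTy (S := sig n m N) Ty.cnt) =>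
        levelProj l k (u ()) := by
  rw [measM_eq]
  exact @gate₁_diagonal (sig n m N) Ty.cnt (inferInstanceAs (DecidableEq (Fin (2 ^ m)))) _

theorem sum_levelProj (l : ℕ) (i : Fin (2 ^ m)) :
    ∑ k, star (levelProj l k i) * levelProj l k i = 1 := by
  rw [Fin.sum_univ_three]
  rcases lt_trichotomy i.val l with h | h | h
  · simp [levelProj, h, h.ne, h.not_gt]
  · simp [levelProj, h]
  · simp [levelProj, h, h.ne', h.not_gt]

theorem sum_measM (l : ℕ) : ∑ k, (gate₁ (S := sig n m N) (τ := Ty.cnt) (measM m l k))ᴴ *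
    gate₁ (S := sig n m N) (τ := Ty.cnt) (measM m l k) = 1 := by
  simp only [gate₁_measM, Matrix.diagonal_conjTranspose, Matrix.diagonal_mul_diagonal]
  ext u w
  rw [Matrix.sum_apply]
  by_cases h : u = w
  · subst h
    simp only [Matrix.diagonal_apply_eq, Matrix.one_apply_eq]
    exact sum_levelProj l (u ())
  · simp only [Matrix.diagonal_apply_ne _ h, Matrix.one_apply_ne h, Finset.sum_const_zero]

theorem conj_lift_measM (l : ℕ) (k : Fin 3) (B : Op (sig n m N)) (c c' : Conf (sig n m N)) :
    ((lift (oneRef (q n m N)) (gate₁ (S := sig n m N) (τ := Ty.cnt) (measM m l k)))ᴴ * B *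
      lift (oneRef (q n m N)) (gate₁ (S := sig n m N) (τ := Ty.cnt) (measM m l k))) c c' =
    star (levelProj l k (cnt c .q)) * B c c' * levelProj l k (cnt c' .q) := by
  refine (congrArg (fun G => ((lift (oneRef (q n m N)) G)ᴴ * B * lift (oneRef (q n m N)) G) c c')
    (gate₁_measM l k)).trans ?_
  exact conj_lift_diagonal q_distinct _ B c c'

/-- The preconditions of the branches. -/
def branchTerm (m : ℕ) (henc : Set.InjOn enc (IsStack l)) (hlm : l < 2 ^ m) (g : Str n → ZMod 2)
    (s : List (Str n) → Str n) : Fin 3 → PQPT (sig n m N)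
  | 0 => specTerm m henc (Nat.le_succ l) fun xs => g (s xs.reverse)
  | 1 => (specTerm m henc le_rfl fun _ => 0).conj
      (lift (pathRef n m N l hlm) (oracleO n m N l g s))
      (lift_isometry (pathRef_distinct hlm) oracleO_unitary.2)
  | 2 => zeroTerm n m N

theorem body_spec {A : Set (Triple (sig n m N))} {g : Str n → ZMod 2}
    {s : List (Str n) → Str n} (henc : Set.InjOn enc (IsStack l)) (hN : 0 < N) (hlN : l ≤ N)
    (hlm : l < 2 ^ m)
    (hs : ∀ xs : List (Str n), xs.length < l → ∀ x : Str n, g (s (xs ++ [x])) = s xs ⬝ᵥ x)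
    (hA : (⟨specTerm m henc le_rfl fun xs => g (s xs.reverse), .call () (args n m N .q .Y),
      specTerm m henc le_rfl fun _ => 0⟩ : Triple (sig n m N)) ∈ A) :
    QBE (decl n m N l hlm g s) (trueOrder _) A
      (specTerm m henc le_rfl fun xs => g (s xs.reverse))
      ((decl n m N l hlm g s).body ()) (specTerm m henc le_rfl fun _ => 0) := by
  refine QBE.case (P := branchTerm m henc hlm g s) q_distinct (sum_measM l) (fun k => ?_)
    ((frameTerm_Params _ _).trans (frameTerm_Params _ _).symm) fun v _ => ?_
  · match k with
    | 0 => exact branch_zero henc hN hlN hlm hs hA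
    | 1 => exact QBE.unit_conj (pathRef_distinct hlm) oracleO_unitary _
    | 2 => exact zero_bot (frameTerm_Params _ _)
  · ext c c'
    rw [Matrix.sum_apply, Fin.sum_univ_three, conj_lift_measM, conj_lift_measM, conj_lift_measM]
    simp only [branchTerm]
    rw [PQPT.conj_den, conj_lift_oracleO, zeroTerm_den, specTerm, specTerm, specTerm,
      frameTerm_den, frameTerm_den, frameTerm_den, Matrix.submatrix_apply, Matrix.zero_apply]
    have hl : ∀ c : Conf (sig n m N), levelProj l 1 (cnt c .q) = if level c = l then 1 else 0 :=
      fun _ => rfl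
    -- `frame_setBit` holds only at level `l`, and the measurement operator retains nothing else.
    have h₁ : ∀ M M' : ℂ, (level c = l → level c' = l → M = M') →
        star (levelProj l 1 (cnt c .q)) * M * levelProj l 1 (cnt c' .q) =
        star (levelProj l 1 (cnt c .q)) * M' * levelProj l 1 (cnt c' .q) := by
      intro M M' h
      rw [hl, hl]
      split_ifs with e e'
      · rw [h e e']
      all_goals simp
    rw [h₁ _ _ fun e e' => frame_setBit hlN (fun xs => g (s xs.reverse)) e e']
    simp only [frame, Matrix.of_apply]
    -- States with equal rests have the same counter and fall into the same branch, so the three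
    -- blocks add up to the specification without cross terms.
    by_cases hr : rest c = rest c'
    · have hq : cnt c' .q = cnt c .q := (rest_eq_iff.1 hr).1.symm
      have hq' : level c' = level c := congrArg Fin.val hq
      simp only [if_pos hr, hq, hq', levelProj]
      change _ = star (if level c < l then (1 : ℂ) else 0) * _ * (if level c < l then 1 else 0) +
        star (if level c = l then (1 : ℂ) else 0) * _ * (if level c = l then 1 else 0) +
        star (if l < level c then (1 : ℂ) else 0) * _ * (if l < level c then 1 else 0)
      rcases lt_trichotomy (level c) l with h | h | h
      · simp [h, h.ne, h.not_gt, Nat.lt_succ_of_lt h]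
      · simp [h]
      · simp [h, h.ne', h.not_gt, show ¬ level c < l + 1 by omega]
    · simp [hr]


/-! ## The main program -/

theorem call_mem_pRecTriples {g : Str n → ZMod 2} {s : List (Str n) → Str n}
    (henc : Set.InjOn enc (IsStack l)) (hN : 0 < N) (hlN : l ≤ N) (hlm : l < 2 ^ m)
    (hs : ∀ xs : List (Str n), xs.length < l → ∀ x : Str n, g (s (xs ++ [x])) = s xs ⬝ᵥ x) :
    (⟨specTerm m henc le_rfl fun xs => g (s xs.reverse), .call () (args n m N .q .Y),
      specTerm m henc le_rfl fun _ => 0⟩ : Triple (sig n m N)) ∈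
        pRecTriples (decl n m N l hlm g s) (trueOrder _) :=
  ⟨fun _ => specTerm m henc le_rfl fun xs => g (s xs.reverse),
    fun _ => specTerm m henc le_rfl fun _ => 0,
    fun _ => (frameTerm_Params _ _).trans (frameTerm_Params _ _).symm,
    fun _ => body_spec henc hN hlN hlm hs ⟨(), rfl⟩, ⟨(), rfl⟩⟩

open Classical in
theorem basis_den (p : Conf (sig n m N) → Prop) (v : PVar (sig n m N) → Op (sig n m N)) :
    (PQPT.basis p).den v = Matrix.diagonal fun c => if p c then 1 else 0 := by
  simp only [PQPT.den, PQPT.basis, PQPT.ofProjection, dual, List.map_nil, List.sum_nil,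
    List.map_cons, List.sum_cons, mul_one, zero_add, add_zero, Matrix.diagonal_conjTranspose,
    Matrix.diagonal_mul_diagonal]
  congr 1
  funext c
  by_cases h : p c <;> simp [h]

theorem strs_localTo (t : Fin N → Str n) : ∀ K ∈ (PQPT.basis fun c : Conf (sig n m N) =>
    strs c = t).F, LocalTo (Set.range strVar) K := by
  classical
  intro K hK
  rw [List.mem_singleton.1 hK]
  refine ⟨fun a b => if a = b then if (fun i => a ⟨strVar i, i, rfl⟩) = t then 1 else 0 else 0,
    fun x y => ⟨fun h => ?_, ?_⟩⟩
  · have h' : x = y ↔ (fun v : Set.range (strVar (n := n) (m := m) (N := N)) => x v.1) =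
        fun v : Set.range (strVar (n := n) (m := m) (N := N)) => y v.1 := by
      refine ⟨fun e => by rw [e], fun e => funext fun v => ?_⟩
      by_cases hv : v ∈ Set.range strVar
      · exact congrFun e ⟨v, hv⟩
      · exact h v hv
    rw [Matrix.diagonal_apply]
    refine if_congr h' ?_ rfl
    congr
  · rintro ⟨v, _, hne⟩
    exact Matrix.diagonal_apply_ne _ fun e => hne (congrFun e v)

/-- The renaming of `q` to `p`. -/
def swapCnt (N : ℕ) : Equiv.Perm (CntName N) :=
  @Equiv.swap _ (Classical.decEq _) .p .q

/-- The renaming of `Y` to `Z`. -/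
def swapBit (N : ℕ) : Equiv.Perm (BitName N) :=
  @Equiv.swap _ (Classical.decEq _) .Z .Y

theorem swapCnt_q : swapCnt N .q = .p :=
  @Equiv.swap_apply_right _ (Classical.decEq _) _ _

theorem swapBit_Y : swapBit N .Y = .Z :=
  @Equiv.swap_apply_right _ (Classical.decEq _) _ _

/-- An empty list of strings forces level `0`, so the store alone also fixes the counter. -/
theorem flip_data_eq_iff {h : List (Str n) → ZMod 2} {b : ZMod 2} {c : Conf (sig n m N)} :
    flip h (data c) = ([], [b]) ↔ level c = 0 ∧ bit c .Y + h [] = b := by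
  rw [data, stack_eq_cons, flip, Prod.mk.injEq, List.cons.injEq]
  constructor
  · rintro ⟨h₁, h₂, -⟩
    have h₃ : level c = 0 := by rw [← path_length (level c) c, h₁, List.length_nil]
    rw [h₁] at h₂
    exact ⟨h₃, h₂⟩
  · rintro ⟨h₁, h₂⟩
    rw [h₁]
    exact ⟨rfl, h₂, rfl⟩

/-- The specification of the procedure for a store that holds only the bit `b`, after renaming. -/
theorem main_den (henc : Set.InjOn enc (IsStack l)) {h : List (Str n) → ZMod 2} {b : ZMod 2}
    (v : PVar (sig n m N) → Op (sig n m N)) :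
    frame (rest ∘ Conf.pre (mkRen (swapCnt N) (swapBit N)))
      (fun c => emb (enc (flip h (data (Conf.pre (mkRen (swapCnt N) (swapBit N)) c)))))
      ((fun c => if level c < l + 1 then 1 else 0) ∘ Conf.pre (mkRen (swapCnt N) (swapBit N)))
      ((PQPT.basis fun c : Conf (sig n m N) => strs c = enc ([], [b])).den v) =
    (PQPT.basis fun c : Conf (sig n m N) => (cnt c .p).val = 0 ∧ bit c .Z + h [] = b).den v := by
  classical
  rw [basis_den, basis_den]
  refine (congrArg (fun A => Matrix.submatrix A (Conf.pre (mkRen (swapCnt N) (swapBit N)))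
    (Conf.pre (mkRen (swapCnt N) (swapBit N)))) (frame_diagonal (fun _ => indicator_cases _)
      (spec_injective henc le_rfl h) _)).trans ?_
  rw [Matrix.submatrix_diagonal _ _ (Conf.pre_injective _)]
  congr 1
  funext c
  have hl : level (Conf.pre (mkRen (swapCnt N) (swapBit N)) c) = (cnt c .p).val := by
    rw [level, cnt_pre, swapCnt_q]
  have hY : bit (Conf.pre (mkRen (swapCnt N) (swapBit N)) c) .Y = bit c .Z := by
    rw [bit_pre, swapBit_Y]
  have hstrs : ∀ t, strs (emb t : Conf (sig n m N)) = t := fun t => rfl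
  simp only [Function.comp_apply, hstrs]
  rw [← hl, ← hY]
  generalize Conf.pre (mkRen (swapCnt N) (swapBit N)) c = c
  by_cases hc : level c < l + 1
  · rw [if_pos hc, one_mul]
    have h₁ : enc (flip h (data c)) = enc ([], [b]) ↔ level c = 0 ∧ bit c .Y + h [] = b := by
      rw [henc.eq_iff (flip_mem (data_mem (by omega))) (by simp [IsStack]), flip_data_eq_iff]
    simp only [h₁]
    congr
  · rw [if_neg hc, zero_mul, if_neg]
    rintro ⟨h₀, -⟩
    omega

/-- The store is instantiated with the code of the final stack `([], [g (s [])])`. Read with the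
specification's `h`, it says that `Z + g (s [])` equals `g (s [])`, so `Z` is `0`; read with `0`, it
says that `Z` is `g (s [])`. -/
theorem main_call {A : Set (Triple (sig n m N))} {T : Set (PQPT (sig n m N) × PQPT (sig n m N))}
    {g : Str n → ZMod 2} {s : List (Str n) → Str n} (hlm : l < 2 ^ m)
    (henc : Set.InjOn enc (IsStack l))
    (hA : (⟨specTerm m henc le_rfl fun xs => g (s xs.reverse), .call () (args n m N .q .Y),
      specTerm m henc le_rfl fun _ => 0⟩ : Triple (sig n m N)) ∈ A) :
    QBE (decl n m N l hlm g s) T A (post n m N 0) (.call () (args n m N .p .Z))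
      (post n m N (g (s []))) := by
  have hpost : ∀ (h : List (Str n) → ZMod 2) (b b' : ZMod 2), b' + h [] = b →
      (PQPT.basis fun c : Conf (sig n m N) => (cnt c .p).val = 0 ∧ bit c .Z + h [] = b) =
        post n m N b' := by
    rintro h _ b' rfl
    refine congrArg PQPT.basis (funext fun c => propext (and_congr ?_ ?_))
    · exact (Fin.ext_iff (a := cnt c .p) (b := ⟨0, Nat.two_pow_pos m⟩)).symm
    · exact add_left_inj _
  have key := call_rule (hlm := hlm) (g := g) (s := s) (T := T) hA (swapCnt N) (swapBit N)
    (R := PQPT.basis fun c : Conf (sig n m N) => strs c = enc ([], [g (s [])]))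
    (P' := post n m N 0) (Q' := post n m N (g (s [])))
    ⟨fun Y hY => absurd hY List.not_mem_nil, fun K hK => absurd hK List.not_mem_nil,
      strs_localTo _⟩ rfl rfl
    (fun v _ => ((main_den henc v).trans (congrArg (fun P => PQPT.den P v)
      (hpost (fun xs => g (s xs.reverse)) (g (s [])) 0 (zero_add _)))).symm)
    fun v _ => ((main_den henc v).trans (congrArg (fun P => PQPT.den P v)
      (hpost (fun _ => 0) (g (s [])) (g (s [])) (add_zero _)))).symm
  rwa [swapCnt_q, swapBit_Y] at key

theorem main_init {D : Decl (sig n m N)} {A : Set (Triple (sig n m N))}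
    {T : Set (PQPT (sig n m N) × PQPT (sig n m N))} :
    QBE D T A (PQPT.one _) (.init (pairRef (p n m N) (Z n m N))) (post n m N 0) := by
  classical
  refine QBE.init p_Z_distinct rfl fun v _ => ?_
  have hone : (PQPT.one (sig n m N)).den v = 1 := by
    simp [PQPT.den, PQPT.one, PQPT.ofProjection, dual]
  rw [hone, post, basis_den]
  ext c c'
  refine Eq.trans ?_ (sum_conj_lift_single p_Z_distinct _ _ c c').symm
  by_cases h : c = c'
  · subst h
    rw [if_pos rfl, Matrix.diagonal_apply_eq, Matrix.one_apply_eq, if_pos]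
    have e := setAt_p_Z c fun i => (sig n m N).zero (pairTy (S := sig n m N) Ty.cnt Ty.bit i)
    exact ⟨(congrArg (fun c => cnt c .p) e).trans ((cnt_setBit _ _ _ _).trans (cnt_setCnt _ _ _)),
      (congrArg (fun c => bit c .Z) e).trans (bit_setBit _ _ _)⟩
  · rw [Matrix.one_apply_ne h]
    split_ifs with hr
    · exact (Matrix.diagonal_apply_ne _ fun e => h (eq_of_setAt_eq p_Z_distinct e hr)).symm
    · rfl

/-- The diagonal of `|k⟩⟨k|`. -/
def bitProj (k i : ZMod 2) : ℂ := if i = k then 1 else 0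

theorem gate₁_measZ (k : ZMod 2) : gate₁ (S := sig n m N) (τ := Ty.bit) (measZ k) =
    Matrix.diagonal fun u : Vals (sig n m N) (oneTy (S := sig n m N) Ty.bit) =>
      bitProj k (u ()) := by
  have h : measZ k = Matrix.diagonal (bitProj k) := by
    rw [measZ, ← Matrix.diagonal_single]
    congr 1
    funext i
    simp [bitProj, Pi.single_apply]
  rw [h]
  exact @gate₁_diagonal (sig n m N) Ty.bit (inferInstanceAs (DecidableEq (ZMod 2))) _

theorem sum_bitProj (i : ZMod 2) : ∑ k, star (bitProj k i) * bitProj k i = 1 := by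
  simp [bitProj]

theorem sum_measZ : ∑ k : ZMod 2, (gate₁ (S := sig n m N) (τ := Ty.bit) (measZ k))ᴴ *
    gate₁ (S := sig n m N) (τ := Ty.bit) (measZ k) = 1 := by
  simp only [gate₁_measZ, Matrix.diagonal_conjTranspose, Matrix.diagonal_mul_diagonal]
  ext u w
  rw [Matrix.sum_apply]
  by_cases h : u = w
  · subst h
    simp only [Matrix.diagonal_apply_eq, Matrix.one_apply_eq]
    exact sum_bitProj (u ())
  · simp only [Matrix.diagonal_apply_ne _ h, Matrix.one_apply_ne h, Finset.sum_const_zero]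

/-- The assertion is diagonal in the measured basis, so the measurement does not change it. -/
theorem main_measure {D : Decl (sig n m N)} {A : Set (Triple (sig n m N))}
    {T : Set (PQPT (sig n m N) × PQPT (sig n m N))} (b : ZMod 2) :
    QBE D T A (post n m N b) (.case (oneRef (Z n m N))
      (fun k : ZMod 2 => gate₁ (S := sig n m N) (τ := Ty.bit) (measZ k)) fun _ => .skip)
      (post n m N b) := by
  classical
  refine QBE.case (P := fun _ => post n m N b) Z_distinct sum_measZ (fun _ => QBE.skip) rfl
    fun v _ => ?_
  rw [post, basis_den]
  ext c c'
  have h : ∀ (k : ZMod 2) (B : Op (sig n m N)),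
      ((lift (oneRef (Z n m N)) (gate₁ (S := sig n m N) (τ := Ty.bit) (measZ k)))ᴴ * B *
        lift (oneRef (Z n m N)) (gate₁ (S := sig n m N) (τ := Ty.bit) (measZ k))) c c' =
      star (bitProj k (bit c .Z)) * B c c' * bitProj k (bit c' .Z) := by
    intro k B
    refine (congrArg (fun G => ((lift (oneRef (Z n m N)) G)ᴴ * B *
      lift (oneRef (Z n m N)) G) c c') (gate₁_measZ k)).trans ?_
    exact conj_lift_diagonal Z_distinct _ B c c'
  rw [Matrix.sum_apply]
  simp only [h]
  by_cases hc : c = c'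
  · subst hc
    simp only [mul_right_comm _ (Matrix.diagonal _ c c), ← Finset.sum_mul, sum_bitProj, one_mul]
  · simp only [Matrix.diagonal_apply_ne _ hc, mul_zero, zero_mul, Finset.sum_const_zero]

end RQFS

end QHL

end

theorem mainTheorem11 (n m l : ℕ) (hn : 0 < n) (hl : 0 < l) (hlm : l < 2 ^ m)
    (g : QHL.RQFS.Str n → ZMod 2) (s : List (QHL.RQFS.Str n) → QHL.RQFS.Str n)
    (hs : ∀ xs : List (QHL.RQFS.Str n), xs.length < l → ∀ x : QHL.RQFS.Str n,
      g (s (xs ++ [x])) = s xs ⬝ᵥ x) :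
    ∃ N₀ : ℕ, ∀ N : ℕ, N₀ ≤ N →
      QHL.QPP (QHL.RQFS.decl n m N l hlm g s) (QHL.trueOrder (QHL.RQFS.sig n m N))
        (QHL.PQPT.one (QHL.RQFS.sig n m N)) (QHL.RQFS.main n m N)
        (QHL.RQFS.post n m N (g (s []))) := by
  obtain ⟨N₀, hN₀⟩ := QHL.RQFS.exists_encoding n l hn
  -- The bound `N₀` provides strings for the encoding, and `l` provides qubits for the targets of up
  -- to `l` callers; since `l > 0`, it also gives the `N > 0` needed for `shift`.
  refine ⟨max N₀ l, fun N hN => ?_⟩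
  obtain ⟨enc, henc⟩ := hN₀ N (le_of_max_le_left hN)
  have hlN : l ≤ N := le_of_max_le_right hN
  exact QHL.RQFS.main_init.comp ((QHL.RQFS.main_call hlm henc
    (QHL.RQFS.call_mem_pRecTriples henc (hl.trans_le hlN) hlN hlm hs)).comp
      (QHL.RQFS.main_measure _))
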